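/- **Network.** Let $\mathcal N$ and $\mathcal F$ be finite sets of nodes and flows, with a symmetric neighbourhood relation $m\in\mathcal A(n)$, and disjoint sets $\mathcal S_f,\mathcal D_f\subset\mathcal N$ of sources and destinations of each flow $f$. For $\mathbf s\in\{0,1\}^{\mathcal N}$ ($s_n=1$: node $n$ transmits) let $\mathcal P(\mathbf s)$ be the set of power allocations $\mathbf p=(p_{n,m})$ with $0\le p_{n,m}\le 1$, $p_{n,m}\le s_n(1-s_m)$, $p_{n,m}=0$ for $m\notin\mathcal A(n)$, and $\sum_{m\in\mathcal A(n)}p_{n,m}\le 1$. The rate of link $(n,m)$ in bits per frame is $$r_{n,m}(\mathbf p)=\alpha_1T_{\rm f}W\log_2\Big(1+\alpha_2\frac{p_{n,m}P_n|G_{n,m}|^2}{I_{n,m}(\mathbf p)+WN_o}\Big),\qquad I_{n,m}(\mathbf p)=\sum_{(i,j)\neq(n,m)}|\Gamma_{n,m}^{i,j}|^2P_i\,p_{i,j},$$ with positive $\alpha_1,\alpha_2,T_{\rm f},W,N_o,P_n$ and arbitrary complex gains $G,\Gamma$ ($\Gamma=0$: negligible interference). Let $\breve{\mathcal P}(\mathbf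 s)\subset\mathcal P(\mathbf s)$ be arbitrary subsets. **Policies, stability, capacity.** In frame $t$ a causal policy chooses $\mathbf s(t)$, $\mathbf p(t)\in\breve{\mathcal P}(\mathbf s(t))$ and flow rates $r^f_{n,m}(t)\ge 0$ with $\sum_fr^f_{n,m}(t)\le r_{n,m}(\mathbf p(t))$ and $\sum_{m\in\mathcal A(n)}r^f_{n,m}(t)\le q_n^f(t)$. The queues start from a deterministic nonnegative state, satisfy $q_n^f(t)=0$ for $n\in\mathcal D_f$, and otherwise $$q_n^f(t+1)=q_n^f(t)+\sum_{m\in\mathcal A(n)}r^f_{m,n}(t)-\sum_{m\in\mathcal A(n)}r^f_{n,m}(t)+a_n^f(t).$$ The arrivals $a_n^f(t)\ge0$ have conditional mean $\lambda_n^f(t)$ given the history up to the scheduling of frame $t$, and conditional fourth moments bounded by a constant $K$. The network is *stable* if almost surely $\limsup_{T\to\infty}\frac1T\sum_{t<T}\|\mathbf q(t)\|_1<\infty$. The constrained capacity region $\breve{\mathcal X}$ is the set of $\mathbf x\in\mathbb R_{\ge0}^{\mathcal N\times\mathcal F}$ for which there are arrivals (at any nodes) with $\frac1T\sum_{t<T}\boldsymbol\lambda(t)\to\mathbf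 x$ almost surely and a causal policy that makes the network stable; $\mathcal X$ is the same with $\mathcal P$ in place of $\breve{\mathcal P}$. $\operatorname{Int}\breve{\mathcal X}$ denotes the interior relative to the nonnegative orthant. **Constrained MU-MIMO MBP.** Given $\mathbf q$, choose $f^*_{n,m}\in\arg\max_f(q_n^f-q_m^f)$, set $\xi_{n,m}=r_{n,m}(\mathbf p)/\sum_{m':f^*_{n,m'}=f^*_{n,m}}r_{n,m'}(\mathbf p)$ (zero if the denominator vanishes), let $r^f_{n,m}(\mathbf p)=\min(r_{n,m}(\mathbf p),q_n^f\xi_{n,m})$ if $f=f^*_{n,m}$ and $q_n^f>q_m^f$, and $r_{n,m}^f(\mathbf p)=0$ otherwise, and choose $(\mathbf s,\mathbf p)$ that maximizes $\sum_{n,m}\max_fr^f_{n,m}(\mathbf p)(q_n^f-q_m^f)$ over $\mathbf s\in\{0,1\}^{\mathcal N}$, $\mathbf p\in\breve{\mathcal P}(\mathbf s)$. **ANCC with parameter $V>0$.** $\lambda_n^f(t)=\max(\min((\dot{\mathscr U}^{f})^{-1}(q_n^f(t)/V),\lambda_{\max}),0)$ for $n\in\mathcal S_f$ and $\lambda_n^f(t)=0$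 otherwise, where $(\dot{\mathscr U}^f)^{-1}(y)=\sup\{x>0:\dot{\mathscr U}^f(x)\ge y\}$ and $\lambda_{\max}=\max_n|\mathcal A(n)|\cdot\max_{n,m}r_{n,m}$, the link rates being taken at $p_{n,m}=1$ without interference. Each utility $\mathscr U^f$ is continuous, non-decreasing and strictly concave on its domain, and differentiable on $(0,\infty)$; its domain is $[0,\infty)$, or $(0,\infty)$ with $\mathscr U^f(0^+)=-\infty$. The constrained NUM problem is $$\max\ \Phi(\mathbf x),\qquad \Phi(\mathbf x)=\sum_f\sum_{n\in\mathcal S_f}\mathscr U^f(x_n^f),$$ over the $\mathbf x\in\breve{\mathcal X}$ with $x_n^f=0$ for $n\notin\mathcal S_f$ and source rates in the domains. If every flow has exactly one source, one may equivalently take $\Phi(\mathbf x)=\sum_f\mathscr U^f(\sum_nx_n^f)$. **Lemma.** 1. $\breve{\mathcal X}\subset\mathcal X$, and for every $\mathbf x\in\operatorname{Int}\breve{\mathcal X}$ constrained MBP makes the network stable under all arrivals as above with $\boldsymbol\lambda(t)=\mathbf x$ for all $t$. 2. Suppose $\operatorname{Int}\breve{\mathcal X}\ne\emptyset$. For every $K$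 there is a constant $C$ such that, for all $V>0$, the network under constrained MBP and ANCC is stable, and for every feasible $\mathbf x$ of the constrained NUM problem, almost surely $\Phi\big(\frac1T\sum_{t<T}\boldsymbol\lambda(t)\big)\ge\Phi(\mathbf x)-C/V$ for all large $T$. 3. Suppose $\operatorname{Int}\breve{\mathcal X}\ne\emptyset$ and let $\mathbf x^*$ solve the constrained NUM problem. For all $K$ and $\varepsilon>0$ there is $V_0>0$ such that, for all $V\ge V_0$, almost surely for all large $T$ both the average rate $\frac1T\sum_{t<T}\boldsymbol\lambda(t)$ and the solution $\mathbf x^V$ of $\max_{\mathbf x}V\Phi(\mathbf x)-\bar{\mathbf q}^T\mathbf x$, with $\Phi$ the sum over the sources, $\bar{\mathbf q}=\frac1T\sum_{t<T}\mathbf q(t)$ and $\mathbf x$ ranging over the source rates at most $\lambda_{\max}$, are within $\varepsilon$ of $\mathbf x^*$. 4. The fixed equal power allocation $p_{n,m}=s_n(1-s_m)/|\mathcal A(n)|$ for $m\in\mathcal A(n)$ (and $0$ otherwise) lies in $\mathcal P(\mathbf s)$. If $\breve{\mathcal P}(\mathbf s)$ consists of this allocation only and $\Gamma=0$, then for $\mathbf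 q\ge0$ the MBP choices are exactly the $\mathbf s$ that maximize $\sum_{(n,m)\in\mathcal L_{TR}(\mathbf s)}w_{n,m}$ (with $\mathbf p$ the equal power allocation), where $\mathcal L_{TR}(\mathbf s)=\{(n,m):m\in\mathcal A(n),s_n=1,s_m=0\}$, $w_{n,m}=\min(R_{n,m},q_n^{f^*_{n,m}}\xi_{n,m})\max(0,\max_f(q_n^f-q_m^f))$, $R_{n,m}$ is the link rate at $p_{n,m}=1/|\mathcal A(n)|$, and $\xi_{n,m}=R_{n,m}/\sum R_{n,m'}$, the sum running over the $m'$ with $(n,m')\in\mathcal L_{TR}(\mathbf s)$ and $f^*_{n,m'}=f^*_{n,m}$. -/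

import Mathlib

open MeasureTheory Filter Topology

noncomputable section

namespace MUMIMO

/-- A multi-hop MU-MIMO network with nodes `N` and traffic flows `F`. -/
structure Network (N F : Type*) [Fintype N] where
  /-- Pairs of nodes that can reach each other; `(n, m)` and `(m, n)` are then both links. -/
  graph : SimpleGraph N
  /-- Sources of each flow. -/
  src : F → Finset N
  /-- Destinations of each flow (anycast: a bit leaves the network at any of them). -/
  dst : F → Finset N
  src_disjoint_dst : ∀ f, Disjoint (src f) (dst f)
  /-- Spectral efficiency factor. -/
  α₁ : ℝ
  /-- Power efficiency factor. -/
  α₂ : ℝ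
  /-- Frame duration. -/
  frame : ℝ
  /-- Bandwidth. -/
  bandwidth : ℝ
  /-- Noise power spectral density. -/
  noise : ℝ
  /-- Power budget of each node. -/
  power : N → ℝ
  α₁_pos : 0 < α₁
  α₂_pos : 0 < α₂
  frame_pos : 0 < frame
  bandwidth_pos : 0 < bandwidth
  noise_pos : 0 < noise
  power_pos : ∀ n, 0 < power n
  /-- Equivalent complex gain of link `(n, m)`, beamforming included. -/
  gain : N → N → ℂ
  /-- `crossGain n m i j` is the complex gain with which the signal that `i` sends to `j` arrives
  at the port of `m` that receives from `n`; all zero when interference is neglected. -/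
  crossGain : N → N → N → N → ℂ

/-- Normalized power allocations `p n m`. -/
abbrev Alloc (N : Type*) := N → N → ℝ

/-- Vectors with one entry per queue, i.e. per node and flow. -/
abbrev QVec (N F : Type*) := N → F → ℝ

namespace Network

variable {N F : Type*} [Fintype N] [DecidableEq N] [Fintype F] [DecidableEq F]

open scoped Classical in
/-- The neighbours of node `n`. -/
def nbrs (net : Network N F) (n : N) : Finset N :=
  Finset.univ.filter fun m => net.graph.Adj n m

/-- The valid power allocations when the transmit/receive state of the nodes is `s`
(`s n = true` when `n` transmits): only links from a transmitting to a receiving neighbour carry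
power, and each node shares at most its unit budget. -/
def allocations (net : Network N F) (s : N → Bool) : Set (Alloc N) :=
  {p | (∀ n m, 0 ≤ p n m ∧ p n m ≤ 1) ∧
    (∀ n, ∑ m ∈ net.nbrs n, p n m ≤ 1) ∧
    (∀ n m, p n m ≠ 0 → m ∈ net.nbrs n ∧ s n = true ∧ s m = false)}

/-- Interference power received in link `(n, m)`. -/
def interference (net : Network N F) (p : Alloc N) (n m : N) : ℝ :=
  ∑ i, ∑ j, if i = n ∧ j = m then 0 else p i j * net.power i * ‖net.crossGain n m i j‖ ^ 2

/-- Rate of link `(n, m)`, in bits per frame, under the allocation `p`. -/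
def linkRate (net : Network N F) (p : Alloc N) (n m : N) : ℝ :=
  net.α₁ * net.frame * net.bandwidth * Real.logb 2 (1 + net.α₂ *
    (p n m * net.power n * ‖net.gain n m‖ ^ 2 /
      (net.interference p n m + net.bandwidth * net.noise)))

/-- Interference-free rate of link `(n, m)` when it gets the fraction `y` of the power. -/
def soloRate (net : Network N F) (n m : N) (y : ℝ) : ℝ :=
  net.α₁ * net.frame * net.bandwidth * Real.logb 2 (1 + net.α₂ *
    (y * net.power n * ‖net.gain n m‖ ^ 2 / (net.bandwidth * net.noise)))

/-! ### Maximum back pressure -/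

/-- The choice of a flow of highest queue pressure for every link. -/
def IsTopFlow (q : QVec N F) (fs : N → N → F) : Prop :=
  ∀ n m f, q n f - q m f ≤ q n (fs n m) - q m (fs n m)

/-- The share of the queue of flow `fs n m` at node `n` that is offered to link `(n, m)`. -/
def share (net : Network N F) (fs : N → N → F) (p : Alloc N) (n m : N) : ℝ :=
  net.linkRate p n m /
    ∑ m' ∈ Finset.univ.filter (fun m' => fs n m' = fs n m), net.linkRate p n m'

/-- Flow rates of the back-pressure algorithm: link `(n, m)` serves only its flow of highest
pressure, and only when that pressure is positive. -/
def mbpRate (net : Network N F) (q : QVec N F) (fs : N → N → F) (p : Alloc N)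
    (n m : N) (f : F) : ℝ :=
  if f = fs n m ∧ 0 < q n f - q m f then min (net.linkRate p n m) (q n f * net.share fs p n m)
  else 0

/-- The sum queue-pressure metric. -/
def mbpObjective (net : Network N F) (q : QVec N F) (fs : N → N → F) (p : Alloc N) : ℝ :=
  ∑ n, ∑ m, ⨆ f, net.mbpRate q fs p n m f * (q n f - q m f)

/-- `(s, p)` is a choice of the MU-MIMO maximum back pressure algorithm at queue state `q`, when
the allowed power allocations for node state `s` are `Pc s`. -/
def IsMBPChoice (net : Network N F) (Pc : (N → Bool) → Set (Alloc N)) (q : QVec N F)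
    (fs : N → N → F) (s : N → Bool) (p : Alloc N) : Prop :=
  IsTopFlow q fs ∧ p ∈ Pc s ∧
    ∀ s', ∀ p' ∈ Pc s', net.mbpObjective q fs p' ≤ net.mbpObjective q fs p

/-! ### Queueing processes -/

/-- A random evolution of the network under a causal scheduling policy that only uses the power
allocations in `Pc`. The history before the arrivals of frame `t` is the σ-algebra `ℱ t`. -/
structure Run (net : Network N F) (Pc : (N → Bool) → Set (Alloc N))
    {Ω : Type*} [MeasurableSpace Ω] (μ : Measure Ω) where
  ℱ : Filtration ℕ (inferInstance : MeasurableSpace Ω)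
  /-- Initial queue lengths. -/
  q₀ : QVec N F
  /-- Queue lengths, in bits. -/
  q : ℕ → Ω → QVec N F
  /-- Transmit/receive states. -/
  s : ℕ → Ω → N → Bool
  /-- Power allocations. -/
  p : ℕ → Ω → Alloc N
  /-- `rate t ω n m f` bits of flow `f` go from `n` to `m` in frame `t`. -/
  rate : ℕ → Ω → N → N → F → ℝ
  /-- Exogenous arrivals. -/
  a : ℕ → Ω → QVec N F
  /-- Mean arrival rates given the history. -/
  lam : ℕ → Ω → QVec N F
  q₀_nonneg : 0 ≤ q₀
  q₀_dst : ∀ f, ∀ n ∈ net.dst f, q₀ n f = 0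
  measurable_s : ∀ t, Measurable[ℱ t] (s t)
  measurable_p : ∀ t, Measurable[ℱ t] (p t)
  measurable_rate : ∀ t, Measurable[ℱ t] (rate t)
  measurable_lam : ∀ t, Measurable[ℱ t] (lam t)
  measurable_a : ∀ t, Measurable[ℱ (t + 1)] (a t)
  p_mem : ∀ t ω, p t ω ∈ Pc (s t ω)
  rate_nonneg : ∀ t ω n m f, 0 ≤ rate t ω n m f
  rate_le_link : ∀ t ω n m, ∑ f, rate t ω n m f ≤ net.linkRate (p t ω) n m
  rate_le_queue : ∀ t ω n f, ∑ m ∈ net.nbrs n, rate t ω n m f ≤ q t ω n f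
  a_nonneg : ∀ t ω, 0 ≤ a t ω
  integrable_a : ∀ t n f, Integrable (fun ω => a t ω n f) μ
  condExp_a : ∀ t n f, μ[fun ω => a t ω n f | ℱ t] =ᵐ[μ] fun ω => lam t ω n f
  q_zero : ∀ ω, q 0 ω = q₀
  q_succ : ∀ t ω n f, q (t + 1) ω n f =
    if n ∈ net.dst f then 0
    else q t ω n f + ∑ m ∈ net.nbrs n, rate t ω m n f - ∑ m ∈ net.nbrs n, rate t ω n m f
      + a t ω n f

namespace Run

variable {net : Network N F} {Pc : (N → Bool) → Set (Alloc N)}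
  {Ω : Type*} [MeasurableSpace Ω] {μ : Measure Ω}

/-- The conditional fourth moments of the arrivals are at most `K`. -/
def MomentBound (R : Run net Pc μ) (K : ℝ) : Prop :=
  ∀ t n f, Integrable (fun ω => R.a t ω n f ^ 4) μ ∧
    μ[fun ω => R.a t ω n f ^ 4 | R.ℱ t] ≤ᵐ[μ] fun _ => K

/-- Average of the arrival rates over the first `T` frames. -/
def avgRate (R : Run net Pc μ) (T : ℕ) (ω : Ω) : QVec N F :=
  fun n f => (∑ t ∈ Finset.range T, R.lam t ω n f) / T

/-- Average of the queue lengths over the first `T` frames. -/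
def avgQueue (R : Run net Pc μ) (T : ℕ) (ω : Ω) : QVec N F :=
  fun n f => (∑ t ∈ Finset.range T, R.q t ω n f) / T

/-- Stability: almost surely the time average of the total queue length stays bounded. -/
def Stable (R : Run net Pc μ) : Prop :=
  ∀ᵐ ω ∂μ, ∃ B : ℝ, ∀ᶠ T : ℕ in atTop, ∑ n, ∑ f, R.avgQueue T ω n f ≤ B

/-- The run is scheduled by MU-MIMO maximum back pressure over the allocations `Pc`. -/
def IsMBP (R : Run net Pc μ) : Prop :=
  ∃ fs : ℕ → Ω → N → N → F, ∀ t ω,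
    net.IsMBPChoice Pc (R.q t ω) (fs t ω) (R.s t ω) (R.p t ω) ∧
    R.rate t ω = net.mbpRate (R.q t ω) (fs t ω) (R.p t ω)

end Run

/-- Throughput capacity region under the allocations `Pc`: the long-term average arrival rates for
which some causal scheduling policy keeps the network stable. -/
def capacityRegion (net : Network N F) (Pc : (N → Bool) → Set (Alloc N)) : Set (QVec N F) :=
  {x | ∃ (Ω : Type) (_ : MeasurableSpace Ω) (μ : Measure Ω) (_ : IsProbabilityMeasure μ)
    (R : Run net Pc μ) (K : ℝ), R.MomentBound K ∧
      (∀ᵐ ω ∂μ, Tendsto (fun T => R.avgRate T ω) atTop (𝓝 x)) ∧ R.Stable}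

/-- Interior of the capacity region relative to the set of nonnegative rate vectors. -/
def capacityInterior (net : Network N F) (Pc : (N → Bool) → Set (Alloc N)) : Set (QVec N F) :=
  {x | 0 ≤ x ∧ net.capacityRegion Pc ∈ 𝓝[Set.Ici 0] x}

/-! ### Utilities and congestion control -/

/-- `U` is a strictly concave differentiable utility function with domain `D`. The domain is
`[0, ∞)`, or `(0, ∞)` for a utility such as the logarithm that is `-∞` at zero. -/
structure IsUtility (D : Set ℝ) (U : ℝ → ℝ) : Prop where
  domain : D = Set.Ici 0 ∨ (D = Set.Ioi 0 ∧ Tendsto U (𝓝[>] 0) atBot)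
  continuousOn : ContinuousOn U D
  monotoneOn : MonotoneOn U D
  strictConcaveOn : StrictConcaveOn ℝ D U
  differentiableOn : DifferentiableOn ℝ U (Set.Ioi 0)

/-- Largest link rate at full power. -/
def rateMax (net : Network N F) : ℝ := ⨆ n, ⨆ m : net.nbrs n, net.soloRate n m 1

/-- Cap of the source rates: the maximum degree times the largest link rate. -/
def lamMax (net : Network N F) : ℝ :=
  (Finset.univ.sup fun n => (net.nbrs n).card : ℕ) * net.rateMax

/-- `max (min (U'⁻¹ y) b) 0`, where `U'⁻¹ y` is the generalized inverse
`sup {x > 0 | y ≤ U' x}` of the decreasing function `U'`. -/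
def clippedInvDeriv (U : ℝ → ℝ) (b y : ℝ) : ℝ :=
  sSup (insert 0 {x | 0 < x ∧ x < b ∧ y ≤ deriv U x})

/-- The source rates are set by adaptive NUM congestion control with parameter `V`. -/
def Run.IsANCC {net : Network N F} {Pc : (N → Bool) → Set (Alloc N)}
    {Ω : Type*} [MeasurableSpace Ω] {μ : Measure Ω}
    (R : Run net Pc μ) (U : F → ℝ → ℝ) (V : ℝ) : Prop :=
  ∀ t ω n f, R.lam t ω n f =
    if n ∈ net.src f then clippedInvDeriv (U f) net.lamMax (R.q t ω n f / V) else 0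

/-- Network utility `∑_f U^f (∑_n x_n^f)`. -/
def flowUtility (U : F → ℝ → ℝ) (x : QVec N F) : ℝ := ∑ f, U f (∑ n, x n f)

/-- Network utility `∑_f ∑_{n ∈ S_f} U^f (x_n^f)`, in which every source is counted
separately. -/
def sourceUtility (net : Network N F) (U : F → ℝ → ℝ) (x : QVec N F) : ℝ :=
  ∑ f, ∑ n ∈ net.src f, U f (x n f)

/-- The rate vectors with no arrivals outside the sources, and source rates in the domains of the
utilities. -/
def sourceVectors (net : Network N F) (D : F → Set ℝ) : Set (QVec N F) :=
  {x | ∀ f n, (n ∈ net.src f → x n f ∈ D f) ∧ (n ∉ net.src f → x n f = 0)}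

/-- The feasible set of the NUM problem: the rate vectors in the capacity region with arrivals at
the sources only. -/
def numFeasible (net : Network N F) (Pc : (N → Bool) → Set (Alloc N)) (D : F → Set ℝ) :
    Set (QVec N F) :=
  net.capacityRegion Pc ∩ net.sourceVectors D

/-- `x` maximizes `V ∑_{n,f} U^f (x_n^f) - qᵀ x` over the source rates in `[0, lamMax]`. -/
def IsPenalizedOptimum (net : Network N F) (D : F → Set ℝ) (U : F → ℝ → ℝ) (V : ℝ)
    (q x : QVec N F) : Prop :=
  x ∈ net.sourceVectors D ∩ {y | ∀ n f, y n f ≤ net.lamMax} ∧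
    IsMaxOn (fun y => V * net.sourceUtility U y - ∑ n, ∑ f, q n f * y n f)
      (net.sourceVectors D ∩ {y | ∀ n f, y n f ≤ net.lamMax}) x

/-! ### Fixed equal power and directed bipartite subgraphs -/

/-- Links of the directed bipartite subgraph induced by `s`: from a transmitter to a receiver. -/
def dbsgLinks (net : Network N F) (s : N → Bool) : Finset (N × N) :=
  Finset.univ.filter fun l => l.2 ∈ net.nbrs l.1 ∧ s l.1 = true ∧ s l.2 = false

/-- Fixed equal power: every link of the subgraph gets the same share of its transmitter's
power. -/
def equalPower (net : Network N F) (s : N → Bool) : Alloc N :=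
  fun n m => if (n, m) ∈ net.dbsgLinks s then 1 / ((net.nbrs n).card : ℝ) else 0

/-- Constant link rate under fixed equal power without interference. -/
def fixedRate (net : Network N F) (n m : N) : ℝ :=
  net.soloRate n m (1 / ((net.nbrs n).card : ℝ))

/-- Queue-pressure weight of link `(n, m)` under fixed equal power; the queue is shared among the
links of the subgraph that serve the same flow. -/
def dbsgWeight (net : Network N F) (q : QVec N F) (fs : N → N → F) (s : N → Bool)
    (n m : N) : ℝ :=
  min (net.fixedRate n m) (q n (fs n m) * (net.fixedRate n m /
      ∑ m' ∈ Finset.univ.filter (fun m' => (n, m') ∈ net.dbsgLinks s ∧ fs n m' = fs n m),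
        net.fixedRate n m'))
    * max 0 (⨆ f, (q n f - q m f))

/-- `s` induces a maximum weighted directed bipartite subgraph. -/
def IsMaxWeightDBSG (net : Network N F) (q : QVec N F) (fs : N → N → F) (s : N → Bool) : Prop :=
  ∀ s', ∑ l ∈ net.dbsgLinks s', net.dbsgWeight q fs s' l.1 l.2 ≤
    ∑ l ∈ net.dbsgLinks s, net.dbsgWeight q fs s l.1 l.2

end Network

end MUMIMO

end

/-!
The scheduler is analysed through the maximum weight `∑ rate * max (pressure, 0)`, maximized over
the allowed allocations. Up to a constant, transport lowers the squared norm of the queues by at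
most twice the maximum weight at the queues, and back pressure attains this, since its shares only
cut down the rates of links with short queues. Hence stability under arrival rates `x` forces
`⟪w, x⟫ ≤ maxWeight w` for every weight vector `w` that is a possible queue vector: otherwise the
queues, tested against `w`, would grow linearly. Conversely, if these inequalities hold with a
margin, the squared norm of the queues has a negative drift that is linear in the queues. The drift
inequality for the fourth power of the norm then makes the second moments of the queues summable
against `t⁻²`, so that the strong law for martingale differences applies to the fluctuations of the
arrivals weighted with the queues, and the time averages of the queues stay bounded.

Under the congestion controller the arrival rates maximize `V Φ(x) - ⟪q, x⟫` in every frame. Adding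
the penalty `-V Φ` to the drift and averaging, Jensen's inequality and the maximum weight
inequalities for a feasible `x` give `Φ(x) - C / V ≤ Φ(average rate)`. The queues grow sublinearly,
so the average rates are asymptotically feasible, and the uniform strict concavity of `Φ` around
its maximizer turns near optimality into closeness, for the average rates as well as for the
penalized optima at the average queues.
-/

noncomputable section

namespace MUMIMO

/-! ### Martingale differences -/

section MartingaleDifferences

theorem tendsto_average_of_tendsto_sum_div {d : ℕ → ℝ} {c : ℝ}
    (h : Tendsto (fun T => ∑ t ∈ Finset.range T, d t / ((t : ℝ) + 1)) atTop (𝓝 c)) :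
    Tendsto (fun T : ℕ => (∑ t ∈ Finset.range T, d t) / T) atTop (𝓝 0) := by
  set s : ℕ → ℝ := fun T => ∑ t ∈ Finset.range T, d t / ((t : ℝ) + 1)
  have summation_by_parts (T : ℕ) :
      ∑ t ∈ Finset.range T, d t = T * s T - ∑ t ∈ Finset.range T, s t := by
    induction T with
    | zero => simp
    | succ T ih =>
      rw [Finset.sum_range_succ, Finset.sum_range_succ, ih,
        show s (T + 1) = s T + d T / ((T : ℝ) + 1) from Finset.sum_range_succ _ _]
      push_cast
      field_simp
      ring
  have hlim : Tendsto (fun T : ℕ => s T - (T : ℝ)⁻¹ * ∑ t ∈ Finset.range T, s t) atTop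
      (𝓝 0) := by simpa using h.sub h.cesaro
  refine hlim.congr' ?_
  filter_upwards [eventually_ne_atTop 0] with T hT
  rw [summation_by_parts]
  field_simp

theorem summable_div_sq_of_le {u v : ℕ → ℝ} (hu : ∀ t, 0 ≤ u t) (huv : ∀ t, u t ≤ v t)
    (hv : Summable fun t : ℕ => v t / ((t : ℝ) + 1) ^ 2) :
    Summable fun t : ℕ => u t / ((t : ℝ) + 1) ^ 2 :=
  hv.of_nonneg_of_le (fun t => div_nonneg (hu t) (by positivity)) fun t => by
    gcongr; exact huv t

theorem summable_const_div_sq (k : ℝ) : Summable fun t : ℕ => k / ((t : ℝ) + 1) ^ 2 := by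
  simpa [div_eq_mul_inv] using
    ((summable_nat_add_iff 1).2 (Real.summable_nat_pow_inv.2 one_lt_two)).mul_left k

theorem summable_div_sq_of_drift {u Y : ℕ → ℝ} {k : ℝ} (hu : ∀ t, 0 ≤ u t) (hY : ∀ t, 0 ≤ Y t)
    (h : ∀ t, Y (t + 1) + u t ≤ Y t + k) :
    Summable fun t : ℕ => u t / ((t : ℝ) + 1) ^ 2 := by
  have telescope (T : ℕ) :
      ∑ t ∈ Finset.range T, u t / ((t : ℝ) + 1) ^ 2 + Y T / ((T : ℝ) + 1) ^ 2
        ≤ Y 0 + ∑ t ∈ Finset.range T, k / ((t : ℝ) + 1) ^ 2 := by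
    induction T with
    | zero => simp
    | succ T ih =>
      rw [Finset.sum_range_succ, Finset.sum_range_succ]
      have hdecay : Y (T + 1) / (((T + 1 : ℕ) : ℝ) + 1) ^ 2 ≤ Y (T + 1) / ((T : ℝ) + 1) ^ 2 := by
        have := hY (T + 1)
        gcongr
        simp
      have hstep : (Y (T + 1) + u T) / ((T : ℝ) + 1) ^ 2 ≤ (Y T + k) / ((T : ℝ) + 1) ^ 2 := by
        have := h T
        gcongr
      rw [add_div, add_div] at hstep
      linarith
  refine summable_of_sum_range_le (c := Y 0 + ∑' t : ℕ, |k| / ((t : ℝ) + 1) ^ 2)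
    (fun t => div_nonneg (hu t) (by positivity)) fun T => ?_
  have hYT : 0 ≤ Y T / ((T : ℝ) + 1) ^ 2 := div_nonneg (hY T) (by positivity)
  have hkT : ∑ t ∈ Finset.range T, k / ((t : ℝ) + 1) ^ 2
      ≤ ∑ t ∈ Finset.range T, |k| / ((t : ℝ) + 1) ^ 2 := by
    gcongr; exact le_abs_self k
  have := (summable_const_div_sq |k|).sum_le_tsum (Finset.range T) fun t _ => by positivity
  linarith [telescope T]

variable {Ω : Type*} {m₀ : MeasurableSpace Ω} {μ : Measure Ω}

theorem integral_mul_eq_integral_mul_condExp {m : MeasurableSpace Ω} (hm : m ≤ m₀)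
    [SigmaFinite (μ.trim hm)] {Z Y : Ω → ℝ} (hZ : StronglyMeasurable[m] Z)
    (hZY : Integrable (Z * Y) μ) (hY : Integrable Y μ) :
    ∫ ω, Z ω * Y ω ∂μ = ∫ ω, Z ω * (μ[Y | m]) ω ∂μ :=
  (integral_condExp hm).symm.trans
    (integral_congr_ae (condExp_mul_of_stronglyMeasurable_left hZ hZY hY))

theorem integral_mul_le_of_condExp_le {m : MeasurableSpace Ω} (hm : m ≤ m₀)
    [SigmaFinite (μ.trim hm)] {Z Y : Ω → ℝ} {k : ℝ} (hZ : StronglyMeasurable[m] Z)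
    (hZY : Integrable (Z * Y) μ) (hY : Integrable Y μ) (hZi : Integrable Z μ)
    (hZ0 : ∀ ω, 0 ≤ Z ω) (hk : μ[Y | m] ≤ᵐ[μ] fun _ => k) :
    ∫ ω, Z ω * Y ω ∂μ ≤ k * ∫ ω, Z ω ∂μ := by
  rw [integral_mul_eq_integral_mul_condExp hm hZ hZY hY, ← integral_const_mul]
  refine integral_mono_ae ?_ (hZi.const_mul k) ?_
  · exact integrable_condExp.congr (condExp_mul_of_stronglyMeasurable_left hZ hZY hY)
  · filter_upwards [hk] with ω hω
    rw [mul_comm k]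
    exact mul_le_mul_of_nonneg_left hω (hZ0 ω)

theorem integral_le_of_condExp_le [IsProbabilityMeasure μ] {m : MeasurableSpace Ω} (hm : m ≤ m₀)
    {Y : Ω → ℝ} {k : ℝ} (hY : Integrable Y μ) (hk : μ[Y | m] ≤ᵐ[μ] fun _ => k) :
    ∫ ω, Y ω ∂μ ≤ k := by
  simpa using integral_mul_le_of_condExp_le (Z := fun _ => 1) hm stronglyMeasurable_const
    (by simpa [Pi.mul_def] using hY) hY (integrable_const 1) (fun _ => zero_le_one) hk

/-- A square integrable martingale difference sequence: `d t` is revealed at time `t + 1` and has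
zero conditional mean given `ℱ t`. -/
structure IsMartingaleDifference (ℱ : Filtration ℕ m₀) (μ : Measure Ω) (d : ℕ → Ω → ℝ) :
    Prop where
  stronglyMeasurable : ∀ t, StronglyMeasurable[ℱ (t + 1)] (d t)
  memLp : ∀ t, MemLp (d t) 2 μ
  condExp_eq_zero : ∀ t, μ[d t | ℱ t] =ᵐ[μ] 0

variable {ℱ : Filtration ℕ m₀} {d X Z : ℕ → Ω → ℝ}

theorem IsMartingaleDifference.memLp_sum (hd : IsMartingaleDifference ℱ μ d) (T : ℕ) :
    MemLp (∑ t ∈ Finset.range T, d t) 2 μ :=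
  memLp_finsetSum' _ fun t _ => hd.memLp t

variable [IsFiniteMeasure μ]

theorem isMartingaleDifference_sub_condExp (hX : ∀ t, StronglyMeasurable[ℱ (t + 1)] (X t))
    (hX2 : ∀ t, MemLp (X t) 2 μ) :
    IsMartingaleDifference ℱ μ fun t => X t - μ[X t | ℱ t] where
  stronglyMeasurable t := (hX t).sub (stronglyMeasurable_condExp.mono (ℱ.mono t.le_succ))
  memLp t := (hX2 t).sub ((hX2 t).condExp one_le_two)
  condExp_eq_zero t := by
    have hX1 : Integrable (X t) μ := (hX2 t).integrable one_le_two
    refine (condExp_sub hX1 integrable_condExp (ℱ t)).trans ?_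
    rw [condExp_of_stronglyMeasurable (ℱ.le t) stronglyMeasurable_condExp integrable_condExp,
      sub_self]

namespace IsMartingaleDifference

theorem integral_mul_eq_zero (hd : IsMartingaleDifference ℱ μ d) {t : ℕ} {Z : Ω → ℝ}
    (hZ : StronglyMeasurable[ℱ t] Z) (hZd : Integrable (Z * d t) μ) :
    ∫ ω, Z ω * d t ω ∂μ = 0 := by
  rw [integral_mul_eq_integral_mul_condExp (ℱ.le t) hZ hZd ((hd.memLp t).integrable one_le_two)]
  refine integral_eq_zero_of_ae ?_
  filter_upwards [hd.condExp_eq_zero t] with ω hω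
  simp [hω]

theorem mul (hd : IsMartingaleDifference ℱ μ d) (hZ : ∀ t, StronglyMeasurable[ℱ t] (Z t))
    (hZd : ∀ t, MemLp (Z t * d t) 2 μ) : IsMartingaleDifference ℱ μ fun t => Z t * d t where
  stronglyMeasurable t := ((hZ t).mono (ℱ.mono t.le_succ)).mul (hd.stronglyMeasurable t)
  memLp := hZd
  condExp_eq_zero t := by
    refine (condExp_mul_of_stronglyMeasurable_left (hZ t) ((hZd t).integrable one_le_two)
      ((hd.memLp t).integrable one_le_two)).trans ?_
    filter_upwards [hd.condExp_eq_zero t] with ω hω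
    simp [hω]

theorem finsetSum {ι : Type*} {I : Finset ι} {d : ι → ℕ → Ω → ℝ}
    (hd : ∀ i, IsMartingaleDifference ℱ μ (d i)) :
    IsMartingaleDifference ℱ μ fun t ω => ∑ i ∈ I, d i t ω where
  stronglyMeasurable t := Finset.stronglyMeasurable_fun_sum _ fun i _ => (hd i).stronglyMeasurable t
  memLp t := memLp_finsetSum _ fun i _ => (hd i).memLp t
  condExp_eq_zero t := by
    have hsum : (fun ω => ∑ i ∈ I, d i t ω) = ∑ i ∈ I, d i t := by
      funext ω; rw [Finset.sum_apply]
    rw [hsum]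
    refine (condExp_finsetSum (fun i _ => ((hd i).memLp t).integrable one_le_two) (ℱ t)).trans ?_
    exact (eventuallyEq_sum fun i _ => (hd i).condExp_eq_zero t).trans
      (by rw [Finset.sum_const_zero])

theorem const_mul (hd : IsMartingaleDifference ℱ μ d) (b : ℕ → ℝ) :
    IsMartingaleDifference ℱ μ fun t ω => b t * d t ω :=
  hd.mul (Z := fun t _ => b t) (fun _ => stronglyMeasurable_const)
    fun t => (hd.memLp t).const_mul (b t)

theorem martingale_sum (hd : IsMartingaleDifference ℱ μ d) :
    Martingale (fun T => ∑ t ∈ Finset.range T, d t) ℱ μ := by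
  refine martingale_of_condExp_sub_eq_zero_nat
    (fun T => Finset.stronglyMeasurable_sum _ fun t ht =>
      (hd.stronglyMeasurable t).mono (ℱ.mono (Finset.mem_range.1 ht)))
    (fun T => (hd.memLp_sum T).integrable one_le_two) fun T => ?_
  rw [Finset.sum_range_succ_sub_sum]
  exact hd.condExp_eq_zero T

theorem integral_sq_sum (hd : IsMartingaleDifference ℱ μ d) (T : ℕ) :
    ∫ ω, (∑ t ∈ Finset.range T, d t) ω ^ 2 ∂μ = ∑ t ∈ Finset.range T, ∫ ω, d t ω ^ 2 ∂μ := by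
  induction T with
  | zero => simp
  | succ T ih =>
    have hS := hd.memLp_sum T
    set S := ∑ t ∈ Finset.range T, d t with hSdef
    have hSd : Integrable (fun ω => S ω * d T ω) μ := hS.integrable_mul (hd.memLp T)
    have orthogonal : ∫ ω, S ω * d T ω ∂μ = 0 :=
      hd.integral_mul_eq_zero (hd.martingale_sum.1 T) hSd
    have expand (ω : Ω) : (S + d T) ω ^ 2 = S ω ^ 2 + 2 * (S ω * d T ω) + d T ω ^ 2 := by
      rw [Pi.add_apply]; ring
    rw [Finset.sum_range_succ, Finset.sum_range_succ, ← ih]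
    simp_rw [← hSdef, expand]
    have hcross : Integrable (fun ω => S ω ^ 2 + 2 * (S ω * d T ω)) μ :=
      hS.integrable_sq.add (hSd.const_mul 2)
    rw [integral_add hcross (hd.memLp T).integrable_sq,
      integral_add hS.integrable_sq (hSd.const_mul 2), integral_const_mul, orthogonal]
    ring

theorem ae_exists_tendsto_sum (hd : IsMartingaleDifference ℱ μ d)
    (hsum : Summable fun t => ∫ ω, d t ω ^ 2 ∂μ) :
    ∀ᵐ ω ∂μ, ∃ c, Tendsto (fun T => ∑ t ∈ Finset.range T, d t ω) atTop (𝓝 c) := by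
  set B := μ.real Set.univ + ∑' t, ∫ ω, d t ω ^ 2 ∂μ with hB
  have eLpNorm_le (T : ℕ) : eLpNorm (∑ t ∈ Finset.range T, d t) 1 μ ≤ B.toNNReal := by
    have hS := hd.memLp_sum T
    have hS1 : Integrable (∑ t ∈ Finset.range T, d t) μ := hS.integrable one_le_two
    have hL2 := hd.integral_sq_sum T
    have hle := hsum.sum_le_tsum (Finset.range T) fun t _ => integral_nonneg fun ω => sq_nonneg _
    set S := ∑ t ∈ Finset.range T, d t
    rw [eLpNorm_one_eq_lintegral_enorm, ← ofReal_integral_norm_eq_lintegral_enorm hS1]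
    refine ENNReal.ofReal_le_ofReal ?_
    calc ∫ ω, ‖S ω‖ ∂μ ≤ ∫ ω, (1 + S ω ^ 2) ∂μ :=
          integral_mono hS1.norm ((integrable_const _).add hS.integrable_sq) fun ω => by
            rw [Real.norm_eq_abs, ← sq_abs]
            nlinarith [sq_nonneg (|S ω| - 1), sq_abs (S ω)]
      _ = μ.real Set.univ + ∫ ω, S ω ^ 2 ∂μ := by
          rw [integral_add (integrable_const _) hS.integrable_sq, integral_const, smul_eq_mul,
            mul_one]
      _ ≤ B := by rw [hL2, hB]; gcongr
  simpa only [Finset.sum_apply] using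
    hd.martingale_sum.submartingale.exists_ae_tendsto_of_bdd eLpNorm_le

theorem ae_tendsto_average (hd : IsMartingaleDifference ℱ μ d)
    (hsum : Summable fun t : ℕ => (∫ ω, d t ω ^ 2 ∂μ) / ((t : ℝ) + 1) ^ 2) :
    ∀ᵐ ω ∂μ, Tendsto (fun T : ℕ => (∑ t ∈ Finset.range T, d t ω) / T) atTop (𝓝 0) := by
  have hsum' : Summable fun t : ℕ => ∫ ω, (((t : ℝ) + 1)⁻¹ * d t ω) ^ 2 ∂μ := by
    simpa only [inv_mul_eq_div, div_pow, integral_div] using hsum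
  filter_upwards [(hd.const_mul fun t : ℕ => ((t : ℝ) + 1)⁻¹).ae_exists_tendsto_sum hsum']
    with ω ⟨c, hc⟩
  exact tendsto_average_of_tendsto_sum_div (c := c) (by simpa only [inv_mul_eq_div] using hc)

end IsMartingaleDifference

theorem integral_sq_sub_condExp_le {m : MeasurableSpace Ω} (hm : m ≤ m₀) {Y : Ω → ℝ}
    (hY : MemLp Y 2 μ) : ∫ ω, (Y ω - (μ[Y | m]) ω) ^ 2 ∂μ ≤ ∫ ω, Y ω ^ 2 ∂μ := by
  have h := integral_mono_ae integrable_condExp integrable_condExp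
    (ProbabilityTheory.condVar_ae_le_condExp_sq hm hY)
  rwa [integral_condExp hm, integral_condExp hm] at h

theorem ae_eventually_sum_le_of_condExp_le {c ε : ℝ} (hε : 0 < ε)
    (hX : ∀ t, StronglyMeasurable[ℱ (t + 1)] (X t)) (hX2 : ∀ t, MemLp (X t) 2 μ)
    (hc : ∀ t, μ[X t | ℱ t] ≤ᵐ[μ] fun _ => c)
    (hsum : Summable fun t : ℕ => (∫ ω, X t ω ^ 2 ∂μ) / ((t : ℝ) + 1) ^ 2) :
    ∀ᵐ ω ∂μ, ∀ᶠ T : ℕ in atTop, ∑ t ∈ Finset.range T, X t ω ≤ (c + ε) * T := by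
  have hcentred := (isMartingaleDifference_sub_condExp hX hX2).ae_tendsto_average
    (summable_div_sq_of_le (fun t => integral_nonneg fun ω => sq_nonneg _)
      (fun t => integral_sq_sub_condExp_le (ℱ.le t) (hX2 t)) hsum)
  filter_upwards [hcentred, ae_all_iff.2 hc] with ω hω hcω
  filter_upwards [hω.eventually_lt_const hε, eventually_gt_atTop 0] with T hT hT0
  have hT0' : (0 : ℝ) < T := by exact_mod_cast hT0
  simp only [Pi.sub_apply] at hT
  rw [div_lt_iff₀ hT0', Finset.sum_sub_distrib] at hT
  have hcond : ∑ t ∈ Finset.range T, (μ[X t | ℱ t]) ω ≤ c * T := by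
    simpa [mul_comm] using
      Finset.sum_le_card_nsmul (Finset.range T) (fun t => (μ[X t | ℱ t]) ω) c fun t _ => hcω t
  linarith

end MartingaleDifferences

section FourthMoments

variable {Ω : Type*} {m₀ : MeasurableSpace Ω} {μ : Measure Ω} {f g : Ω → ℝ}

theorem memLp_four_of_integrable_pow (hf : AEStronglyMeasurable f μ)
    (h : Integrable (fun ω => f ω ^ 4) μ) : MemLp f 4 μ := by
  rw [← integrable_norm_rpow_iff hf (by norm_num) (by norm_num)]
  refine h.congr (Eventually.of_forall fun ω => ?_)
  simp only [ENNReal.toReal_ofNat, Real.norm_eq_abs]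
  exact_mod_cast ((by decide : Even 4).pow_abs (f ω)).symm

theorem memLp_two_mul_of_memLp_four (hf : MemLp f 4 μ) (hg : MemLp g 4 μ) :
    MemLp (fun ω => f ω * g ω) 2 μ := by
  have : ENNReal.HolderTriple 4 4 2 := ⟨by
    rw [← two_mul, show (4 : ENNReal) = 2 * 2 by norm_num,
      ENNReal.mul_inv (by norm_num) (by norm_num), ← mul_assoc,
      ENNReal.mul_inv_cancel (by norm_num) (by norm_num), one_mul]⟩
  exact hg.mul hf

theorem memLp_two_sq_of_memLp_four (hf : MemLp f 4 μ) : MemLp (fun ω => f ω ^ 2) 2 μ := by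
  simpa only [sq] using memLp_two_mul_of_memLp_four hf hf

end FourthMoments

/-! ### Queue vectors and the maximum weight -/

namespace Network

section Vectors

variable {N F : Type*} [Fintype N] [Fintype F]

/-- The Euclidean inner product of queue vectors, as a bilinear form. -/
def dot : QVec N F →ₗ[ℝ] QVec N F →ₗ[ℝ] ℝ :=
  LinearMap.mk₂ ℝ (fun w x => ∑ n, ∑ f, w n f * x n f)
    (fun _ _ _ => by simp only [Pi.add_apply, add_mul, Finset.sum_add_distrib])
    (fun _ _ _ => by simp only [Pi.smul_apply, smul_eq_mul, mul_assoc, Finset.mul_sum])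
    (fun _ _ _ => by simp only [Pi.add_apply, mul_add, Finset.sum_add_distrib])
    (fun _ _ _ => by simp only [Pi.smul_apply, smul_eq_mul, mul_left_comm, Finset.mul_sum])

/-- The sum of the entries of a queue vector. -/
def total (w : QVec N F) : ℝ := ∑ n, ∑ f, w n f

/-- The squared Euclidean norm, which is the Lyapunov function of the queues. -/
def sqNorm (w : QVec N F) : ℝ := dot w w

theorem dot_apply (w x : QVec N F) : dot w x = ∑ n, ∑ f, w n f * x n f := rfl

theorem dot_comm (w x : QVec N F) : dot w x = dot x w := by
  simp only [dot_apply, mul_comm]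

theorem dot_const (w : QVec N F) (c : ℝ) : dot w (fun _ _ => c) = c * total w := by
  simp only [dot_apply, total, Finset.mul_sum, mul_comm]

theorem dot_nonneg {w x : QVec N F} (hw : 0 ≤ w) (hx : 0 ≤ x) : 0 ≤ dot w x :=
  Finset.sum_nonneg fun n _ => Finset.sum_nonneg fun f _ => mul_nonneg (hw n f) (hx n f)

theorem dot_mono_right {w x y : QVec N F} (hw : 0 ≤ w) (h : x ≤ y) : dot w x ≤ dot w y :=
  sub_nonneg.1 (by rw [← map_sub]; exact dot_nonneg hw (sub_nonneg.2 h))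

theorem dot_le_mul_total {w x : QVec N F} (hw : 0 ≤ w) {c : ℝ} (h : ∀ n f, x n f ≤ c) :
    dot w x ≤ c * total w :=
  dot_const w c ▸ dot_mono_right hw h

theorem continuous_dot_right (w : QVec N F) : Continuous fun x => dot w x := by
  simp only [dot_apply]; fun_prop

theorem total_nonneg {w : QVec N F} (hw : 0 ≤ w) : 0 ≤ total w :=
  Finset.sum_nonneg fun n _ => Finset.sum_nonneg fun f _ => hw n f

theorem entry_le_total {w : QVec N F} (hw : 0 ≤ w) (n : N) (f : F) : w n f ≤ total w :=
  calc w n f ≤ ∑ f, w n f := Finset.single_le_sum (fun f _ => hw n f) (Finset.mem_univ f)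
    _ ≤ total w := Finset.single_le_sum (f := fun n => ∑ f, w n f)
        (fun n _ => Finset.sum_nonneg fun f _ => hw n f) (Finset.mem_univ n)

theorem sqNorm_eq_sum (w : QVec N F) : sqNorm w = ∑ n, ∑ f, w n f ^ 2 := by
  simp only [sqNorm, dot_apply, sq]

theorem sqNorm_nonneg (w : QVec N F) : 0 ≤ sqNorm w := by
  rw [sqNorm_eq_sum]; positivity

theorem sq_entry_le_sqNorm (w : QVec N F) (n : N) (f : F) : w n f ^ 2 ≤ sqNorm w :=
  sqNorm_eq_sum w ▸ entry_le_total (w := fun n f => w n f ^ 2) (fun _ _ => sq_nonneg _) n f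

theorem sqNorm_le_sqNorm {w x : QVec N F} (h : ∀ n f, |w n f| ≤ |x n f|) :
    sqNorm w ≤ sqNorm x := by
  simp only [sqNorm_eq_sum]
  exact Finset.sum_le_sum fun n _ => Finset.sum_le_sum fun f _ => sq_le_sq.2 (h n f)

theorem sqNorm_le_card_mul {w : QVec N F} {c : ℝ} (h : ∀ n f, w n f ^ 2 ≤ c) :
    sqNorm w ≤ Fintype.card N * Fintype.card F * c := by
  calc sqNorm w ≤ ∑ _n : N, ∑ _f : F, c := sqNorm_eq_sum w ▸
        Finset.sum_le_sum fun n _ => Finset.sum_le_sum fun f _ => h n f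
    _ = Fintype.card N * Fintype.card F * c := by
        simp only [Finset.sum_const, Finset.card_univ, nsmul_eq_mul, mul_assoc]

theorem sqNorm_add (w x : QVec N F) : sqNorm (w + x) = sqNorm w + 2 * dot w x + sqNorm x := by
  simp only [sqNorm, map_add, LinearMap.add_apply, dot_comm x w]
  ring

theorem sqNorm_sub (w x : QVec N F) : sqNorm (w - x) = sqNorm w - 2 * dot w x + sqNorm x := by
  simp only [sqNorm, map_sub, LinearMap.sub_apply, dot_comm x w]
  ring

theorem sqNorm_add_le (w x : QVec N F) : sqNorm (w + x) ≤ 2 * sqNorm w + 2 * sqNorm x := by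
  linarith [sqNorm_add w x, sqNorm_sub w x, sqNorm_nonneg (w - x)]

theorem sqNorm_le_sq_total {w : QVec N F} (hw : 0 ≤ w) : sqNorm w ≤ total w ^ 2 :=
  sq (total w) ▸ dot_le_mul_total hw (entry_le_total hw)

theorem sq_dot_le (w x : QVec N F) : dot w x ^ 2 ≤ sqNorm w * sqNorm x := by
  have h := Finset.sum_mul_sq_le_sq_mul_sq (Finset.univ : Finset (N × F))
    (fun i => w i.1 i.2) (fun i => x i.1 i.2)
  simpa only [Fintype.sum_prod_type, ← sqNorm_eq_sum, ← dot_apply] using h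

theorem sq_total_le (w : QVec N F) :
    total w ^ 2 ≤ Fintype.card N * Fintype.card F * sqNorm w := by
  calc total w ^ 2 = dot w (fun _ _ => 1) ^ 2 := by rw [dot_const, one_mul]
    _ ≤ sqNorm w * sqNorm (fun (_ : N) (_ : F) => (1 : ℝ)) := sq_dot_le _ _
    _ ≤ sqNorm w * (Fintype.card N * Fintype.card F * 1) :=
        mul_le_mul_of_nonneg_left (sqNorm_le_card_mul fun _ _ => (one_pow 2).le) (sqNorm_nonneg w)
    _ = Fintype.card N * Fintype.card F * sqNorm w := by ring

end Vectors

section Pressure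

variable {N F : Type*}

/-- The largest positive part over the flows of the pressure `w n f - w m f` on link `(n, m)`. -/
def pressure (w : QVec N F) (n m : N) : ℝ := ⨆ f, max 0 (w n f - w m f)

theorem pressure_nonneg (w : QVec N F) (n m : N) : 0 ≤ pressure w n m :=
  Real.iSup_nonneg fun _ => le_max_left _ _

theorem pressure_le {w : QVec N F} {n m : N} {c : ℝ} (hc : 0 ≤ c)
    (h : ∀ f, w n f - w m f ≤ c) : pressure w n m ≤ c :=
  Real.iSup_le (fun f => max_le hc (h f)) hc

variable [Finite F]

theorem le_pressure (w : QVec N F) (n m : N) (f : F) : w n f - w m f ≤ pressure w n m :=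
  (le_max_right _ _).trans
    (le_ciSup (f := fun f => max 0 (w n f - w m f)) (Set.finite_range _).bddAbove f)

theorem pressure_add_le (w x : QVec N F) (n m : N) :
    pressure (w + x) n m ≤ pressure w n m + pressure x n m :=
  pressure_le (add_nonneg (pressure_nonneg w n m) (pressure_nonneg x n m)) fun f => by
    simpa only [Pi.add_apply, add_sub_add_comm] using
      add_le_add (le_pressure w n m f) (le_pressure x n m f)

theorem pressure_smul_le {c : ℝ} (hc : 0 ≤ c) (w : QVec N F) (n m : N) :
    pressure (c • w) n m ≤ c * pressure w n m :=
  pressure_le (mul_nonneg hc (pressure_nonneg w n m)) fun f => by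
    simpa only [Pi.smul_apply, smul_eq_mul, mul_sub] using
      mul_le_mul_of_nonneg_left (le_pressure w n m f) hc

end Pressure

section Rates

variable {N F : Type*} [Fintype N]

theorem mem_nbrs {net : Network N F} {n m : N} : m ∈ net.nbrs n ↔ net.graph.Adj n m := by
  simp only [nbrs, Finset.mem_filter, Finset.mem_univ, true_and]

theorem mem_nbrs_comm {net : Network N F} {n m : N} : m ∈ net.nbrs n ↔ n ∈ net.nbrs m := by
  rw [mem_nbrs, mem_nbrs, net.graph.adj_comm]

theorem soloRate_nonneg (net : Network N F) (n m : N) {y : ℝ} (hy : 0 ≤ y) :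
    0 ≤ net.soloRate n m y := by
  have := net.α₁_pos; have := net.α₂_pos; have := net.frame_pos; have := net.bandwidth_pos
  have := net.noise_pos; have := net.power_pos n
  exact mul_nonneg (by positivity)
    (Real.logb_nonneg one_lt_two (le_add_of_nonneg_right (by positivity)))

theorem rateMax_nonneg (net : Network N F) : 0 ≤ net.rateMax :=
  Real.iSup_nonneg fun _ => Real.iSup_nonneg fun _ => net.soloRate_nonneg _ _ zero_le_one

theorem soloRate_one_le_rateMax (net : Network N F) {n m : N} (h : m ∈ net.nbrs n) :
    net.soloRate n m 1 ≤ net.rateMax :=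
  (le_ciSup (f := fun m : net.nbrs n => net.soloRate n m 1) (Set.finite_range _).bddAbove
    ⟨m, h⟩).trans
    (le_ciSup (f := fun n => ⨆ m : net.nbrs n, net.soloRate n m 1)
      (Set.finite_range _).bddAbove n)

theorem lamMax_nonneg (net : Network N F) : 0 ≤ net.lamMax :=
  mul_nonneg (Nat.cast_nonneg _) net.rateMax_nonneg

theorem card_mul_rateMax_le_lamMax (net : Network N F) (n : N) :
    ((net.nbrs n).card : ℝ) * net.rateMax ≤ net.lamMax :=
  mul_le_mul_of_nonneg_right
    (mod_cast Finset.le_sup (f := fun n => (net.nbrs n).card) (Finset.mem_univ n))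
    net.rateMax_nonneg

variable [DecidableEq N]

theorem linkRate_of_power_eq_zero (net : Network N F) {p : Alloc N} {n m : N}
    (h : p n m = 0) : net.linkRate p n m = 0 := by
  simp only [linkRate, h, zero_mul, zero_div, mul_zero, add_zero, Real.logb_one]

variable (net : Network N F) {s : N → Bool} {p : Alloc N} (hp : p ∈ net.allocations s)
include hp

theorem interference_nonneg (n m : N) : 0 ≤ net.interference p n m := by
  refine Finset.sum_nonneg fun i _ => Finset.sum_nonneg fun j _ => ?_
  have := (hp.1 i j).1
  have := net.power_pos i
  split_ifs <;> positivity

theorem linkRate_nonneg (n m : N) : 0 ≤ net.linkRate p n m := by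
  have := net.α₁_pos; have := net.α₂_pos; have := net.frame_pos; have := net.bandwidth_pos
  have := net.noise_pos; have := net.power_pos n
  have := net.interference_nonneg hp n m
  have := (hp.1 n m).1
  exact mul_nonneg (by positivity)
    (Real.logb_nonneg one_lt_two (le_add_of_nonneg_right (by positivity)))

theorem linkRate_of_notMem_nbrs {n m : N} (h : m ∉ net.nbrs n) : net.linkRate p n m = 0 :=
  net.linkRate_of_power_eq_zero (by_contra fun h0 => h (hp.2.2 n m h0).1)

theorem linkRate_le_rateMax (n m : N) : net.linkRate p n m ≤ net.rateMax := by
  by_cases h : m ∈ net.nbrs n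
  · refine le_trans ?_ (net.soloRate_one_le_rateMax h)
    have := net.α₁_pos; have := net.α₂_pos; have := net.frame_pos; have := net.bandwidth_pos
    have := net.noise_pos; have := net.power_pos n
    have hI := net.interference_nonneg hp n m
    obtain ⟨h0, h1⟩ := hp.1 n m
    refine mul_le_mul_of_nonneg_left ?_ (by positivity)
    refine Real.logb_le_logb_of_le one_lt_two (by positivity) ?_
    gcongr
    exact le_add_of_nonneg_left hI
  · rw [net.linkRate_of_notMem_nbrs hp h]
    exact net.rateMax_nonneg

theorem sum_linkRate_le_lamMax (n : N) : ∑ m, net.linkRate p n m ≤ net.lamMax :=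
  calc ∑ m, net.linkRate p n m = ∑ m ∈ net.nbrs n, net.linkRate p n m :=
        (Finset.sum_subset (Finset.subset_univ _) fun m _ hm =>
          net.linkRate_of_notMem_nbrs hp hm).symm
    _ ≤ (net.nbrs n).card * net.rateMax := by
        simpa only [nsmul_eq_mul] using Finset.sum_le_card_nsmul (net.nbrs n)
          (fun m => net.linkRate p n m) net.rateMax fun m _ => net.linkRate_le_rateMax hp n m
    _ ≤ net.lamMax := net.card_mul_rateMax_le_lamMax n

end Rates

section MaxWeight

variable {N F : Type*} [Fintype N] [DecidableEq N]

/-- The maximum-weight objective of an allocation: every link rate is weighted with the pressure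
on the link, regardless of how much traffic is queued. -/
def weight (net : Network N F) (w : QVec N F) (p : Alloc N) : ℝ :=
  ∑ n, ∑ m, net.linkRate p n m * pressure w n m

/-- The supremum of the maximum-weight objective over the allowed allocations. It is the support
function that describes the capacity region. -/
def maxWeight (net : Network N F) (Pc : (N → Bool) → Set (Alloc N)) (w : QVec N F) : ℝ :=
  ⨆ p : (⋃ s, Pc s : Set (Alloc N)), net.weight w p

variable {net : Network N F} {Pc : (N → Bool) → Set (Alloc N)}

theorem weight_nonneg {s : N → Bool} {p : Alloc N} (hp : p ∈ net.allocations s)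
    (w : QVec N F) : 0 ≤ net.weight w p :=
  Finset.sum_nonneg fun n _ => Finset.sum_nonneg fun m _ =>
    mul_nonneg (net.linkRate_nonneg hp n m) (pressure_nonneg w n m)

theorem maxWeight_le {w : QVec N F} {c : ℝ} (hc : 0 ≤ c)
    (h : ∀ s, ∀ p ∈ Pc s, net.weight w p ≤ c) : net.maxWeight Pc w ≤ c := by
  refine Real.iSup_le (fun p => ?_) hc
  obtain ⟨s, hs⟩ := Set.mem_iUnion.1 p.2
  exact h s _ hs

theorem exists_maxWeight_sub_lt_weight (hne : ∃ s, (Pc s).Nonempty) (w : QVec N F) {ε : ℝ}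
    (hε : 0 < ε) : ∃ s, ∃ p ∈ Pc s, net.maxWeight Pc w - ε < net.weight w p := by
  have : Nonempty (⋃ s, Pc s : Set (Alloc N)) := by
    obtain ⟨s, p, hp⟩ := hne
    exact ⟨⟨p, Set.mem_iUnion.2 ⟨s, hp⟩⟩⟩
  obtain ⟨⟨p, hp⟩, h⟩ := exists_lt_of_lt_ciSup (sub_lt_self (net.maxWeight Pc w) hε)
  obtain ⟨s, hs⟩ := Set.mem_iUnion.1 hp
  exact ⟨s, p, hs, h⟩

variable (hPc : ∀ s, Pc s ⊆ net.allocations s)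
include hPc

theorem weight_le_maxWeight {s : N → Bool} {p : Alloc N} (hp : p ∈ Pc s) (w : QVec N F) :
    net.weight w p ≤ net.maxWeight Pc w := by
  refine le_ciSup (f := fun p : (⋃ s, Pc s : Set (Alloc N)) => net.weight w p)
    ⟨∑ n, ∑ m, net.rateMax * pressure w n m, ?_⟩ ⟨p, Set.mem_iUnion.2 ⟨s, hp⟩⟩
  rintro _ ⟨p', rfl⟩
  obtain ⟨s', hs'⟩ := Set.mem_iUnion.1 p'.2
  exact Finset.sum_le_sum fun n _ => Finset.sum_le_sum fun m _ =>
    mul_le_mul_of_nonneg_right (net.linkRate_le_rateMax (hPc s' hs') n m) (pressure_nonneg w n m)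

theorem maxWeight_nonneg (w : QVec N F) : 0 ≤ net.maxWeight Pc w := by
  refine Real.iSup_nonneg fun p => ?_
  obtain ⟨s, hs⟩ := Set.mem_iUnion.1 p.2
  exact weight_nonneg (hPc s hs) w

variable [Finite F]

theorem maxWeight_add_le (w x : QVec N F) :
    net.maxWeight Pc (w + x) ≤ net.maxWeight Pc w + net.maxWeight Pc x := by
  refine maxWeight_le (add_nonneg (maxWeight_nonneg hPc w) (maxWeight_nonneg hPc x))
    fun s p hp => ?_
  refine le_trans ?_ (add_le_add (weight_le_maxWeight hPc hp w) (weight_le_maxWeight hPc hp x))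
  simp only [weight, ← Finset.sum_add_distrib, ← mul_add]
  exact Finset.sum_le_sum fun n _ => Finset.sum_le_sum fun m _ =>
    mul_le_mul_of_nonneg_left (pressure_add_le w x n m) (net.linkRate_nonneg (hPc s hp) n m)

theorem maxWeight_smul_le {c : ℝ} (hc : 0 ≤ c) (w : QVec N F) :
    net.maxWeight Pc (c • w) ≤ c * net.maxWeight Pc w := by
  refine maxWeight_le (mul_nonneg hc (maxWeight_nonneg hPc w)) fun s p hp => ?_
  refine le_trans ?_ (mul_le_mul_of_nonneg_left (weight_le_maxWeight hPc hp w) hc)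
  simp only [weight, Finset.mul_sum, mul_left_comm c]
  exact Finset.sum_le_sum fun n _ => Finset.sum_le_sum fun m _ =>
    mul_le_mul_of_nonneg_left (pressure_smul_le hc w n m) (net.linkRate_nonneg (hPc s hp) n m)

theorem maxWeight_sum_le {ι : Type*} (t : Finset ι) (w : ι → QVec N F) :
    net.maxWeight Pc (∑ i ∈ t, w i) ≤ ∑ i ∈ t, net.maxWeight Pc (w i) := by
  have h0 : net.maxWeight Pc 0 ≤ 0 := by
    simpa only [zero_smul, zero_mul] using maxWeight_smul_le hPc le_rfl (0 : QVec N F)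
  exact Finset.le_sum_of_subadditive _ h0 (maxWeight_add_le hPc) t w

end MaxWeight

/-! ### Queue dynamics and back pressure -/

section Flows

variable {N F : Type*} [Fintype N] [DecidableEq N] [Fintype F]

/-- The possible queue vectors: they are nonnegative and vanish at the destinations. -/
def queueStates (net : Network N F) : Set (QVec N F) :=
  {w | 0 ≤ w ∧ ∀ f, ∀ n ∈ net.dst f, w n f = 0}

/-- The flow rates `r` respect the link rates of the valid allocation `p` and the queue lengths
`q`. -/
structure Admissible (net : Network N F) (s : N → Bool) (p : Alloc N) (q : QVec N F)
    (r : N → N → F → ℝ) : Prop where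
  mem_allocations : p ∈ net.allocations s
  nonneg : ∀ n m f, 0 ≤ r n m f
  le_link : ∀ n m, ∑ f, r n m f ≤ net.linkRate p n m
  le_queue : ∀ n f, ∑ m ∈ net.nbrs n, r n m f ≤ q n f

/-- The gain of the flow rates `r` for queue weights `w`: each transported bit counts with the
difference of the weights of the queues it leaves and enters. -/
def flowGain (w : QVec N F) (r : N → N → F → ℝ) : ℝ :=
  ∑ n, ∑ m, ∑ f, r n m f * (w n f - w m f)

/-- The traffic that neighbours send to a queue minus the traffic that the queue sends out. -/
def netInflow (net : Network N F) (r : N → N → F → ℝ) : QVec N F := fun n f =>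
  ∑ m ∈ net.nbrs n, r m n f - ∑ m ∈ net.nbrs n, r n m f

/-- The queues one frame after `q`, under the flow rates `r` and the arrivals `a`. -/
def nextQueue (net : Network N F) (q : QVec N F) (r : N → N → F → ℝ) (a : QVec N F) :
    QVec N F :=
  fun n f => if n ∈ net.dst f then 0
    else q n f + ∑ m ∈ net.nbrs n, r m n f - ∑ m ∈ net.nbrs n, r n m f + a n f

/-- The contribution of the transport in one frame to the drift of the squared queue norm: twice
a bound on the squared norm of the net inflow. -/
def driftConst (net : Network N F) : ℝ :=
  2 * (Fintype.card N * Fintype.card F * (Fintype.card N * net.rateMax) ^ 2)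

variable {net : Network N F} {s : N → Bool} {p : Alloc N} {q : QVec N F} {r : N → N → F → ℝ}

omit [Fintype F] in
theorem nextQueue_apply_of_notMem {n : N} {f : F} (hn : n ∉ net.dst f) (a : QVec N F) :
    net.nextQueue q r a n f = (q + net.netInflow r + a) n f := by
  simp only [nextQueue, if_neg hn, netInflow, Pi.add_apply, add_sub_assoc]

theorem dot_nextQueue {w : QVec N F} (hw : ∀ f, ∀ n ∈ net.dst f, w n f = 0) (a : QVec N F) :
    dot w (net.nextQueue q r a) = dot w q + dot w (net.netInflow r) + dot w a := by
  rw [← map_add, ← map_add]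
  refine Finset.sum_congr rfl fun n _ => Finset.sum_congr rfl fun f _ => ?_
  by_cases hn : n ∈ net.dst f
  · rw [hw f n hn, zero_mul, zero_mul]
  · rw [nextQueue_apply_of_notMem hn]

theorem sqNorm_nextQueue_le (q : QVec N F) (r : N → N → F → ℝ) (a : QVec N F) :
    sqNorm (net.nextQueue q r a) ≤ sqNorm (q + net.netInflow r + a) := by
  refine sqNorm_le_sqNorm fun n f => ?_
  by_cases hn : n ∈ net.dst f
  · simp only [nextQueue, if_pos hn, abs_zero, abs_nonneg]
  · rw [nextQueue_apply_of_notMem hn]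

namespace Admissible

variable (h : net.Admissible s p q r)
include h

theorem nextQueue_mem_queueStates {a : QVec N F} (ha : 0 ≤ a) :
    net.nextQueue q r a ∈ net.queueStates := by
  refine ⟨fun n f => ?_, fun f n hn => if_pos hn⟩
  have hin : 0 ≤ ∑ m ∈ net.nbrs n, r m n f := Finset.sum_nonneg fun m _ => h.nonneg m n f
  have hout := h.le_queue n f
  have haf : 0 ≤ a n f := ha n f
  simp only [nextQueue, Pi.zero_apply]
  split_ifs <;> linarith

theorem rate_le_linkRate (n m : N) (f : F) : r n m f ≤ net.linkRate p n m :=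
  (Finset.single_le_sum (fun f _ => h.nonneg n m f) (Finset.mem_univ f)).trans (h.le_link n m)

theorem rate_eq_zero {n m : N} (hm : m ∉ net.nbrs n) (f : F) : r n m f = 0 :=
  le_antisymm ((h.rate_le_linkRate n m f).trans_eq
    (net.linkRate_of_notMem_nbrs h.mem_allocations hm)) (h.nonneg n m f)

theorem netInflow_apply (n : N) (f : F) :
    net.netInflow r n f = ∑ m, r m n f - ∑ m, r n m f := by
  rw [netInflow,
    Finset.sum_subset (Finset.subset_univ (net.nbrs n)) fun _ _ hm => h.rate_eq_zero hm f,
    Finset.sum_subset (Finset.subset_univ (net.nbrs n)) fun _ _ hm =>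
      h.rate_eq_zero (fun h' => hm (mem_nbrs_comm.1 h')) f]

theorem dot_netInflow (w : QVec N F) : dot w (net.netInflow r) = -flowGain w r := by
  have hout : ∑ n, ∑ f, ∑ m, w n f * r n m f = ∑ n, ∑ m, ∑ f, w n f * r n m f :=
    Finset.sum_congr rfl fun n _ => Finset.sum_comm
  have hin : ∑ n, ∑ f, ∑ m, w n f * r m n f = ∑ n, ∑ m, ∑ f, w m f * r n m f := by
    rw [Finset.sum_comm (f := fun n m => ∑ f, w m f * r n m f)]
    exact Finset.sum_congr rfl fun n _ => Finset.sum_comm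
  simp only [dot_apply, h.netInflow_apply, mul_sub, Finset.mul_sum, Finset.sum_sub_distrib, hout,
    hin, flowGain, mul_comm (r _ _ _), sub_mul, neg_sub]

theorem sq_netInflow_le (n : N) (f : F) :
    net.netInflow r n f ^ 2 ≤ (Fintype.card N * net.rateMax) ^ 2 := by
  have sum_le : ∀ g : N → ℝ, (∀ m, g m ≤ net.rateMax) →
      ∑ m, g m ≤ Fintype.card N * net.rateMax := fun g hg => by
    simpa only [nsmul_eq_mul, Finset.card_univ] using
      Finset.sum_le_card_nsmul Finset.univ g net.rateMax fun m _ => hg m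
  have rate_le : ∀ n m, r n m f ≤ net.rateMax := fun n m =>
    (h.rate_le_linkRate n m f).trans (net.linkRate_le_rateMax h.mem_allocations n m)
  have hin := sum_le (fun m => r m n f) fun m => rate_le m n
  have hout := sum_le (fun m => r n m f) fun m => rate_le n m
  have hin0 : 0 ≤ ∑ m, r m n f := Finset.sum_nonneg fun m _ => h.nonneg m n f
  have hout0 : 0 ≤ ∑ m, r n m f := Finset.sum_nonneg fun m _ => h.nonneg n m f
  rw [h.netInflow_apply]
  exact sq_le_sq' (by linarith) (by linarith)

theorem sqNorm_netInflow_le : 2 * sqNorm (net.netInflow r) ≤ net.driftConst :=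
  mul_le_mul_of_nonneg_left (sqNorm_le_card_mul h.sq_netInflow_le) zero_le_two

theorem sqNorm_nextQueue_le (a : QVec N F) :
    sqNorm (net.nextQueue q r a) ≤
      sqNorm q + 2 * dot q a - 2 * flowGain q r + net.driftConst + 2 * sqNorm a := by
  have hnext := Network.sqNorm_nextQueue_le (net := net) q r a
  have hsplit := sqNorm_add_le (net.netInflow r) a
  have hinflow := h.sqNorm_netInflow_le
  rw [add_assoc, sqNorm_add, map_add, h.dot_netInflow] at hnext
  linarith

theorem flowGain_le_weight (w : QVec N F) : flowGain w r ≤ net.weight w p := by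
  refine Finset.sum_le_sum fun n _ => Finset.sum_le_sum fun m _ => ?_
  calc ∑ f, r n m f * (w n f - w m f)
      ≤ ∑ f, r n m f * pressure w n m := Finset.sum_le_sum fun f _ =>
        mul_le_mul_of_nonneg_left (le_pressure w n m f) (h.nonneg n m f)
    _ = (∑ f, r n m f) * pressure w n m := by rw [Finset.sum_mul]
    _ ≤ net.linkRate p n m * pressure w n m :=
        mul_le_mul_of_nonneg_right (h.le_link n m) (pressure_nonneg w n m)

end Admissible

end Flows

section MBP

theorem exists_isTopFlow {N F : Type*} [Finite F] [Nonempty F] (q : QVec N F) :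
    ∃ fs, IsTopFlow q fs := by
  choose fs hfs using fun n m => Finite.exists_max fun f => q n f - q m f
  exact ⟨fs, hfs⟩

variable {N F : Type*} [Fintype N] [DecidableEq N] [DecidableEq F]
  {net : Network N F} {s : N → Bool} {p : Alloc N} {q : QVec N F} {fs : N → N → F}

theorem mbpRate_of_ne {n m : N} {f : F} (h : f ≠ fs n m) : net.mbpRate q fs p n m f = 0 :=
  if_neg fun h' => h h'.1

theorem mbpRate_of_pressure_nonpos {n m : N} {f : F} (h : q n f - q m f ≤ 0) :
    net.mbpRate q fs p n m f = 0 :=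
  if_neg fun h' => h'.2.not_ge h

theorem sum_share_le_one (n : N) (f : F) :
    ∑ m with fs n m = f, net.share fs p n m ≤ 1 := by
  have : ∀ m ∈ Finset.univ.filter (fun m => fs n m = f), net.share fs p n m
      = net.linkRate p n m / ∑ m' with fs n m' = f, net.linkRate p n m' := by
    intro m hm
    rw [share, (Finset.mem_filter.1 hm).2]
  rw [Finset.sum_congr rfl this, ← Finset.sum_div]
  exact div_self_le_one _

/-- The loss of back pressure that is due to short queues: a link whose rate is cut down to a
share of its queue serves a queue of at most `lamMax`. -/
def mbpLoss (net : Network N F) : ℝ :=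
  Fintype.card N * (Fintype.card N * (net.rateMax * net.lamMax))

omit [DecidableEq N] [DecidableEq F] in
theorem mbpLoss_nonneg (net : Network N F) : 0 ≤ net.mbpLoss := by
  have := net.rateMax_nonneg; have := net.lamMax_nonneg
  unfold mbpLoss; positivity

section Allocation

variable (hp : p ∈ net.allocations s)
include hp

theorem share_nonneg (n m : N) : 0 ≤ net.share fs p n m :=
  div_nonneg (net.linkRate_nonneg hp n m)
    (Finset.sum_nonneg fun m' _ => net.linkRate_nonneg hp n m')

theorem mbpRate_le_linkRate (n m : N) (f : F) :
    net.mbpRate q fs p n m f ≤ net.linkRate p n m := by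
  unfold mbpRate
  split_ifs
  exacts [min_le_left _ _, net.linkRate_nonneg hp n m]

theorem linkRate_mul_queue_le_of_share {n m : N}
    (hshare : q n (fs n m) * net.share fs p n m ≤ net.linkRate p n m) :
    net.linkRate p n m * q n (fs n m) ≤ net.rateMax * net.lamMax := by
  set S := ∑ m' with fs n m' = fs n m, net.linkRate p n m' with hS
  have hr := net.linkRate_nonneg hp n m
  have hrS : net.linkRate p n m ≤ S :=
    Finset.single_le_sum (f := fun m' => net.linkRate p n m')
      (fun m' _ => net.linkRate_nonneg hp n m')
      (Finset.mem_filter.2 ⟨Finset.mem_univ m, rfl⟩)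
  have hSle : S ≤ net.lamMax :=
    (Finset.sum_le_sum_of_subset_of_nonneg (Finset.subset_univ _)
      fun m' _ _ => net.linkRate_nonneg hp n m').trans (net.sum_linkRate_le_lamMax hp n)
  have hqS : net.linkRate p n m * q n (fs n m) ≤ net.linkRate p n m * S := by
    rcases hr.eq_or_lt with h0 | hpos
    · rw [← h0, zero_mul, zero_mul]
    · rw [share, ← hS, ← mul_div_assoc, div_le_iff₀ (hpos.trans_le hrS)] at hshare
      rwa [mul_comm]
  exact hqS.trans (mul_le_mul (net.linkRate_le_rateMax hp n m) hSle (hr.trans hrS)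
    net.rateMax_nonneg)

variable (hq : 0 ≤ q)
include hq

theorem mbpRate_nonneg (n m : N) (f : F) : 0 ≤ net.mbpRate q fs p n m f := by
  unfold mbpRate
  split_ifs
  exacts [le_min (net.linkRate_nonneg hp n m) (mul_nonneg (hq n f) (share_nonneg hp n m)), le_rfl]

theorem mbpRate_le_queue_mul_share (n m : N) (f : F) :
    net.mbpRate q fs p n m f ≤ q n f * net.share fs p n m := by
  unfold mbpRate
  split_ifs
  exacts [min_le_right _ _, mul_nonneg (hq n f) (share_nonneg hp n m)]

theorem mbpRate_mul_nonneg (n m : N) (f : F) :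
    0 ≤ net.mbpRate q fs p n m f * (q n f - q m f) := by
  rcases le_total (q n f - q m f) 0 with h | h
  · rw [mbpRate_of_pressure_nonpos h, zero_mul]
  · exact mul_nonneg (mbpRate_nonneg hp hq n m f) h

theorem sum_nbrs_mbpRate_le_queue (n : N) (f : F) :
    ∑ m ∈ net.nbrs n, net.mbpRate q fs p n m f ≤ q n f :=
  calc ∑ m ∈ net.nbrs n, net.mbpRate q fs p n m f ≤ ∑ m, net.mbpRate q fs p n m f :=
        Finset.sum_le_sum_of_subset_of_nonneg (Finset.subset_univ _)
          fun m _ _ => mbpRate_nonneg hp hq n m f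
    _ = ∑ m with fs n m = f, net.mbpRate q fs p n m f :=
        (Finset.sum_filter_of_ne fun m _ hm =>
          by_contra fun h => hm (mbpRate_of_ne fun h' => h h'.symm)).symm
    _ ≤ ∑ m with fs n m = f, q n f * net.share fs p n m :=
        Finset.sum_le_sum fun m _ => mbpRate_le_queue_mul_share hp hq n m f
    _ ≤ q n f := by
        rw [← Finset.mul_sum]
        exact mul_le_of_le_one_right (hq n f) (sum_share_le_one n f)

theorem linkRate_mul_pressure_le (hfs : IsTopFlow q fs) (n m : N) :
    net.linkRate p n m * pressure q n m ≤
      net.mbpRate q fs p n m (fs n m) * (q n (fs n m) - q m (fs n m))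
        + net.rateMax * net.lamMax := by
  have hr := net.linkRate_nonneg hp n m
  have hloss : 0 ≤ net.rateMax * net.lamMax := by
    have := net.rateMax_nonneg; have := net.lamMax_nonneg
    positivity
  have hrate := mbpRate_mul_nonneg (fs := fs) hp hq n m (fs n m)
  rcases le_or_gt (q n (fs n m) - q m (fs n m)) 0 with hdiff | hdiff
  · have hpr : pressure q n m = 0 :=
      le_antisymm (pressure_le le_rfl fun f => (hfs n m f).trans hdiff) (pressure_nonneg q n m)
    rw [hpr, mul_zero]
    exact add_nonneg hrate hloss
  · have hpr : net.linkRate p n m * pressure q n m ≤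
        net.linkRate p n m * (q n (fs n m) - q m (fs n m)) :=
      mul_le_mul_of_nonneg_left (pressure_le hdiff.le (hfs n m)) hr
    rcases le_total (net.linkRate p n m) (q n (fs n m) * net.share fs p n m) with hmin | hmin
    · rw [mbpRate, if_pos ⟨rfl, hdiff⟩, min_eq_left hmin]
      linarith
    · have hqueue := linkRate_mul_queue_le_of_share hp hmin
      have hqm := mul_nonneg hr (hq m (fs n m))
      linarith

theorem weight_le_mbpObjective [Finite F] (hfs : IsTopFlow q fs) :
    net.weight q p ≤ net.mbpObjective q fs p + net.mbpLoss := by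
  have hloss : net.mbpLoss = ∑ _n : N, ∑ _m : N, net.rateMax * net.lamMax := by
    simp only [mbpLoss, Finset.sum_const, Finset.card_univ, nsmul_eq_mul]
  simp only [hloss, mbpObjective, ← Finset.sum_add_distrib]
  refine Finset.sum_le_sum fun n _ => Finset.sum_le_sum fun m _ =>
    (linkRate_mul_pressure_le hp hq hfs n m).trans ?_
  gcongr
  exact le_ciSup (f := fun f => net.mbpRate q fs p n m f * (q n f - q m f))
    (Set.finite_range _).bddAbove (fs n m)

variable [Fintype F]

theorem admissible_mbpRate : net.Admissible s p q (net.mbpRate q fs p) where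
  mem_allocations := hp
  nonneg := mbpRate_nonneg hp hq
  le_link n m := by
    rw [Finset.sum_eq_single (fs n m) (fun f _ hf => mbpRate_of_ne hf)
      (fun h => (h (Finset.mem_univ _)).elim)]
    exact mbpRate_le_linkRate hp n m (fs n m)
  le_queue := sum_nbrs_mbpRate_le_queue hp hq

theorem flowGain_mbpRate_nonneg : 0 ≤ flowGain q (net.mbpRate q fs p) :=
  Finset.sum_nonneg fun n _ => Finset.sum_nonneg fun m _ => Finset.sum_nonneg fun f _ =>
    mbpRate_mul_nonneg hp hq n m f

theorem mbpObjective_le_flowGain : net.mbpObjective q fs p ≤ flowGain q (net.mbpRate q fs p) :=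
  Finset.sum_le_sum fun n _ => Finset.sum_le_sum fun m _ =>
    Real.iSup_le (fun f => Finset.single_le_sum
      (f := fun f => net.mbpRate q fs p n m f * (q n f - q m f))
      (fun f _ => mbpRate_mul_nonneg hp hq n m f) (Finset.mem_univ f))
      (Finset.sum_nonneg fun f _ => mbpRate_mul_nonneg hp hq n m f)

end Allocation

variable [Fintype F] {Pc : (N → Bool) → Set (Alloc N)} (hPc : ∀ s, Pc s ⊆ net.allocations s)
include hPc

theorem IsMBPChoice.maxWeight_le (h : net.IsMBPChoice Pc q fs s p) (hq : 0 ≤ q) :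
    net.maxWeight Pc q ≤ flowGain q (net.mbpRate q fs p) + net.mbpLoss := by
  obtain ⟨hfs, hp, hmax⟩ := h
  refine Network.maxWeight_le
    (add_nonneg (flowGain_mbpRate_nonneg (hPc s hp) hq) net.mbpLoss_nonneg) fun s' p' hp' => ?_
  have hweight := weight_le_mbpObjective (hPc s' hp') hq hfs
  have hgain := mbpObjective_le_flowGain (fs := fs) (hPc s hp) hq
  linarith [hmax s' p' hp']

omit [DecidableEq F] in
theorem exists_admissible_maxWeight_le (hne : ∃ s, (Pc s).Nonempty) (hq : 0 ≤ q) :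
    ∃ s, ∃ p ∈ Pc s, ∃ r, net.Admissible s p q r ∧
      net.maxWeight Pc q ≤ flowGain q r + (net.mbpLoss + 1) := by
  classical
  obtain ⟨s, p, hp, hw⟩ := exists_maxWeight_sub_lt_weight hne q one_pos
  refine ⟨s, p, hp, ?_⟩
  rcases isEmpty_or_nonempty F with hF | hF
  · refine ⟨fun _ _ => isEmptyElim, ⟨hPc s hp, fun _ _ f => isEmptyElim f, fun n m => ?_,
      fun _ f => isEmptyElim f⟩, ?_⟩
    · simpa only [Finset.univ_eq_empty, Finset.sum_empty] using net.linkRate_nonneg (hPc s hp) n m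
    · simp only [weight, pressure, Real.iSup_of_isEmpty, mul_zero, Finset.sum_const_zero] at hw
      simp only [flowGain, Finset.univ_eq_empty, Finset.sum_empty, Finset.sum_const_zero]
      linarith [net.mbpLoss_nonneg]
  · obtain ⟨fs, hfs⟩ := exists_isTopFlow q
    refine ⟨net.mbpRate q fs p, admissible_mbpRate (hPc s hp) hq, ?_⟩
    have hweight := weight_le_mbpObjective (hPc s hp) hq hfs
    have hgain := mbpObjective_le_flowGain (fs := fs) (hPc s hp) hq
    linarith

end MBP

/-! ### Paths and moments of a run -/

section RandomVectors

variable {N F : Type*} [Fintype N] [Fintype F] {Ω : Type*} {m m₀ : MeasurableSpace Ω}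
  {μ : Measure Ω} {X Y : Ω → QVec N F}

theorem stronglyMeasurable_dot (hX : ∀ n f, StronglyMeasurable[m] fun ω => X ω n f)
    (hY : ∀ n f, StronglyMeasurable[m] fun ω => Y ω n f) :
    StronglyMeasurable[m] fun ω => dot (X ω) (Y ω) :=
  Finset.stronglyMeasurable_fun_sum _ fun n _ => Finset.stronglyMeasurable_fun_sum _ fun f _ =>
    (hX n f).mul (hY n f)

theorem memLp_dot (hX : ∀ n f, MemLp (fun ω => X ω n f) 4 μ)
    (hY : ∀ n f, MemLp (fun ω => Y ω n f) 4 μ) : MemLp (fun ω => dot (X ω) (Y ω)) 2 μ :=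
  memLp_finsetSum _ fun n _ => memLp_finsetSum _ fun f _ =>
    memLp_two_mul_of_memLp_four (hX n f) (hY n f)

theorem condExp_sqNorm_le {c : ℝ} (hX : ∀ n f, Integrable (fun ω => X ω n f ^ 2) μ)
    (hc : ∀ n f, μ[fun ω => X ω n f ^ 2 | m] ≤ᵐ[μ] fun _ => c) :
    μ[fun ω => sqNorm (X ω) | m] ≤ᵐ[μ] fun _ => Fintype.card N * Fintype.card F * c := by
  have hsum : (fun ω => sqNorm (X ω)) = ∑ i : N × F, fun ω => X ω i.1 i.2 ^ 2 := by
    funext ω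
    rw [sqNorm_eq_sum, Finset.sum_apply, Fintype.sum_prod_type]
  have hcond := condExp_finsetSum (s := Finset.univ) (fun (i : N × F) _ => hX i.1 i.2) m
  rw [hsum]
  filter_upwards [hcond, ae_all_iff.2 fun i : N × F => hc i.1 i.2] with ω hω hcω
  rw [hω, Finset.sum_apply]
  refine (Finset.sum_le_card_nsmul _ _ c fun i _ => hcω i).trans_eq ?_
  rw [Finset.card_univ, Fintype.card_prod, nsmul_eq_mul, Nat.cast_mul]

end RandomVectors

namespace Run

variable {N F : Type*} [Fintype N] [DecidableEq N] [Fintype F] {net : Network N F}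
  {Pc : (N → Bool) → Set (Alloc N)} {Ω : Type*} [MeasurableSpace Ω] {μ : Measure Ω}

/-- The deviation of the arrivals from their conditional mean given the history. -/
def arrivalNoise (R : net.Run Pc μ) (t : ℕ) (ω : Ω) : QVec N F := R.a t ω - R.lam t ω

/-- A bound on the conditional second moments of the norms of the arrivals and of their noise, when
the conditional fourth moments of the arrivals are at most `K`. -/
def arrivalMoment (N F : Type*) [Fintype N] [Fintype F] (K : ℝ) : ℝ :=
  Fintype.card N * Fintype.card F * (1 + K)

/-- The schedule is up to `c` as good as a maximum weight schedule in every frame. -/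
def IsNearMaxWeight (R : net.Run Pc μ) (c : ℝ) : Prop :=
  ∀ t ω, net.maxWeight Pc (R.q t ω) ≤ flowGain (R.q t ω) (R.rate t ω) + c

variable (R : net.Run Pc μ)

section Paths

theorem q_succ_eq_nextQueue (t : ℕ) (ω : Ω) :
    R.q (t + 1) ω = net.nextQueue (R.q t ω) (R.rate t ω) (R.a t ω) :=
  funext₂ (R.q_succ t ω)

theorem q_mem_queueStates (t : ℕ) (ω : Ω) : R.q t ω ∈ net.queueStates := by
  refine ⟨fun n f => ?_, fun f n hn => ?_⟩
  · exact (Finset.sum_nonneg fun m _ => R.rate_nonneg t ω n m f).trans (R.rate_le_queue t ω n f)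
  · cases t with
    | zero => rw [R.q_zero]; exact R.q₀_dst f n hn
    | succ t => rw [R.q_succ, if_pos hn]

theorem q_nonneg (t : ℕ) (ω : Ω) : 0 ≤ R.q t ω := (R.q_mem_queueStates t ω).1

theorem admissible (hPc : ∀ s, Pc s ⊆ net.allocations s) (t : ℕ) (ω : Ω) :
    net.Admissible (R.s t ω) (R.p t ω) (R.q t ω) (R.rate t ω) :=
  ⟨hPc _ (R.p_mem t ω), R.rate_nonneg t ω, R.rate_le_link t ω, R.rate_le_queue t ω⟩

include R in
theorem exists_nonempty [Nonempty Ω] : ∃ s, (Pc s).Nonempty :=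
  ⟨R.s 0 (Classical.arbitrary Ω), _, R.p_mem 0 (Classical.arbitrary Ω)⟩

theorem avgRate_eq (T : ℕ) (ω : Ω) :
    R.avgRate T ω = (T : ℝ)⁻¹ • ∑ t ∈ Finset.range T, R.lam t ω := by
  ext n f
  simp only [avgRate, div_eq_inv_mul, Pi.smul_apply, Finset.sum_apply, smul_eq_mul]

theorem avgQueue_eq (T : ℕ) (ω : Ω) :
    R.avgQueue T ω = (T : ℝ)⁻¹ • ∑ t ∈ Finset.range T, R.q t ω := by
  ext n f
  simp only [avgQueue, div_eq_inv_mul, Pi.smul_apply, Finset.sum_apply, smul_eq_mul]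

theorem total_avgQueue (T : ℕ) (ω : Ω) :
    total (R.avgQueue T ω) = (∑ t ∈ Finset.range T, total (R.q t ω)) / T := by
  have total_eq_dot (w : QVec N F) : total w = dot w fun _ _ => 1 := by rw [dot_const, one_mul]
  simp only [total_eq_dot, avgQueue_eq, map_smul, map_sum, LinearMap.smul_apply,
    LinearMap.sum_apply, smul_eq_mul, div_eq_inv_mul]

variable {R}

theorem dot_sum_lam_le (hPc : ∀ s, Pc s ⊆ net.allocations s) {w : QVec N F}
    (hw : w ∈ net.queueStates) (T : ℕ) (ω : Ω) :
    dot w (∑ t ∈ Finset.range T, R.lam t ω) ≤ T * net.maxWeight Pc w + dot w (R.q T ω)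
      - dot w (∑ t ∈ Finset.range T, R.arrivalNoise t ω) := by
  induction T with
  | zero => simpa using dot_nonneg hw.1 (R.q_nonneg 0 ω)
  | succ T ih =>
    have hgain := ((R.admissible hPc T ω).flowGain_le_weight w).trans
      (weight_le_maxWeight hPc (R.p_mem T ω) w)
    have hq := dot_nextQueue (q := R.q T ω) (r := R.rate T ω) hw.2 (R.a T ω)
    rw [(R.admissible hPc T ω).dot_netInflow, ← R.q_succ_eq_nextQueue] at hq
    rw [Finset.sum_range_succ, Finset.sum_range_succ, map_add, map_add, arrivalNoise, map_sub]
    push_cast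
    linarith

theorem IsNearMaxWeight.sqNorm_q_succ_le {c : ℝ} (h : R.IsNearMaxWeight c)
    (hPc : ∀ s, Pc s ⊆ net.allocations s) (t : ℕ) (ω : Ω) :
    sqNorm (R.q (t + 1) ω) + 2 * (net.maxWeight Pc (R.q t ω) - dot (R.q t ω) (R.lam t ω)) ≤
      sqNorm (R.q t ω) + 2 * dot (R.q t ω) (R.arrivalNoise t ω) + (2 * c + net.driftConst)
        + 2 * sqNorm (R.a t ω) := by
  have hdrift := (R.admissible hPc t ω).sqNorm_nextQueue_le (R.a t ω)
  rw [← R.q_succ_eq_nextQueue] at hdrift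
  have hnear := h t ω
  rw [arrivalNoise, map_sub]
  linarith

end Paths

section Moments

theorem stronglyMeasurable_a (t : ℕ) (n : N) (f : F) :
    StronglyMeasurable[R.ℱ (t + 1)] fun ω => R.a t ω n f :=
  ((measurable_pi_apply f).comp
    ((measurable_pi_apply n).comp (R.measurable_a t))).stronglyMeasurable

theorem stronglyMeasurable_lam (t : ℕ) (n : N) (f : F) :
    StronglyMeasurable[R.ℱ t] fun ω => R.lam t ω n f :=
  ((measurable_pi_apply f).comp
    ((measurable_pi_apply n).comp (R.measurable_lam t))).stronglyMeasurable

theorem stronglyMeasurable_rate (t : ℕ) (n m : N) (f : F) :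
    StronglyMeasurable[R.ℱ t] fun ω => R.rate t ω n m f :=
  ((measurable_pi_apply f).comp ((measurable_pi_apply m).comp
    ((measurable_pi_apply n).comp (R.measurable_rate t)))).stronglyMeasurable

theorem stronglyMeasurable_arrivalNoise (t : ℕ) (n : N) (f : F) :
    StronglyMeasurable[R.ℱ (t + 1)] fun ω => R.arrivalNoise t ω n f :=
  (R.stronglyMeasurable_a t n f).sub
    ((R.stronglyMeasurable_lam t n f).mono (R.ℱ.mono t.le_succ))

theorem stronglyMeasurable_q (t : ℕ) (n : N) (f : F) :
    StronglyMeasurable[R.ℱ t] fun ω => R.q t ω n f := by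
  induction t generalizing n f with
  | zero => simp only [R.q_zero]; exact stronglyMeasurable_const
  | succ t ih =>
    have hle := R.ℱ.mono t.le_succ
    simp only [R.q_succ]
    by_cases hn : n ∈ net.dst f
    · simp only [hn, if_true]; exact stronglyMeasurable_const
    · simp only [hn, if_false]
      exact ((((ih n f).mono hle).add
        (Finset.stronglyMeasurable_fun_sum _ fun m _ =>
          (R.stronglyMeasurable_rate t m n f).mono hle)).sub
        (Finset.stronglyMeasurable_fun_sum _ fun m _ =>
          (R.stronglyMeasurable_rate t n m f).mono hle)).add (R.stronglyMeasurable_a t n f)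

theorem arrivalNoise_ae_eq (t : ℕ) (n : N) (f : F) :
    (fun ω => R.arrivalNoise t ω n f) =ᵐ[μ]
      (fun ω => R.a t ω n f) - μ[fun ω => R.a t ω n f | R.ℱ t] := by
  filter_upwards [R.condExp_a t n f] with ω hω
  rw [Pi.sub_apply, hω, arrivalNoise, Pi.sub_apply, Pi.sub_apply]

variable {R} {K : ℝ} (hK : R.MomentBound K)
include hK

theorem MomentBound.memLp_a (t : ℕ) (n : N) (f : F) : MemLp (fun ω => R.a t ω n f) 4 μ :=
  memLp_four_of_integrable_pow
    ((R.stronglyMeasurable_a t n f).mono (R.ℱ.le _)).aestronglyMeasurable (hK t n f).1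

theorem MomentBound.memLp_lam (t : ℕ) (n : N) (f : F) : MemLp (fun ω => R.lam t ω n f) 4 μ :=
  ((hK.memLp_a t n f).condExp (by norm_num)).ae_eq (R.condExp_a t n f)

theorem MomentBound.memLp_arrivalNoise (t : ℕ) (n : N) (f : F) :
    MemLp (fun ω => R.arrivalNoise t ω n f) 4 μ :=
  (hK.memLp_a t n f).sub (hK.memLp_lam t n f)

end Moments

section Noise

variable {R} [IsProbabilityMeasure μ] {K : ℝ}

namespace MomentBound

variable (hK : R.MomentBound K)
include hK

theorem integrable_a_sq (t : ℕ) (n : N) (f : F) : Integrable (fun ω => R.a t ω n f ^ 2) μ :=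
  (memLp_two_sq_of_memLp_four (hK.memLp_a t n f)).integrable one_le_two

theorem condExp_a_sq_le (t : ℕ) (n : N) (f : F) :
    μ[fun ω => R.a t ω n f ^ 2 | R.ℱ t] ≤ᵐ[μ] fun _ => 1 + K := by
  have hmono : μ[fun ω => R.a t ω n f ^ 2 | R.ℱ t]
      ≤ᵐ[μ] μ[(fun _ => (1 : ℝ)) + fun ω => R.a t ω n f ^ 4 | R.ℱ t] := by
    refine condExp_mono (hK.integrable_a_sq t n f) ((integrable_const _).add (hK t n f).1)
      (Eventually.of_forall fun ω => ?_)
    simp only [Pi.add_apply]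
    nlinarith [sq_nonneg (R.a t ω n f ^ 2 - 1), sq_nonneg (R.a t ω n f ^ 2)]
  filter_upwards [hmono, condExp_add (integrable_const (1 : ℝ)) (hK t n f).1 (R.ℱ t),
    (hK t n f).2] with ω hmono hadd hfour
  rw [hadd, Pi.add_apply, condExp_const (R.ℱ.le t)] at hmono
  linarith

theorem isMartingaleDifference_arrivalNoise (n : N) (f : F) :
    IsMartingaleDifference R.ℱ μ fun t ω => R.arrivalNoise t ω n f where
  stronglyMeasurable t := R.stronglyMeasurable_arrivalNoise t n f
  memLp t := (hK.memLp_arrivalNoise t n f).mono_exponent (by norm_num)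
  condExp_eq_zero t := (condExp_congr_ae (R.arrivalNoise_ae_eq t n f)).trans
    ((isMartingaleDifference_sub_condExp (fun t => R.stronglyMeasurable_a t n f)
      fun t => (hK.memLp_a t n f).mono_exponent (by norm_num)).condExp_eq_zero t)

theorem integrable_arrivalNoise_sq (t : ℕ) (n : N) (f : F) :
    Integrable (fun ω => R.arrivalNoise t ω n f ^ 2) μ :=
  (memLp_two_sq_of_memLp_four (hK.memLp_arrivalNoise t n f)).integrable one_le_two

theorem condExp_arrivalNoise_sq_le (t : ℕ) (n : N) (f : F) :
    μ[fun ω => R.arrivalNoise t ω n f ^ 2 | R.ℱ t] ≤ᵐ[μ] fun _ => 1 + K := by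
  have hvar := ProbabilityTheory.condVar_ae_le_condExp_sq (R.ℱ.le t)
    ((hK.memLp_a t n f).mono_exponent (p := 2) (by norm_num))
  exact (condExp_congr_ae ((R.arrivalNoise_ae_eq t n f).pow_const 2)).trans_le
    (hvar.trans (hK.condExp_a_sq_le t n f))

theorem ae_tendsto_average_arrivalNoise :
    ∀ᵐ ω ∂μ, Tendsto (fun T : ℕ => (T : ℝ)⁻¹ • ∑ t ∈ Finset.range T, R.arrivalNoise t ω)
      atTop (𝓝 0) := by
  have hentry (n : N) (f : F) := (hK.isMartingaleDifference_arrivalNoise n f).ae_tendsto_average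
    (summable_div_sq_of_le (fun t => integral_nonneg fun ω => sq_nonneg _)
      (fun t => integral_le_of_condExp_le (R.ℱ.le t) (hK.integrable_arrivalNoise_sq t n f)
        (hK.condExp_arrivalNoise_sq_le t n f)) (summable_const_div_sq (1 + K)))
  filter_upwards [ae_all_iff.2 fun n => ae_all_iff.2 (hentry n)] with ω hω
  refine tendsto_pi_nhds.2 fun n => tendsto_pi_nhds.2 fun f => ?_
  simpa only [Pi.smul_apply, Finset.sum_apply, smul_eq_mul, ← div_eq_inv_mul, Pi.zero_apply]
    using hω n f

variable {Z : ℕ → Ω → QVec N F}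

theorem isMartingaleDifference_dot_arrivalNoise
    (hZ : ∀ t n f, StronglyMeasurable[R.ℱ t] fun ω => Z t ω n f)
    (hZ4 : ∀ t n f, MemLp (fun ω => Z t ω n f) 4 μ) :
    IsMartingaleDifference R.ℱ μ fun t ω => dot (Z t ω) (R.arrivalNoise t ω) :=
  .finsetSum fun n => .finsetSum fun f =>
    (hK.isMartingaleDifference_arrivalNoise n f).mul (fun t => hZ t n f)
      fun t => memLp_two_mul_of_memLp_four (hZ4 t n f) (hK.memLp_arrivalNoise t n f)

theorem integral_mul_sqNorm_arrivalNoise_le {t : ℕ} {Y : Ω → ℝ}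
    (hY : StronglyMeasurable[R.ℱ t] Y) (hY2 : MemLp Y 2 μ) (hY0 : ∀ ω, 0 ≤ Y ω) :
    ∫ ω, Y ω * sqNorm (R.arrivalNoise t ω) ∂μ ≤ arrivalMoment N F K * ∫ ω, Y ω ∂μ := by
  have hnoise := memLp_dot (hK.memLp_arrivalNoise t) (hK.memLp_arrivalNoise t)
  exact integral_mul_le_of_condExp_le (R.ℱ.le t) hY (hY2.integrable_mul hnoise)
    (hnoise.integrable one_le_two) (hY2.integrable one_le_two) hY0
    (condExp_sqNorm_le (hK.integrable_arrivalNoise_sq t) (hK.condExp_arrivalNoise_sq_le t))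

theorem integral_mul_sqNorm_a_le {t : ℕ} {Y : Ω → ℝ}
    (hY : StronglyMeasurable[R.ℱ t] Y) (hY2 : MemLp Y 2 μ) (hY0 : ∀ ω, 0 ≤ Y ω) :
    ∫ ω, Y ω * sqNorm (R.a t ω) ∂μ ≤ arrivalMoment N F K * ∫ ω, Y ω ∂μ := by
  have ha := memLp_dot (hK.memLp_a t) (hK.memLp_a t)
  exact integral_mul_le_of_condExp_le (R.ℱ.le t) hY (hY2.integrable_mul ha)
    (ha.integrable one_le_two) (hY2.integrable one_le_two) hY0
    (condExp_sqNorm_le (hK.integrable_a_sq t) (hK.condExp_a_sq_le t))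

theorem integral_sq_dot_arrivalNoise_le {t : ℕ} {X : Ω → QVec N F}
    (hX : ∀ n f, StronglyMeasurable[R.ℱ t] fun ω => X ω n f)
    (hX4 : ∀ n f, MemLp (fun ω => X ω n f) 4 μ) :
    ∫ ω, dot (X ω) (R.arrivalNoise t ω) ^ 2 ∂μ ≤ arrivalMoment N F K * ∫ ω, sqNorm (X ω) ∂μ := by
  refine le_trans ?_ (hK.integral_mul_sqNorm_arrivalNoise_le (stronglyMeasurable_dot hX hX)
    (memLp_dot hX4 hX4) fun ω => sqNorm_nonneg _)
  exact integral_mono (memLp_dot hX4 (hK.memLp_arrivalNoise t)).integrable_sq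
    ((memLp_dot hX4 hX4).integrable_mul
      (memLp_dot (hK.memLp_arrivalNoise t) (hK.memLp_arrivalNoise t)))
    fun ω => sq_dot_le _ _

theorem ae_tendsto_average_dot_arrivalNoise
    (hZ : ∀ t n f, StronglyMeasurable[R.ℱ t] fun ω => Z t ω n f)
    (hZ4 : ∀ t n f, MemLp (fun ω => Z t ω n f) 4 μ)
    (hsum : Summable fun t : ℕ => (∫ ω, sqNorm (Z t ω) ∂μ) / ((t : ℝ) + 1) ^ 2) :
    ∀ᵐ ω ∂μ, Tendsto (fun T : ℕ =>
      (∑ t ∈ Finset.range T, dot (Z t ω) (R.arrivalNoise t ω)) / T) atTop (𝓝 0) := by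
  refine (hK.isMartingaleDifference_dot_arrivalNoise hZ hZ4).ae_tendsto_average
    (summable_div_sq_of_le (fun t => integral_nonneg fun ω => sq_nonneg _)
      (fun t => hK.integral_sq_dot_arrivalNoise_le (hZ t) (hZ4 t)) ?_)
  simpa only [mul_div_assoc] using hsum.mul_left (arrivalMoment N F K)

theorem integral_sq_sqNorm_a_le (t : ℕ) :
    ∫ ω, sqNorm (R.a t ω) ^ 2 ∂μ ≤ (Fintype.card N * Fintype.card F) ^ 2 * K := by
  have hfour (n : N) (f : F) : ∫ ω, R.a t ω n f ^ 4 ∂μ ≤ K :=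
    integral_le_of_condExp_le (R.ℱ.le t) (hK t n f).1 (hK t n f).2
  have hint : Integrable (fun ω => ∑ n, ∑ f, R.a t ω n f ^ 4) μ :=
    integrable_finsetSum _ fun n _ => integrable_finsetSum _ fun f _ => (hK t n f).1
  calc ∫ ω, sqNorm (R.a t ω) ^ 2 ∂μ
      ≤ ∫ ω, Fintype.card N * Fintype.card F * ∑ n, ∑ f, R.a t ω n f ^ 4 ∂μ := by
        refine integral_mono (memLp_dot (hK.memLp_a t) (hK.memLp_a t)).integrable_sq
          (hint.const_mul _) fun ω => ?_
        have := sq_total_le fun n f => R.a t ω n f ^ 2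
        simpa only [total, sqNorm_eq_sum, ← pow_mul] using this
    _ = Fintype.card N * Fintype.card F * ∑ n, ∑ f, ∫ ω, R.a t ω n f ^ 4 ∂μ := by
        rw [integral_const_mul, integral_finsetSum _ fun n _ =>
          integrable_finsetSum _ fun f _ => (hK t n f).1]
        simp only [integral_finsetSum _ fun f _ => (hK t _ f).1]
    _ ≤ Fintype.card N * Fintype.card F * ∑ _n : N, ∑ _f : F, K := by
        gcongr with n _ f _; exact hfour n f
    _ = (Fintype.card N * Fintype.card F) ^ 2 * K := by
        simp only [Finset.sum_const, Finset.card_univ, nsmul_eq_mul]; ring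

theorem ae_eventually_sum_sqNorm_a_le {ε : ℝ} (hε : 0 < ε) :
    ∀ᵐ ω ∂μ, ∀ᶠ T : ℕ in atTop,
      ∑ t ∈ Finset.range T, sqNorm (R.a t ω) ≤ (arrivalMoment N F K + ε) * T :=
  ae_eventually_sum_le_of_condExp_le hε
    (fun t => stronglyMeasurable_dot (R.stronglyMeasurable_a t) (R.stronglyMeasurable_a t))
    (fun t => memLp_dot (hK.memLp_a t) (hK.memLp_a t))
    (fun t => condExp_sqNorm_le (hK.integrable_a_sq t) (hK.condExp_a_sq_le t))
    (summable_div_sq_of_le (fun _ => integral_nonneg fun _ => sq_nonneg _)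
      hK.integral_sq_sqNorm_a_le (summable_const_div_sq _))

end MomentBound

end Noise

end Run

end Network

/-! ### Drift of the queues -/

theorem frequently_lt_mul_of_sum_le {u : ℕ → ℝ} {b c : ℝ} (hu : ∀ t, 0 ≤ u t) (hc : 0 < c)
    (hsum : ∀ᶠ T : ℕ in atTop, ∑ t ∈ Finset.range T, u t ≤ b * T) :
    ∃ᶠ T : ℕ in atTop, u T < c * T := by
  intro hlarge
  simp only [not_lt] at hlarge
  obtain ⟨T₁, hT₁⟩ := eventually_atTop.1 hlarge
  obtain ⟨T₂, hT₂⟩ := eventually_atTop.1 hsum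
  obtain ⟨T₃, hT₃⟩ := exists_nat_gt (2 * b / c)
  set n := T₁ + T₂ + T₃ + 1 with hn
  have lower : n * (c * n) ≤ ∑ t ∈ Finset.Ico n (2 * n), u t := by
    have hterm : ∀ t ∈ Finset.Ico n (2 * n), c * n ≤ u t := fun t ht => by
      have hnt := (Finset.mem_Ico.1 ht).1
      refine le_trans ?_ (hT₁ t (by omega))
      gcongr
    simpa [two_mul] using Finset.card_nsmul_le_sum (Finset.Ico n (2 * n)) u (c * n) hterm
  have upper : ∑ t ∈ Finset.Ico n (2 * n), u t ≤ b * (2 * n) := by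
    refine le_trans (Finset.sum_le_sum_of_subset_of_nonneg (fun t ht =>
      Finset.mem_range.2 (Finset.mem_Ico.1 ht).2) fun t _ _ => hu t) ?_
    exact_mod_cast hT₂ (2 * n) (by omega)
  have hn0 : (0 : ℝ) < n := by rw [hn]; positivity
  have hcn : c * n ≤ 2 * b := le_of_mul_le_mul_left (by linarith) hn0
  have hT₃n : (T₃ : ℝ) ≤ n := by exact_mod_cast (by omega : T₃ ≤ n)
  rw [div_lt_iff₀ hc] at hT₃
  nlinarith

theorem mul_le_mul_mul_add_of_le_sq {k δ L x : ℝ} (hδ : 0 < δ) (hL : 0 ≤ L) (hx : 0 ≤ x)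
    (hLx : L ≤ x ^ 2) : k * L ≤ δ * (L * x) + |k| * (|k| / δ) ^ 2 := by
  have hk : k * L ≤ |k| * L := mul_le_mul_of_nonneg_right (le_abs_self k) hL
  rcases le_total (|k| / δ) x with hsmall | hlarge
  · rw [div_le_iff₀ hδ] at hsmall
    have := mul_le_mul_of_nonneg_right hsmall hL
    have : 0 ≤ |k| * (|k| / δ) ^ 2 := by positivity
    linarith
  · have hsq : x ^ 2 ≤ (|k| / δ) ^ 2 := by gcongr
    have := mul_le_mul_of_nonneg_left (hLx.trans hsq) (abs_nonneg k)
    have : 0 ≤ δ * (L * x) := by positivity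
    linarith

/-- Squaring turns a drift that is negative and linear in `x` into one that is negative and cubic,
which beats the quadratic error terms. -/
theorem exists_sq_le_of_le_sub_mul {δ : ℝ} (hδ : 0 < δ) (c M m : ℝ) :
    ∃ k, ∀ L L' x g z ζ : ℝ, 0 ≤ L → 0 ≤ L' → 0 ≤ x → L ≤ x ^ 2 → x ^ 2 ≤ M * L →
      g ^ 2 ≤ L * ζ → L' ≤ L + (c - 2 * δ * x + 2 * g + 2 * z) →
      L' ^ 2 + m * L ≤ L ^ 2 + 4 * (L * g) + 4 * (L * z) + 16 * (L * ζ) + 16 * z ^ 2 + k := by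
  set b := m + 2 * c + 16 * δ ^ 2 * M with hb
  refine ⟨4 * c ^ 2 + |b| * (|b| / (4 * δ)) ^ 2, ?_⟩
  intro L L' x g z ζ hL hL' hx hLx hxL hg hdrift
  have expand : (L + (c - 2 * δ * x + 2 * g + 2 * z)) ^ 2 = L ^ 2 + 2 * c * L - 4 * δ * (L * x)
      + 4 * (L * g) + 4 * (L * z) + (c - 2 * δ * x + 2 * g + 2 * z) ^ 2 := by ring
  have sq_sum_le : (c - 2 * δ * x + 2 * g + 2 * z) ^ 2 ≤
      4 * (c ^ 2 + 4 * (δ ^ 2 * x ^ 2) + 4 * g ^ 2 + 4 * z ^ 2) := by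
    nlinarith [sq_nonneg (c + 2 * δ * x), sq_nonneg (c - 2 * g), sq_nonneg (c - 2 * z),
      sq_nonneg (2 * δ * x + 2 * g), sq_nonneg (2 * δ * x + 2 * z), sq_nonneg (2 * g - 2 * z)]
  have hδx : δ ^ 2 * x ^ 2 ≤ δ ^ 2 * (M * L) := mul_le_mul_of_nonneg_left hxL (sq_nonneg δ)
  have absorb := mul_le_mul_mul_add_of_le_sq (k := b) (by positivity : 0 < 4 * δ) hL hx hLx
  have split : b * L = m * L + 2 * c * L + 16 * (δ ^ 2 * (M * L)) := by rw [hb]; ring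
  have hsq : L' ^ 2 ≤ (L + (c - 2 * δ * x + 2 * g + 2 * z)) ^ 2 := by gcongr
  linarith [expand, split]

namespace Network

variable {N F : Type*} [Fintype N] [DecidableEq N] [Fintype F] {net : Network N F}
  {Pc : (N → Bool) → Set (Alloc N)} {Ω : Type*} [MeasurableSpace Ω] {μ : Measure Ω}

theorem dot_le_maxWeight (hPc : ∀ s, Pc s ⊆ net.allocations s) {x w : QVec N F}
    (hx : x ∈ net.capacityRegion Pc) (hw : w ∈ net.queueStates) :
    dot w x ≤ net.maxWeight Pc w := by
  obtain ⟨Ω, _, μ, _, R, K, hK, hlim, hstable⟩ := hx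
  obtain ⟨ω, hrate, hnoise, B, hB⟩ :=
    (hlim.and (hK.ae_tendsto_average_arrivalNoise.and hstable)).exists
  by_contra! hlt
  have hgap : Tendsto (fun T : ℕ => dot w (R.avgRate T ω)
      + dot w ((T : ℝ)⁻¹ • ∑ t ∈ Finset.range T, R.arrivalNoise t ω) - net.maxWeight Pc w)
      atTop (𝓝 (dot w x - net.maxWeight Pc w)) := by
    simpa using ((((continuous_dot_right w).tendsto x).comp hrate).add
      (((continuous_dot_right w).tendsto 0).comp hnoise)).sub_const (net.maxWeight Pc w)
  have hgrow : ∀ᶠ T : ℕ in atTop,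
      (dot w x - net.maxWeight Pc w) / 2 * T ≤ dot w (R.q T ω) := by
    filter_upwards [hgap.eventually_const_lt (half_lt_self (sub_pos.2 hlt)),
      eventually_gt_atTop 0] with T hT hT0
    have hT0' : (0 : ℝ) < T := by exact_mod_cast hT0
    have hflow := R.dot_sum_lam_le hPc hw T ω
    rw [R.avgRate_eq, map_smul, map_smul, smul_eq_mul, smul_eq_mul] at hT
    have hTT := mul_lt_mul_of_pos_right hT hT0'
    field_simp at hTT
    linarith
  have hbounded : ∀ᶠ T : ℕ in atTop,
      ∑ t ∈ Finset.range T, dot w (R.q t ω) ≤ total w * B * T := by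
    filter_upwards [hB, eventually_gt_atTop 0] with T hT hT0
    change total (R.avgQueue T ω) ≤ B at hT
    rw [R.total_avgQueue, div_le_iff₀ (by exact_mod_cast hT0)] at hT
    calc ∑ t ∈ Finset.range T, dot w (R.q t ω)
        ≤ ∑ t ∈ Finset.range T, total w * total (R.q t ω) := Finset.sum_le_sum fun t _ => by
          rw [mul_comm]
          exact dot_le_mul_total hw.1 (entry_le_total (R.q_nonneg t ω))
      _ = total w * ∑ t ∈ Finset.range T, total (R.q t ω) := by rw [Finset.mul_sum]
      _ ≤ total w * B * T := by
          rw [mul_assoc]; exact mul_le_mul_of_nonneg_left hT (total_nonneg hw.1)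
  exact frequently_lt_mul_of_sum_le (fun t => dot_nonneg hw.1 (R.q_nonneg t ω))
    (half_pos (sub_pos.2 hlt)) hbounded (hgrow.mono fun T hT => not_lt.2 hT)

namespace Run

/-- The maximum weight exceeds the offered load by `δ` times the total queue, up to `c`. This is
the negative drift condition on the squared norm of the queues. -/
def HasSlack (R : net.Run Pc μ) (δ c : ℝ) : Prop :=
  ∀ t ω, dot (R.q t ω) (R.lam t ω) + δ * total (R.q t ω) ≤ net.maxWeight Pc (R.q t ω) + c

variable {R : net.Run Pc μ} {K : ℝ}

theorem IsNearMaxWeight.exists_sq_sqNorm_q_succ_le {c₀ c δ : ℝ} (hnear : R.IsNearMaxWeight c₀)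
    (hPc : ∀ s, Pc s ⊆ net.allocations s) (hδ : 0 < δ) (hslack : R.HasSlack δ c) (m : ℝ) :
    ∃ k, ∀ t ω, sqNorm (R.q (t + 1) ω) ^ 2 + m * sqNorm (R.q t ω) ≤
      sqNorm (R.q t ω) ^ 2 + 4 * (sqNorm (R.q t ω) * dot (R.q t ω) (R.arrivalNoise t ω))
        + 4 * (sqNorm (R.q t ω) * sqNorm (R.a t ω))
        + 16 * (sqNorm (R.q t ω) * sqNorm (R.arrivalNoise t ω))
        + 16 * sqNorm (R.a t ω) ^ 2 + k := by
  obtain ⟨k, hk⟩ := exists_sq_le_of_le_sub_mul hδ (2 * c + (2 * c₀ + net.driftConst))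
    (Fintype.card N * Fintype.card F) m
  refine ⟨k, fun t ω => hk _ _ (total (R.q t ω)) _ _ _ (sqNorm_nonneg _) (sqNorm_nonneg _)
    (total_nonneg (R.q_nonneg t ω)) (sqNorm_le_sq_total (R.q_nonneg t ω)) (sq_total_le _)
    (sq_dot_le _ _) ?_⟩
  linarith [hnear.sqNorm_q_succ_le hPc t ω, hslack t ω]

variable [IsProbabilityMeasure μ]

theorem MomentBound.memLp_q (hK : R.MomentBound K) (hPc : ∀ s, Pc s ⊆ net.allocations s) (t : ℕ)
    (n : N) (f : F) : MemLp (fun ω => R.q t ω n f) 4 μ := by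
  induction t generalizing n f with
  | zero => simp only [R.q_zero]; exact memLp_const _
  | succ t ih =>
    have hmeas : StronglyMeasurable[R.ℱ t] fun ω => net.netInflow (R.rate t ω) n f :=
      (Finset.stronglyMeasurable_fun_sum _ fun m _ => R.stronglyMeasurable_rate t m n f).sub
        (Finset.stronglyMeasurable_fun_sum _ fun m _ => R.stronglyMeasurable_rate t n m f)
    have hinflow : MemLp (fun ω => net.netInflow (R.rate t ω) n f) 4 μ :=
      .of_bound (hmeas.mono (R.ℱ.le t)).aestronglyMeasurable |Fintype.card N * net.rateMax|
        (Eventually.of_forall fun ω =>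
          sq_le_sq.1 ((R.admissible hPc t ω).sq_netInflow_le n f))
    simp only [R.q_succ_eq_nextQueue]
    by_cases hn : n ∈ net.dst f
    · simp only [nextQueue, if_pos hn]; exact memLp_const _
    · simp only [nextQueue_apply_of_notMem hn]
      exact ((ih n f).add hinflow).add (hK.memLp_a t n f)

theorem MomentBound.integral_sqNorm_mul_dot_arrivalNoise (hK : R.MomentBound K)
    (hPc : ∀ s, Pc s ⊆ net.allocations s) (t : ℕ) :
    ∫ ω, sqNorm (R.q t ω) * dot (R.q t ω) (R.arrivalNoise t ω) ∂μ = 0 :=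
  (hK.isMartingaleDifference_dot_arrivalNoise R.stronglyMeasurable_q
    (hK.memLp_q hPc)).integral_mul_eq_zero
      (stronglyMeasurable_dot (R.stronglyMeasurable_q t) (R.stronglyMeasurable_q t))
      ((memLp_dot (hK.memLp_q hPc t) (hK.memLp_q hPc t)).integrable_mul
        (memLp_dot (hK.memLp_q hPc t) (hK.memLp_arrivalNoise t)))

theorem IsNearMaxWeight.exists_integral_sq_sqNorm_q_succ_le {c₀ c δ : ℝ}
    (hnear : R.IsNearMaxWeight c₀) (hPc : ∀ s, Pc s ⊆ net.allocations s) (hK : R.MomentBound K)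
    (hδ : 0 < δ) (hslack : R.HasSlack δ c) :
    ∃ k, ∀ t, ∫ ω, sqNorm (R.q (t + 1) ω) ^ 2 ∂μ + ∫ ω, sqNorm (R.q t ω) ∂μ ≤
      ∫ ω, sqNorm (R.q t ω) ^ 2 ∂μ + k := by
  obtain ⟨k, hk⟩ := hnear.exists_sq_sqNorm_q_succ_le hPc hδ hslack (20 * arrivalMoment N F K + 1)
  refine ⟨16 * ((Fintype.card N * Fintype.card F) ^ 2 * K) + k, fun t => ?_⟩
  have hq (t : ℕ) : MemLp (fun ω => sqNorm (R.q t ω)) 2 μ :=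
    memLp_dot (hK.memLp_q hPc t) (hK.memLp_q hPc t)
  have ha : MemLp (fun ω => sqNorm (R.a t ω)) 2 μ := memLp_dot (hK.memLp_a t) (hK.memLp_a t)
  have hg : MemLp (fun ω => dot (R.q t ω) (R.arrivalNoise t ω)) 2 μ :=
    memLp_dot (hK.memLp_q hPc t) (hK.memLp_arrivalNoise t)
  have hζ : MemLp (fun ω => sqNorm (R.arrivalNoise t ω)) 2 μ :=
    memLp_dot (hK.memLp_arrivalNoise t) (hK.memLp_arrivalNoise t)
  have hmeas := stronglyMeasurable_dot (R.stronglyMeasurable_q t) (R.stronglyMeasurable_q t)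
  have iL : Integrable (fun ω => sqNorm (R.q t ω)) μ := (hq t).integrable one_le_two
  have iLL := (hq t).integrable_sq
  have iLg := ((hq t).integrable_mul hg).const_mul 4
  have iLa := ((hq t).integrable_mul ha).const_mul 4
  have iLζ := ((hq t).integrable_mul hζ).const_mul 16
  have iaa := ha.integrable_sq.const_mul 16
  have hmean := integral_mono ((hq (t + 1)).integrable_sq.add (iL.const_mul _))
    (((((iLL.add iLg).add iLa).add iLζ).add iaa).add (integrable_const k)) fun ω => hk t ω
  rw [integral_add' (hq (t + 1)).integrable_sq (iL.const_mul _),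
    integral_add' ((((iLL.add iLg).add iLa).add iLζ).add iaa) (integrable_const k),
    integral_add' (((iLL.add iLg).add iLa).add iLζ) iaa,
    integral_add' ((iLL.add iLg).add iLa) iLζ, integral_add' (iLL.add iLg) iLa,
    integral_add' iLL iLg] at hmean
  simp only [integral_const_mul, integral_const, probReal_univ, one_smul, Pi.mul_apply,
    hK.integral_sqNorm_mul_dot_arrivalNoise hPc t] at hmean
  have hLa := hK.integral_mul_sqNorm_a_le hmeas (hq t) fun ω => sqNorm_nonneg _
  have hLζ := hK.integral_mul_sqNorm_arrivalNoise_le hmeas (hq t) fun ω => sqNorm_nonneg _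
  have haa := hK.integral_sq_sqNorm_a_le t
  change ∫ ω, sqNorm (R.q t ω) * sqNorm (R.a t ω) ∂μ ≤
    arrivalMoment N F K * ∫ ω, sqNorm (R.q t ω) ∂μ at hLa
  change ∫ ω, sqNorm (R.q t ω) * sqNorm (R.arrivalNoise t ω) ∂μ ≤
    arrivalMoment N F K * ∫ ω, sqNorm (R.q t ω) ∂μ at hLζ
  linarith

theorem IsNearMaxWeight.summable_integral_sqNorm_q {c₀ c δ : ℝ} (hnear : R.IsNearMaxWeight c₀)
    (hPc : ∀ s, Pc s ⊆ net.allocations s) (hK : R.MomentBound K) (hδ : 0 < δ)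
    (hslack : R.HasSlack δ c) :
    Summable fun t : ℕ => (∫ ω, sqNorm (R.q t ω) ∂μ) / ((t : ℝ) + 1) ^ 2 := by
  obtain ⟨k, hk⟩ := hnear.exists_integral_sq_sqNorm_q_succ_le hPc hK hδ hslack
  exact summable_div_sq_of_drift (Y := fun t => ∫ ω, sqNorm (R.q t ω) ^ 2 ∂μ)
    (fun t => integral_nonneg fun ω => sqNorm_nonneg _)
    (fun t => integral_nonneg fun ω => sq_nonneg _) hk

omit [IsProbabilityMeasure μ] in
theorem IsNearMaxWeight.sum_maxWeight_sub_dot_le {c₀ : ℝ} (hnear : R.IsNearMaxWeight c₀)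
    (hPc : ∀ s, Pc s ⊆ net.allocations s) (T : ℕ) (ω : Ω) :
    2 * ∑ t ∈ Finset.range T, (net.maxWeight Pc (R.q t ω) - dot (R.q t ω) (R.lam t ω))
      + sqNorm (R.q T ω) ≤
    sqNorm R.q₀ + 2 * ∑ t ∈ Finset.range T, dot (R.q t ω) (R.arrivalNoise t ω)
      + (2 * c₀ + net.driftConst) * T + 2 * ∑ t ∈ Finset.range T, sqNorm (R.a t ω) := by
  induction T with
  | zero => simp [R.q_zero]
  | succ T ih =>
    simp only [Finset.sum_range_succ]
    push_cast
    linarith [hnear.sqNorm_q_succ_le hPc T ω]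

theorem IsNearMaxWeight.ae_eventually_sum_maxWeight_sub_dot_le {c₀ c δ ε : ℝ}
    (hnear : R.IsNearMaxWeight c₀) (hPc : ∀ s, Pc s ⊆ net.allocations s) (hK : R.MomentBound K)
    (hδ : 0 < δ) (hslack : R.HasSlack δ c) (hε : 0 < ε) :
    ∀ᵐ ω ∂μ, ∀ᶠ T : ℕ in atTop,
      2 * ∑ t ∈ Finset.range T, (net.maxWeight Pc (R.q t ω) - dot (R.q t ω) (R.lam t ω))
        + sqNorm (R.q T ω) ≤ (2 * c₀ + net.driftConst + 2 * arrivalMoment N F K + ε) * T := by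
  have hnoise := hK.ae_tendsto_average_dot_arrivalNoise R.stronglyMeasurable_q (hK.memLp_q hPc)
    (hnear.summable_integral_sqNorm_q hPc hK hδ hslack)
  filter_upwards [hnoise, hK.ae_eventually_sum_sqNorm_a_le (by positivity : 0 < ε / 8)]
    with ω hnoise harrivals
  have hinit : Tendsto (fun T : ℕ => sqNorm R.q₀ / T) atTop (𝓝 0) :=
    tendsto_const_div_atTop_nhds_zero_nat _
  filter_upwards [hnoise.eventually_lt_const (by positivity : 0 < ε / 8), harrivals,
    hinit.eventually_lt_const (by positivity : 0 < ε / 8), eventually_gt_atTop 0]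
    with T hnoise harrivals hinit hT0
  have hT0' : (0 : ℝ) < T := by exact_mod_cast hT0
  rw [div_lt_iff₀ hT0'] at hnoise hinit
  have : 0 < ε * T := by positivity
  linarith [hnear.sum_maxWeight_sub_dot_le hPc T ω]

end Run

/-! ### Throughput optimality -/

variable {N F : Type*} [Fintype N] [DecidableEq N] [Fintype F] {net : Network N F}
  {Pc : (N → Bool) → Set (Alloc N)}

/-- `x` satisfies the maximum weight inequalities with a margin of `δ` per queue. -/
def HasMargin (net : Network N F) (Pc : (N → Bool) → Set (Alloc N)) (δ : ℝ) (x : QVec N F) :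
    Prop :=
  ∀ w ∈ net.queueStates, dot w x + δ * total w ≤ net.maxWeight Pc w

theorem HasMargin.mono {x y : QVec N F} {δ δ' : ℝ} (h : net.HasMargin Pc δ x)
    (hle : ∀ n f, y n f + δ' ≤ x n f + δ) : net.HasMargin Pc δ' y := by
  intro w hw
  have hx := h w hw
  rw [← dot_const, ← map_add] at hx ⊢
  exact (dot_mono_right hw.1 hle).trans hx

namespace Run

variable {Ω : Type*} [MeasurableSpace Ω] {μ : Measure Ω} {R : net.Run Pc μ}

theorem HasSlack.sum_total_le {δ c : ℝ} (h : R.HasSlack δ c) (T : ℕ) (ω : Ω) :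
    δ * ∑ t ∈ Finset.range T, total (R.q t ω) ≤
      ∑ t ∈ Finset.range T, (net.maxWeight Pc (R.q t ω) - dot (R.q t ω) (R.lam t ω)) + c * T := by
  have hsum := Finset.sum_le_sum fun t (_ : t ∈ Finset.range T) => h t ω
  simp only [Finset.sum_add_distrib, Finset.sum_const, Finset.card_range, nsmul_eq_mul,
    ← Finset.mul_sum] at hsum
  rw [Finset.sum_sub_distrib]
  linarith

theorem IsNearMaxWeight.stable [IsProbabilityMeasure μ] {c₀ c δ K : ℝ}
    (hnear : R.IsNearMaxWeight c₀) (hPc : ∀ s, Pc s ⊆ net.allocations s) (hK : R.MomentBound K)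
    (hδ : 0 < δ) (hslack : R.HasSlack δ c) : R.Stable := by
  filter_upwards [hnear.ae_eventually_sum_maxWeight_sub_dot_le hPc hK hδ hslack one_pos]
    with ω hdrift
  refine ⟨((2 * c₀ + net.driftConst + 2 * arrivalMoment N F K + 1) / 2 + c) / δ, ?_⟩
  filter_upwards [hdrift, eventually_gt_atTop 0] with T hdrift hT
  have hT0 : (0 : ℝ) < T := by exact_mod_cast hT
  change total (R.avgQueue T ω) ≤ _
  rw [R.total_avgQueue, div_le_div_iff₀ hT0 hδ]
  linarith [hslack.sum_total_le T ω, sqNorm_nonneg (R.q T ω)]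

end Run

/-- A deterministic scheduling rule that only depends on the queues. -/
structure StationaryPolicy (net : Network N F) (Pc : (N → Bool) → Set (Alloc N)) where
  state : QVec N F → N → Bool
  power : QVec N F → Alloc N
  rate : QVec N F → N → N → F → ℝ
  power_mem : ∀ q ∈ net.queueStates, power q ∈ Pc (state q)
  admissible : ∀ q ∈ net.queueStates, net.Admissible (state q) (power q) q (rate q)

theorem exists_stationaryPolicy_maxWeight_le (hPc : ∀ s, Pc s ⊆ net.allocations s)
    (hne : ∃ s, (Pc s).Nonempty) : ∃ π : net.StationaryPolicy Pc, ∀ q ∈ net.queueStates,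
      net.maxWeight Pc q ≤ flowGain q (π.rate q) + (net.mbpLoss + 1) := by
  choose! s p hp r hadm hweight using fun q (hq : q ∈ net.queueStates) =>
    exists_admissible_maxWeight_le hPc hne hq.1
  exact ⟨⟨s, p, r, hp, hadm⟩, hweight⟩

namespace StationaryPolicy

variable (π : net.StationaryPolicy Pc) {x : QVec N F}

/-- The queues under the policy `π` with constant arrivals `x`, from an empty network. -/
def queue (x : QVec N F) : ℕ → QVec N F
  | 0 => 0
  | t + 1 => net.nextQueue (queue x t) (π.rate (queue x t)) x

theorem queue_mem_queueStates (hx : 0 ≤ x) : ∀ t, π.queue x t ∈ net.queueStates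
  | 0 => ⟨le_rfl, fun _ _ _ => rfl⟩
  | t + 1 => (π.admissible _ (queue_mem_queueStates hx t)).nextQueue_mem_queueStates hx

/-- The deterministic run of the policy `π` with constant arrivals `x`. -/
def run (hx : 0 ≤ x) : net.Run Pc (Measure.dirac ()) where
  ℱ := ⊤
  q₀ := 0
  q t _ := π.queue x t
  s t _ := π.state (π.queue x t)
  p t _ := π.power (π.queue x t)
  rate t _ := π.rate (π.queue x t)
  a _ _ := x
  lam _ _ := x
  q₀_nonneg := le_rfl
  q₀_dst _ _ _ := rfl
  measurable_s _ := measurable_const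
  measurable_p _ := measurable_const
  measurable_rate _ := measurable_const
  measurable_lam _ := measurable_const
  measurable_a _ := measurable_const
  p_mem t _ := π.power_mem _ (π.queue_mem_queueStates hx t)
  rate_nonneg t _ := (π.admissible _ (π.queue_mem_queueStates hx t)).nonneg
  rate_le_link t _ := (π.admissible _ (π.queue_mem_queueStates hx t)).le_link
  rate_le_queue t _ := (π.admissible _ (π.queue_mem_queueStates hx t)).le_queue
  a_nonneg _ _ := hx
  integrable_a _ _ _ := integrable_const _
  condExp_a _ n f := .of_eq (condExp_const (μ := Measure.dirac ()) le_rfl (x n f))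
  q_zero _ := rfl
  q_succ _ _ _ _ := rfl

theorem momentBound_run (hx : 0 ≤ x) : (π.run hx).MomentBound (total fun n f => x n f ^ 4) := by
  refine fun t n f => ⟨integrable_const (x n f ^ 4), ?_⟩
  change (Measure.dirac ())[fun _ => x n f ^ 4 | (π.run hx).ℱ t] ≤ᵐ[Measure.dirac ()] _
  rw [condExp_const ((π.run hx).ℱ.le t)]
  exact Eventually.of_forall fun _ => entry_le_total (w := fun n f => x n f ^ 4)
    (fun n f => pow_nonneg (hx n f) 4) n f

theorem tendsto_avgRate_run (hx : 0 ≤ x) (ω : Unit) :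
    Tendsto (fun T => (π.run hx).avgRate T ω) atTop (𝓝 x) := by
  refine tendsto_const_nhds.congr' ?_
  filter_upwards [eventually_gt_atTop 0] with T hT
  ext n f
  simp only [Run.avgRate, run, Finset.sum_const, Finset.card_range, nsmul_eq_mul]
  field_simp

end StationaryPolicy

theorem HasMargin.mem_capacityRegion (hPc : ∀ s, Pc s ⊆ net.allocations s)
    (hne : ∃ s, (Pc s).Nonempty) {x : QVec N F} (hx : 0 ≤ x) {δ : ℝ} (hδ : 0 < δ)
    (h : net.HasMargin Pc δ x) : x ∈ net.capacityRegion Pc := by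
  obtain ⟨π, hπ⟩ := exists_stationaryPolicy_maxWeight_le hPc hne
  have hnear : (π.run hx).IsNearMaxWeight (net.mbpLoss + 1) := fun t _ =>
    hπ _ (π.queue_mem_queueStates hx t)
  have hslack : (π.run hx).HasSlack δ 0 := fun t _ => by
    rw [add_zero]; exact h _ (π.queue_mem_queueStates hx t)
  exact ⟨Unit, _, Measure.dirac (), inferInstance, π.run hx, _, π.momentBound_run hx,
    Eventually.of_forall (π.tendsto_avgRate_run hx),
    hnear.stable hPc (π.momentBound_run hx) hδ hslack⟩

theorem exists_hasMargin_of_mem_capacityInterior (hPc : ∀ s, Pc s ⊆ net.allocations s)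
    {x : QVec N F} (hx : x ∈ net.capacityInterior Pc) : ∃ δ > 0, net.HasMargin Pc δ x := by
  obtain ⟨hx0, hx⟩ := hx
  have hshift : Tendsto (fun δ : ℝ => x + fun _ _ => δ) (𝓝[>] 0) (𝓝[Set.Ici 0] x) := by
    refine tendsto_nhdsWithin_iff.2 ⟨?_, ?_⟩
    · have : Continuous fun δ : ℝ => x + fun _ _ => δ := by fun_prop
      simpa [Pi.zero_def] using (this.tendsto' 0 x (add_zero x)).mono_left nhdsWithin_le_nhds
    · filter_upwards [self_mem_nhdsWithin] with δ hδ
      exact add_nonneg hx0 fun _ _ => le_of_lt hδ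
  obtain ⟨δ, hδ, hδ0⟩ := ((hshift.eventually_mem hx).and self_mem_nhdsWithin).exists
  refine ⟨δ, hδ0, fun w hw => ?_⟩
  rw [← dot_const, ← map_add]
  exact dot_le_maxWeight hPc hδ hw

theorem capacityInterior_subset_capacityRegion :
    net.capacityInterior Pc ⊆ net.capacityRegion Pc := fun _ hx =>
  mem_of_mem_nhdsWithin hx.1 hx.2

theorem exists_nonempty_of_mem_capacityRegion {x : QVec N F}
    (hx : x ∈ net.capacityRegion Pc) : ∃ s, (Pc s).Nonempty := by
  obtain ⟨Ω, _, μ, _, R, -⟩ := hx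
  have : Nonempty Ω := μ.nonempty_of_neZero
  exact R.exists_nonempty

theorem dot_single [DecidableEq F] (n : N) (f : F) (x : QVec N F) :
    dot (Pi.single n (Pi.single f 1)) x = x n f := by
  rw [dot_apply, Fintype.sum_eq_single n fun n' hn' => ?_, Fintype.sum_eq_single f fun f' hf' => ?_]
  · simp only [Pi.single_eq_same, one_mul]
  · simp only [Pi.single_eq_same, Pi.single_eq_of_ne hf', zero_mul]
  · simp only [Pi.single_eq_of_ne hn', Pi.zero_apply, zero_mul, Finset.sum_const_zero]

omit [Fintype N] [Fintype F] in
theorem pressure_single_le [DecidableEq F] (n : N) (f : F) (n' m : N) :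
    pressure (Pi.single n (Pi.single f 1)) n' m ≤ if n' = n then 1 else 0 := by
  have hsingle : (0 : QVec N F) ≤ Pi.single n (Pi.single f 1) :=
    Pi.single_nonneg.2 (Pi.single_nonneg.2 zero_le_one)
  refine pressure_le (by split_ifs <;> norm_num) fun f' =>
    (sub_le_self _ (hsingle m f')).trans ?_
  simp only [Pi.single_apply, ite_apply, Pi.zero_apply]
  split_ifs <;> norm_num

omit [Fintype F] in
theorem weight_single_le [DecidableEq F] {s : N → Bool} {p : Alloc N}
    (hp : p ∈ net.allocations s) (n : N) (f : F) :
    net.weight (Pi.single n (Pi.single f 1)) p ≤ ∑ m, net.linkRate p n m := by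
  calc net.weight (Pi.single n (Pi.single f 1)) p
      ≤ ∑ n', ∑ m, net.linkRate p n' m * (if n' = n then 1 else 0) :=
        Finset.sum_le_sum fun n' _ => Finset.sum_le_sum fun m _ =>
          mul_le_mul_of_nonneg_left (pressure_single_le n f n' m) (net.linkRate_nonneg hp n' m)
    _ = ∑ m, net.linkRate p n m := by
        rw [Fintype.sum_eq_single n fun n' hn' => by
          simp only [if_neg hn', mul_zero, Finset.sum_const_zero]]
        simp only [if_true, mul_one]

omit [Fintype F] in
theorem single_mem_queueStates [DecidableEq F] {n : N} {f : F}
    (hn : n ∉ net.dst f) : (Pi.single n (Pi.single f 1) : QVec N F) ∈ net.queueStates := by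
  refine ⟨Pi.single_nonneg.2 (Pi.single_nonneg.2 zero_le_one), fun f' n' hn' => ?_⟩
  rcases eq_or_ne n' n with rfl | hne
  · have hf' : f' ≠ f := fun h => hn (h ▸ hn')
    simp only [Pi.single_eq_same, Pi.single_eq_of_ne hf']
  · simp only [Pi.single_eq_of_ne hne, Pi.zero_apply]

theorem le_lamMax_of_mem_capacityRegion (hPc : ∀ s, Pc s ⊆ net.allocations s)
    {x : QVec N F} (hx : x ∈ net.capacityRegion Pc) {n : N} {f : F} (hn : n ∉ net.dst f) :
    x n f ≤ net.lamMax := by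
  classical
  calc x n f = dot (Pi.single n (Pi.single f 1)) x := (dot_single n f x).symm
    _ ≤ net.maxWeight Pc (Pi.single n (Pi.single f 1)) :=
        dot_le_maxWeight hPc hx (single_mem_queueStates hn)
    _ ≤ net.lamMax := maxWeight_le net.lamMax_nonneg fun s p hp =>
        (weight_single_le (hPc s hp) n f).trans (net.sum_linkRate_le_lamMax (hPc s hp) n)

end Network

/-! ### Utilities -/

section Midpoint

variable {E : Type*} [AddCommGroup E] [Module ℝ E] {s : Set E} {φ : E → ℝ} {u v x : E}

theorem midpoint_eq_add_smul (u x : E) : midpoint ℝ u x = (2⁻¹ : ℝ) • u + (2⁻¹ : ℝ) • x := by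
  rw [midpoint_eq_smul_add, invOf_eq_inv, smul_add]

theorem midpoint_gap_mono (h : ConcaveOn ℝ s φ) (hu : u ∈ s) (hx : x ∈ s)
    (hv : v ∈ segment ℝ x u) :
    φ (midpoint ℝ v x) - (φ v + φ x) / 2 ≤ φ (midpoint ℝ u x) - (φ u + φ x) / 2 := by
  obtain ⟨b, a, hb, ha, hab, rfl⟩ := hv
  obtain rfl : b = 1 - a := by linarith
  set v := (1 - a) • x + a • u with hv
  have hm : midpoint ℝ v x ∈ s := h.1.midpoint_mem (h.1 hx hu hb ha hab) hx
  have ha2 : 0 < 2 - a := by linarith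
  -- Both `v` and `midpoint u x` lie between `u` and `midpoint v x`, with barycentric weights that
  -- cancel in `φ v + 2 φ (midpoint u x)`.
  have le_v := h.2 hu hm (div_nonneg ha ha2.le)
    (div_nonneg (by linarith : 0 ≤ 2 - 2 * a) ha2.le) (by field)
  have le_mid := h.2 hu hm (div_nonneg hb ha2.le) (div_nonneg zero_le_one ha2.le) (by field)
  have eq_v : (a / (2 - a)) • u + ((2 - 2 * a) / (2 - a)) • midpoint ℝ v x = v := by
    rw [hv, midpoint_eq_add_smul]
    match_scalars <;> field
  have eq_mid : ((1 - a) / (2 - a)) • u + (1 / (2 - a)) • midpoint ℝ v x = midpoint ℝ u x := by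
    rw [hv, midpoint_eq_add_smul, midpoint_eq_add_smul]
    match_scalars <;> field
  rw [eq_v, smul_eq_mul, smul_eq_mul] at le_v
  rw [eq_mid, smul_eq_mul, smul_eq_mul] at le_mid
  have combine : a / (2 - a) * φ u + (2 - 2 * a) / (2 - a) * φ (midpoint ℝ v x)
      + 2 * ((1 - a) / (2 - a) * φ u + 1 / (2 - a) * φ (midpoint ℝ v x))
      = φ u + 2 * φ (midpoint ℝ v x) := by field
  linarith

theorem midpoint_lt (h : StrictConcaveOn ℝ s φ) (hu : u ∈ s) (hx : x ∈ s) (hne : u ≠ x) :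
    (φ u + φ x) / 2 < φ (midpoint ℝ u x) := by
  have := h.2 hu hx hne (inv_pos.2 two_pos) (inv_pos.2 two_pos) (by norm_num)
  rw [smul_eq_mul, smul_eq_mul, ← midpoint_eq_add_smul] at this
  linarith

theorem midpoint_le (h : ConcaveOn ℝ s φ) (hu : u ∈ s) (hx : x ∈ s) :
    (φ u + φ x) / 2 ≤ φ (midpoint ℝ u x) := by
  have := h.2 hu hx (inv_pos.2 two_pos).le (inv_pos.2 two_pos).le (by norm_num)
  rw [smul_eq_mul, smul_eq_mul, ← midpoint_eq_add_smul] at this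
  linarith

theorem exists_midpoint_gap_of_mem_segment (h : StrictConcaveOn ℝ s φ) (hx : x ∈ s)
    (hvx : v ≠ x) :
    ∃ κ > 0, ∀ u ∈ s, v ∈ segment ℝ x u → (φ u + φ x) / 2 + κ ≤ φ (midpoint ℝ u x) := by
  by_cases hv : v ∈ s
  · refine ⟨φ (midpoint ℝ v x) - (φ v + φ x) / 2, sub_pos.2 (midpoint_lt h hv hx hvx),
      fun u hu hvu => ?_⟩
    linarith [midpoint_gap_mono h.concaveOn hu hx hvu]
  · exact ⟨1, one_pos, fun u hu hvu => absurd (h.1.segment_subset hx hu hvu) hv⟩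

theorem exists_midpoint_gap {D : Set ℝ} {U : ℝ → ℝ} (h : StrictConcaveOn ℝ D U) {x ε : ℝ}
    (hx : x ∈ D) (hε : 0 < ε) :
    ∃ κ > 0, ∀ u ∈ D, ε ≤ |u - x| → (U u + U x) / 2 + κ ≤ U (midpoint ℝ u x) := by
  obtain ⟨κ₁, hκ₁, right⟩ := exists_midpoint_gap_of_mem_segment h hx (v := x + ε) (by linarith)
  obtain ⟨κ₂, hκ₂, left⟩ := exists_midpoint_gap_of_mem_segment h hx (v := x - ε) (by linarith)
  refine ⟨min κ₁ κ₂, lt_min hκ₁ hκ₂, fun u hu hux => ?_⟩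
  rcases le_abs.1 hux with hux | hux
  · have := right u hu (by rw [segment_eq_Icc (by linarith)]; constructor <;> linarith)
    linarith [min_le_left κ₁ κ₂]
  · have := left u hu (by
      rw [segment_symm, segment_eq_Icc (by linarith)]; constructor <;> linarith)
    linarith [min_le_right κ₁ κ₂]

end Midpoint

namespace Network

section ScalarUtility

variable {D : Set ℝ} {U : ℝ → ℝ}

theorem IsUtility.subset_Ici (h : IsUtility D U) : D ⊆ Set.Ici 0 := by
  rcases h.domain with rfl | ⟨rfl, -⟩
  · exact le_rfl
  · exact Set.Ioi_subset_Ici_self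

theorem IsUtility.Ioi_subset (h : IsUtility D U) : Set.Ioi 0 ⊆ D := by
  rcases h.domain with rfl | ⟨rfl, -⟩
  · exact Set.Ioi_subset_Ici_self
  · exact le_rfl

theorem IsUtility.interior_domain (h : IsUtility D U) : interior D = Set.Ioi 0 := by
  rcases h.domain with rfl | ⟨rfl, -⟩
  · exact interior_Ici
  · exact interior_Ioi

theorem IsUtility.mem_of_le (h : IsUtility D U) {x y : ℝ} (hx : x ∈ D) (hxy : x ≤ y) :
    y ∈ D := by
  rcases h.domain with rfl | ⟨rfl, -⟩
  · exact le_trans (Set.mem_Ici.1 hx) hxy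
  · exact lt_of_lt_of_le (Set.mem_Ioi.1 hx) hxy

theorem IsUtility.differentiableAt (h : IsUtility D U) {x : ℝ} (hx : 0 < x) :
    DifferentiableAt ℝ U x :=
  (h.differentiableOn x hx).differentiableAt (Ioi_mem_nhds hx)

theorem IsUtility.antitoneOn_deriv (h : IsUtility D U) : AntitoneOn (deriv U) (Set.Ioi 0) :=
  (h.strictConcaveOn.concaveOn.subset h.Ioi_subset (convex_Ioi 0)).antitoneOn_deriv
    fun _ hx => h.differentiableAt hx

section ClippedInvDeriv

variable {b : ℝ} (y : ℝ)

theorem bddAbove_clipped (hb : 0 ≤ b) :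
    BddAbove (insert 0 {x | 0 < x ∧ x < b ∧ y ≤ deriv U x}) := by
  refine ⟨b, ?_⟩
  rintro x (rfl | ⟨-, h, -⟩)
  · exact hb
  · exact h.le

theorem clippedInvDeriv_nonneg (hb : 0 ≤ b) : 0 ≤ clippedInvDeriv U b y :=
  le_csSup (bddAbove_clipped y hb) (Set.mem_insert _ _)

theorem clippedInvDeriv_le (hb : 0 ≤ b) : clippedInvDeriv U b y ≤ b := by
  refine csSup_le (Set.insert_nonempty _ _) ?_
  rintro x (rfl | ⟨-, h, -⟩)
  · exact hb
  · exact h.le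

theorem IsUtility.le_deriv_of_lt_clippedInvDeriv (h : IsUtility D U) {x : ℝ} (hx : 0 < x)
    (hlt : x < clippedInvDeriv U b y) : y ≤ deriv U x := by
  obtain ⟨s, rfl | ⟨hs, -, hys⟩, hxs⟩ := exists_lt_of_lt_csSup (Set.insert_nonempty _ _) hlt
  · exact absurd hxs hx.not_gt
  · exact hys.trans (h.antitoneOn_deriv hx hs hxs.le)

theorem deriv_lt_of_clippedInvDeriv_lt (hb : 0 ≤ b) {x : ℝ} (hx : 0 < x) (hxb : x < b)
    (hlt : clippedInvDeriv U b y < x) : deriv U x < y := by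
  by_contra hy
  exact hlt.not_ge (le_csSup (bddAbove_clipped y hb) (Or.inr ⟨hx, hxb, not_lt.1 hy⟩))

theorem IsUtility.continuousOn_sub_mul (h : IsUtility D U) :
    ContinuousOn (fun x => U x - y * x) D :=
  h.continuousOn.sub (by fun_prop)

theorem IsUtility.differentiableAt_sub_mul (h : IsUtility D U) {x : ℝ} (hx : 0 < x) :
    DifferentiableAt ℝ (fun x => U x - y * x) x :=
  (h.differentiableAt hx).sub (by fun_prop)

theorem IsUtility.deriv_sub_mul (h : IsUtility D U) {x : ℝ} (hx : 0 < x) :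
    deriv (fun x => U x - y * x) x = deriv U x - y := by
  have : HasDerivAt (fun x => U x - y * x) (deriv U x - y * 1) x :=
    (h.differentiableAt hx).hasDerivAt.sub ((hasDerivAt_id x).const_mul y)
  rw [this.deriv, mul_one]

theorem IsUtility.monotoneOn_sub_mul (h : IsUtility D U) :
    MonotoneOn (fun x => U x - y * x) (D ∩ Set.Iic (clippedInvDeriv U b y)) := by
  refine monotoneOn_of_deriv_nonneg (h.strictConcaveOn.1.inter (convex_Iic _))
    ((h.continuousOn_sub_mul y).mono Set.inter_subset_left) ?_ ?_ <;>
    rw [interior_inter, h.interior_domain, interior_Iic]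
  · exact fun x hx => (h.differentiableAt_sub_mul y hx.1).differentiableWithinAt
  · intro x hx
    rw [h.deriv_sub_mul y hx.1]
    exact sub_nonneg.2 (h.le_deriv_of_lt_clippedInvDeriv y hx.1 hx.2)

theorem IsUtility.antitoneOn_sub_mul (h : IsUtility D U) (hb : 0 ≤ b) :
    AntitoneOn (fun x => U x - y * x) (D ∩ Set.Icc (clippedInvDeriv U b y) b) := by
  refine antitoneOn_of_deriv_nonpos (h.strictConcaveOn.1.inter (convex_Icc _ _))
    ((h.continuousOn_sub_mul y).mono Set.inter_subset_left) ?_ ?_ <;>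
    rw [interior_inter, h.interior_domain, interior_Icc]
  · exact fun x hx => (h.differentiableAt_sub_mul y hx.1).differentiableWithinAt
  · intro x hx
    rw [h.deriv_sub_mul y hx.1]
    exact (sub_neg.2 (deriv_lt_of_clippedInvDeriv_lt y hb hx.1 hx.2.2 hx.2.1)).le

theorem IsUtility.clippedInvDeriv_mem (h : IsUtility D U) (hb : 0 < b) :
    clippedInvDeriv U b y ∈ D := by
  have hnonneg := clippedInvDeriv_nonneg (U := U) y hb.le
  rcases h.domain with hD | ⟨-, hlim⟩
  · rw [hD]
    exact hnonneg
  rcases hnonneg.eq_or_lt with hzero | hpos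
  · -- The penalized utility would decrease on `(0, b]`, although it tends to `-∞` at `0`.
    have hbot : Tendsto (fun x => U x - y * x) (𝓝[>] 0) atBot :=
      hlim.atBot_add (((by fun_prop : Continuous fun x : ℝ => -(y * x)).tendsto 0).mono_left
        nhdsWithin_le_nhds)
    obtain ⟨x, hlow, hx0, hxb⟩ :=
      ((hbot.eventually_lt_atBot (U b - y * b)).and (Ioo_mem_nhdsGT hb)).exists
    have hanti := h.antitoneOn_sub_mul y hb.le
    rw [← hzero] at hanti
    exact absurd (hanti ⟨h.Ioi_subset hx0, hx0.le, hxb.le⟩ ⟨h.Ioi_subset hb, hb.le, le_rfl⟩ hxb.le)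
      hlow.not_ge
  · exact h.Ioi_subset hpos

theorem IsUtility.sub_mul_le_clippedInvDeriv (h : IsUtility D U) (hb : 0 < b) {x : ℝ}
    (hx : x ∈ D) (hxb : x ≤ b) :
    U x - y * x ≤ U (clippedInvDeriv U b y) - y * clippedInvDeriv U b y := by
  have hmem := h.clippedInvDeriv_mem y hb
  rcases le_total x (clippedInvDeriv U b y) with hle | hge
  · exact h.monotoneOn_sub_mul y ⟨hx, hle⟩ ⟨hmem, Set.mem_Iic.2 le_rfl⟩ hle
  · exact h.antitoneOn_sub_mul y hb.le ⟨hmem, le_rfl, hge.trans hxb⟩ ⟨hx, hge, hxb⟩ hge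

end ClippedInvDeriv

end ScalarUtility

/-! ### Network utility maximization -/

section VectorUtility

variable {N F : Type*} [Fintype N] {net : Network N F} {D : F → Set ℝ} {U : F → ℝ → ℝ}

theorem convex_sourceVectors (hU : ∀ f, IsUtility (D f) (U f)) :
    Convex ℝ (net.sourceVectors D) := by
  refine fun x hx y hy a b ha hb hab f n =>
    ⟨fun hn => (hU f).strictConcaveOn.1 ((hx f n).1 hn) ((hy f n).1 hn) ha hb hab, fun hn => ?_⟩
  simp only [Pi.add_apply, Pi.smul_apply, (hx f n).2 hn, (hy f n).2 hn, smul_zero, add_zero]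

theorem sourceVectors_nonneg (hU : ∀ f, IsUtility (D f) (U f)) {x : QVec N F}
    (hx : x ∈ net.sourceVectors D) : 0 ≤ x := by
  intro n f
  by_cases hn : n ∈ net.src f
  · exact (hU f).subset_Ici ((hx f n).1 hn)
  · exact ((hx f n).2 hn).ge

/-- The source rates that the congestion controller may choose. -/
def rateBox (net : Network N F) (D : F → Set ℝ) : Set (QVec N F) :=
  net.sourceVectors D ∩ {y | ∀ n f, y n f ≤ net.lamMax}

theorem convex_rateBox (hU : ∀ f, IsUtility (D f) (U f)) : Convex ℝ (net.rateBox D) := by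
  refine (convex_sourceVectors hU).inter fun x hx y hy a b ha hb hab n f => ?_
  exact convex_Iic net.lamMax (hx n f) (hy n f) ha hb hab

theorem exists_source_le_abs_sub [Fintype F] {u x : QVec N F} (hu : u ∈ net.sourceVectors D)
    (hx : x ∈ net.sourceVectors D) {ε : ℝ} (hε : 0 < ε) (h : ε ≤ dist u x) :
    ∃ f, ∃ n ∈ net.src f, ε ≤ |u n f - x n f| := by
  contrapose! h
  refine (dist_pi_lt_iff hε).2 fun n => (dist_pi_lt_iff hε).2 fun f => ?_
  by_cases hn : n ∈ net.src f
  · exact h f n hn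
  · rwa [(hu f n).2 hn, (hx f n).2 hn, dist_self]

variable [Fintype F]

theorem sourceUtility_eq_sum_sigma (x : QVec N F) :
    net.sourceUtility U x = ∑ i ∈ Finset.univ.sigma net.src, U i.1 (x i.2 i.1) := by
  rw [Finset.sum_sigma, sourceUtility]

theorem concaveOn_sourceUtility (hU : ∀ f, IsUtility (D f) (U f)) :
    ConcaveOn ℝ (net.sourceVectors D) (net.sourceUtility U) := by
  refine ⟨convex_sourceVectors hU, fun x hx y hy a b ha hb hab => ?_⟩
  simp only [sourceUtility, smul_eq_mul, Finset.mul_sum, ← Finset.sum_add_distrib]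
  exact Finset.sum_le_sum fun f _ => Finset.sum_le_sum fun n hn =>
    (hU f).strictConcaveOn.concaveOn.2 ((hx f n).1 hn) ((hy f n).1 hn) ha hb hab

theorem flowUtility_eq_sourceUtility (h1 : ∀ f, (net.src f).card = 1) {x : QVec N F}
    (hx : x ∈ net.sourceVectors D) : flowUtility U x = net.sourceUtility U x := by
  refine Finset.sum_congr rfl fun f _ => ?_
  obtain ⟨n, hn⟩ := Finset.card_eq_one.1 (h1 f)
  rw [hn, Finset.sum_singleton, Fintype.sum_eq_single n fun m hm =>
    (hx f m).2 (by rwa [hn, Finset.mem_singleton])]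

theorem sourceUtility_midpoint_gap (hU : ∀ f, IsUtility (D f) (U f)) {u x : QVec N F}
    (hu : u ∈ net.sourceVectors D) (hx : x ∈ net.sourceVectors D) {n : N} {f : F}
    (hn : n ∈ net.src f) :
    U f (midpoint ℝ (u n f) (x n f)) - (U f (u n f) + U f (x n f)) / 2 ≤
      net.sourceUtility U (midpoint ℝ u x) -
        (net.sourceUtility U u + net.sourceUtility U x) / 2 := by
  simp only [sourceUtility_eq_sum_sigma, ← Finset.sum_add_distrib, Finset.sum_div,
    ← Finset.sum_sub_distrib]
  refine Finset.single_le_sum (f := fun i : (_ : F) × N =>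
    U i.1 (midpoint ℝ u x i.2 i.1) - (U i.1 (u i.2 i.1) + U i.1 (x i.2 i.1)) / 2)
    (fun i hi => ?_) (Finset.mem_sigma.2 ⟨Finset.mem_univ f, hn⟩ : ⟨f, n⟩ ∈ _)
  have hi := (Finset.mem_sigma.1 hi).2
  exact sub_nonneg.2
    (midpoint_le (hU i.1).strictConcaveOn.concaveOn ((hu _ _).1 hi) ((hx _ _).1 hi))

theorem exists_sourceUtility_midpoint_gap (hU : ∀ f, IsUtility (D f) (U f)) {x : QVec N F}
    (hx : x ∈ net.sourceVectors D) {ε : ℝ} (hε : 0 < ε) :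
    ∃ κ > 0, ∀ u ∈ net.sourceVectors D, ε ≤ dist u x →
      (net.sourceUtility U u + net.sourceUtility U x) / 2 + κ ≤
        net.sourceUtility U (midpoint ℝ u x) := by
  have hentry : ∀ f n, ∀ᶠ κ in 𝓝[>] (0 : ℝ), n ∈ net.src f → ∀ u ∈ D f, ε ≤ |u - x n f| →
      (U f u + U f (x n f)) / 2 + κ ≤ U f (midpoint ℝ u (x n f)) := by
    intro f n
    by_cases hn : n ∈ net.src f
    · obtain ⟨κ₀, hκ₀, hgap⟩ := exists_midpoint_gap (hU f).strictConcaveOn ((hx f n).1 hn) hε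
      filter_upwards [Ioo_mem_nhdsGT hκ₀] with κ hκ _ u hu hfar
      linarith [hgap u hu hfar, hκ.2]
    · exact Eventually.of_forall fun κ h => absurd h hn
  obtain ⟨κ, hκ, hκ0⟩ := ((eventually_all.2 fun f => eventually_all.2 (hentry f)).and
    self_mem_nhdsWithin).exists
  refine ⟨κ, hκ0, fun u hu hd => ?_⟩
  obtain ⟨f, n, hn, hfar⟩ := exists_source_le_abs_sub hu hx hε hd
  linarith [hκ f n hn _ ((hu f n).1 hn) hfar, sourceUtility_midpoint_gap hU hu hx hn]

theorem sourceUtility_le_of_mem_rateBox (hU : ∀ f, IsUtility (D f) (U f)) {x : QVec N F}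
    (hx : x ∈ net.rateBox D) :
    net.sourceUtility U x ≤ net.sourceUtility U fun _ _ => net.lamMax :=
  Finset.sum_le_sum fun f _ => Finset.sum_le_sum fun n hn =>
    (hU f).monotoneOn ((hx.1 f n).1 hn) ((hU f).mem_of_le ((hx.1 f n).1 hn) (hx.2 n f)) (hx.2 n f)

theorem mul_sourceUtility_sub_dot_eq_sum (V : ℝ) (q : QVec N F) {x : QVec N F}
    (hx : x ∈ net.sourceVectors D) :
    V * net.sourceUtility U x - dot q x =
      ∑ f, ∑ n ∈ net.src f, (V * U f (x n f) - q n f * x n f) := by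
  have hdot : dot q x = ∑ f, ∑ n ∈ net.src f, q n f * x n f := by
    rw [dot_apply, Finset.sum_comm]
    refine Finset.sum_congr rfl fun f _ => (Finset.sum_subset (Finset.subset_univ _) ?_).symm
    intro n _ hn
    rw [(hx f n).2 hn, mul_zero]
  simp only [hdot, sourceUtility, Finset.mul_sum, Finset.sum_sub_distrib]

variable [DecidableEq N] {Pc : (N → Bool) → Set (Alloc N)} {Ω : Type*} [MeasurableSpace Ω]
  {μ : Measure Ω} {R : net.Run Pc μ} {V : ℝ}

theorem Run.IsANCC.lam_mem_rateBox (h : R.IsANCC U V) (hU : ∀ f, IsUtility (D f) (U f))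
    (hpos : ∀ f, ∀ n ∈ net.src f, 0 < net.lamMax) (t : ℕ) (ω : Ω) :
    R.lam t ω ∈ net.rateBox D := by
  refine ⟨fun f n => ⟨fun hn => ?_, fun hn => ?_⟩, fun n f => ?_⟩
  · rw [h, if_pos hn]
    exact (hU f).clippedInvDeriv_mem _ (hpos f n hn)
  · rw [h, if_neg hn]
  · rw [h]
    split_ifs with hn
    · exact clippedInvDeriv_le _ net.lamMax_nonneg
    · exact net.lamMax_nonneg

theorem Run.IsANCC.mul_sourceUtility_sub_dot_le (h : R.IsANCC U V) (hV : 0 < V)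
    (hU : ∀ f, IsUtility (D f) (U f)) (hpos : ∀ f, ∀ n ∈ net.src f, 0 < net.lamMax) (t : ℕ)
    (ω : Ω) {x : QVec N F} (hx : x ∈ net.rateBox D) :
    V * net.sourceUtility U x - dot (R.q t ω) x ≤
      V * net.sourceUtility U (R.lam t ω) - dot (R.q t ω) (R.lam t ω) := by
  rw [mul_sourceUtility_sub_dot_eq_sum V _ hx.1,
    mul_sourceUtility_sub_dot_eq_sum V _ (h.lam_mem_rateBox hU hpos t ω).1]
  refine Finset.sum_le_sum fun f _ => Finset.sum_le_sum fun n hn => ?_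
  have hscale : ∀ z, V * U f z - R.q t ω n f * z = V * (U f z - R.q t ω n f / V * z) := by
    intro z; field_simp
  rw [h t ω n f, if_pos hn, hscale, hscale]
  exact mul_le_mul_of_nonneg_left
    ((hU f).sub_mul_le_clippedInvDeriv _ (hpos f n hn) ((hx.1 f n).1 hn) (hx.2 n f)) hV.le

end VectorUtility

section NumProblem

variable {N F : Type*} [Fintype N] [DecidableEq N] [Fintype F] {net : Network N F}
  {Pc : (N → Bool) → Set (Alloc N)} {D : F → Set ℝ} {U : F → ℝ → ℝ}

theorem numFeasible_subset_rateBox (hPc : ∀ s, Pc s ⊆ net.allocations s) :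
    net.numFeasible Pc D ⊆ net.rateBox D := by
  refine fun x hx => ⟨hx.2, fun n f => ?_⟩
  by_cases hn : n ∈ net.src f
  · exact le_lamMax_of_mem_capacityRegion hPc hx.1
      (Finset.disjoint_left.1 (net.src_disjoint_dst f) hn)
  · exact ((hx.2 f n).2 hn).trans_le net.lamMax_nonneg

theorem hasMargin_zero_of_mem_capacityRegion (hPc : ∀ s, Pc s ⊆ net.allocations s)
    {x : QVec N F} (hx : x ∈ net.capacityRegion Pc) : net.HasMargin Pc 0 x := fun w hw => by
  rw [zero_mul, add_zero]
  exact dot_le_maxWeight hPc hx hw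

theorem HasMargin.add_smul {x y : QVec N F} {δ δ' a b : ℝ} (hx : net.HasMargin Pc δ x)
    (hy : net.HasMargin Pc δ' y) (ha : 0 ≤ a) (hb : 0 ≤ b) (hab : a + b = 1) :
    net.HasMargin Pc (a * δ + b * δ') (a • x + b • y) := by
  intro w hw
  simp only [map_add, map_smul, smul_eq_mul]
  calc a * dot w x + b * dot w y + (a * δ + b * δ') * total w
      = a * (dot w x + δ * total w) + b * (dot w y + δ' * total w) := by ring
    _ ≤ a * net.maxWeight Pc w + b * net.maxWeight Pc w :=
        add_le_add (mul_le_mul_of_nonneg_left (hx w hw) ha)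
          (mul_le_mul_of_nonneg_left (hy w hw) hb)
    _ = net.maxWeight Pc w := by rw [← add_mul, hab, one_mul]

theorem exists_pos_hasMargin (hPc : ∀ s, Pc s ⊆ net.allocations s)
    (hint : (net.capacityInterior Pc).Nonempty) :
    ∃ x : QVec N F, (∀ n f, 0 < x n f) ∧ ∃ δ > 0, net.HasMargin Pc δ x := by
  obtain ⟨x, hx⟩ := hint
  obtain ⟨δ, hδ, hm⟩ := exists_hasMargin_of_mem_capacityInterior hPc hx
  exact ⟨fun n f => x n f + δ / 2, fun n f => add_pos_of_nonneg_of_pos (hx.1 n f) (half_pos hδ),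
    δ / 2, half_pos hδ, hm.mono fun n f => by linarith⟩

theorem exists_nonempty_of_capacityInterior_nonempty
    (hint : (net.capacityInterior Pc).Nonempty) : ∃ s, (Pc s).Nonempty :=
  exists_nonempty_of_mem_capacityRegion (capacityInterior_subset_capacityRegion hint.some_mem)

theorem lamMax_pos (hPc : ∀ s, Pc s ⊆ net.allocations s)
    (hint : (net.capacityInterior Pc).Nonempty) {n : N} {f : F} (hn : n ∈ net.src f) :
    0 < net.lamMax := by
  obtain ⟨x, hx, δ, hδ, hm⟩ := exists_pos_hasMargin hPc hint
  have hmem := hm.mem_capacityRegion hPc (exists_nonempty_of_capacityInterior_nonempty hint)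
    (fun n f => (hx n f).le) hδ
  exact (hx n f).trans_le
    (le_lamMax_of_mem_capacityRegion hPc hmem
      (Finset.disjoint_left.1 (net.src_disjoint_dst f) hn))

theorem exists_mem_numFeasible_hasMargin (hPc : ∀ s, Pc s ⊆ net.allocations s)
    (hU : ∀ f, IsUtility (D f) (U f)) (hint : (net.capacityInterior Pc).Nonempty) :
    ∃ z ∈ net.numFeasible Pc D, ∃ δ > 0, net.HasMargin Pc δ z := by
  obtain ⟨x, hx, δ, hδ, hm⟩ := exists_pos_hasMargin hPc hint
  let z : QVec N F := fun n f => if n ∈ net.src f then x n f else 0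
  have hz : z ∈ net.sourceVectors D := fun f n =>
    ⟨fun hn => (hU f).Ioi_subset ((hx n f).trans_eq (if_pos hn).symm), fun hn => if_neg hn⟩
  have hzm : net.HasMargin Pc δ z := hm.mono fun n f => by
    refine add_le_add_left ?_ δ
    simp only [z]
    split_ifs
    exacts [le_rfl, (hx n f).le]
  have hne := exists_nonempty_of_capacityInterior_nonempty hint
  exact ⟨z, ⟨hzm.mem_capacityRegion hPc hne (sourceVectors_nonneg hU hz) hδ, hz⟩, δ, hδ, hzm⟩

theorem exists_forall_hasMargin_sourceUtility_le (hPc : ∀ s, Pc s ⊆ net.allocations s)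
    (hU : ∀ f, IsUtility (D f) (U f)) (hint : (net.capacityInterior Pc).Nonempty)
    {x : QVec N F} (hmax : IsMaxOn (net.sourceUtility U) (net.numFeasible Pc D) x)
    {κ : ℝ} (hκ : 0 < κ) :
    ∃ η > 0, ∀ y ∈ net.sourceVectors D, net.HasMargin Pc (-η) y →
      net.sourceUtility U y ≤ net.sourceUtility U x + κ := by
  obtain ⟨z, hz, δ, hδ, hm⟩ := exists_mem_numFeasible_hasMargin hPc hU hint
  set Φ := net.sourceUtility U
  have hsmall : ∀ᶠ ρ in 𝓝[>] (0 : ℝ), ρ * (κ + Φ x - Φ z) < κ := by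
    have hcont : Continuous fun ρ : ℝ => ρ * (κ + Φ x - Φ z) := by fun_prop
    exact ((hcont.tendsto' 0 0 (zero_mul _)).mono_left nhdsWithin_le_nhds).eventually_lt_const hκ
  obtain ⟨ρ, hρ, hρ0, hρ1⟩ := (hsmall.and (Ioo_mem_nhdsGT one_pos)).exists
  refine ⟨ρ * δ / 2, by positivity, fun y hy hym => ?_⟩
  have hρ' : 0 ≤ 1 - ρ := by linarith
  have hsum : 1 - ρ + ρ = 1 := sub_add_cancel 1 ρ
  -- Moving a nearly feasible `y` slightly towards the strictly feasible `z` makes it feasible.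
  have hmargin : net.HasMargin Pc (ρ * δ / 2) ((1 - ρ) • y + ρ • z) :=
    (hym.add_smul hm hρ' hρ0.le hsum).mono fun n f => by
      nlinarith [mul_pos (mul_pos hρ0 hρ0) hδ]
  have hsource : (1 - ρ) • y + ρ • z ∈ net.sourceVectors D :=
    convex_sourceVectors hU hy hz.2 hρ' hρ0.le hsum
  have hfeasible : (1 - ρ) • y + ρ • z ∈ net.numFeasible Pc D :=
    ⟨hmargin.mem_capacityRegion hPc (exists_nonempty_of_capacityInterior_nonempty hint)
      (sourceVectors_nonneg hU hsource) (by positivity), hsource⟩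
  have hconcave : (1 - ρ) * Φ y + ρ * Φ z ≤ Φ ((1 - ρ) • y + ρ • z) :=
    (concaveOn_sourceUtility hU).2 hy hz.2 hρ' hρ0.le hsum
  have hopt : Φ ((1 - ρ) • y + ρ • z) ≤ Φ x := hmax hfeasible
  refine le_of_mul_le_mul_left (?_ : (1 - ρ) * Φ y ≤ (1 - ρ) * (Φ x + κ)) (by linarith)
  linarith

end NumProblem

/-! ### Optimality of back pressure with congestion control -/

section NearMaxWeight

variable {N F : Type*} [Fintype N] [DecidableEq N] [Fintype F] {net : Network N F}
  {Pc : (N → Bool) → Set (Alloc N)} {Ω : Type*} [MeasurableSpace Ω] {μ : Measure Ω}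

/-- The same run, regarded as a run over a larger set of power allocations. -/
def Run.ofLE {Pc' : (N → Bool) → Set (Alloc N)} (h : ∀ s, Pc s ⊆ Pc' s) (R : net.Run Pc μ) :
    net.Run Pc' μ :=
  { R with p_mem := fun t ω => h _ (R.p_mem t ω) }

theorem capacityRegion_mono {Pc' : (N → Bool) → Set (Alloc N)} (h : ∀ s, Pc s ⊆ Pc' s) :
    net.capacityRegion Pc ⊆ net.capacityRegion Pc' := by
  rintro x ⟨Ω, _, μ, hμ, R, K, hK, hlim, hstable⟩
  exact ⟨Ω, _, μ, hμ, R.ofLE h, K, hK, hlim, hstable⟩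

variable {R : net.Run Pc μ} {K c₀ c δ : ℝ}

theorem Run.avgQueue_mem_queueStates (T : ℕ) (ω : Ω) : R.avgQueue T ω ∈ net.queueStates := by
  rw [R.avgQueue_eq]
  refine ⟨smul_nonneg (by positivity) (Finset.sum_nonneg fun t _ => R.q_nonneg t ω),
    fun f n hn => ?_⟩
  simp only [Pi.smul_apply, Finset.sum_apply, (R.q_mem_queueStates _ ω).2 f n hn,
    Finset.sum_const_zero, smul_zero]

theorem Run.mul_maxWeight_avgQueue_le (hPc : ∀ s, Pc s ⊆ net.allocations s) {T : ℕ} (hT : 0 < T)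
    (ω : Ω) : T * net.maxWeight Pc (R.avgQueue T ω) ≤
      ∑ t ∈ Finset.range T, net.maxWeight Pc (R.q t ω) := by
  rw [R.avgQueue_eq, ← le_inv_mul_iff₀ (by exact_mod_cast hT)]
  exact (maxWeight_smul_le hPc (by positivity) _).trans
    (mul_le_mul_of_nonneg_left (maxWeight_sum_le hPc _ _) (by positivity))

variable [IsProbabilityMeasure μ]

theorem Run.IsNearMaxWeight.ae_tendsto_queue_div (hnear : R.IsNearMaxWeight c₀)
    (hPc : ∀ s, Pc s ⊆ net.allocations s) (hK : R.MomentBound K) (hδ : 0 < δ)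
    (hslack : R.HasSlack δ c) :
    ∀ᵐ ω ∂μ, Tendsto (fun T : ℕ => (T : ℝ)⁻¹ • R.q T ω) atTop (𝓝 0) := by
  filter_upwards [hnear.ae_eventually_sum_maxWeight_sub_dot_le hPc hK hδ hslack one_pos]
    with ω hdrift
  set B := 2 * c₀ + net.driftConst + 2 * arrivalMoment N F K + 1 + 2 * c
  have hsqrt : Tendsto (fun T : ℕ => √(B / T)) atTop (𝓝 0) := by
    simpa only [Real.sqrt_zero] using (tendsto_const_div_atTop_nhds_zero_nat B).sqrt
  refine tendsto_pi_nhds.2 fun n => tendsto_pi_nhds.2 fun f => squeeze_zero_norm' ?_ hsqrt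
  filter_upwards [hdrift] with T hdrift
  have htotal : 0 ≤ δ * ∑ t ∈ Finset.range T, total (R.q t ω) :=
    mul_nonneg hδ.le (Finset.sum_nonneg fun t _ => total_nonneg (R.q_nonneg t ω))
  have hnorm : R.q T ω n f ^ 2 ≤ B * T := by
    linarith [hslack.sum_total_le T ω, sq_entry_le_sqNorm (R.q T ω) n f]
  refine Real.abs_le_sqrt ?_
  calc ((T : ℝ)⁻¹ * R.q T ω n f) ^ 2 = R.q T ω n f ^ 2 / T ^ 2 := by
        rw [← div_eq_inv_mul, div_pow]
    _ ≤ B * T / T ^ 2 := by gcongr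
    _ = B / T := by field_simp

theorem Run.IsNearMaxWeight.ae_eventually_hasMargin (hnear : R.IsNearMaxWeight c₀)
    (hPc : ∀ s, Pc s ⊆ net.allocations s) (hK : R.MomentBound K) (hδ : 0 < δ)
    (hslack : R.HasSlack δ c) :
    ∀ᵐ ω ∂μ, ∀ η > 0, ∀ᶠ T : ℕ in atTop, net.HasMargin Pc (-η) (R.avgRate T ω) := by
  filter_upwards [hnear.ae_tendsto_queue_div hPc hK hδ hslack,
    hK.ae_tendsto_average_arrivalNoise] with ω hqueue hnoise η hη
  have hentry : ∀ᶠ T : ℕ in atTop, ∀ n f, ((T : ℝ)⁻¹ • R.q T ω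
      - (T : ℝ)⁻¹ • ∑ t ∈ Finset.range T, R.arrivalNoise t ω) n f ≤ η := by
    have hlim := hqueue.sub hnoise
    rw [sub_zero] at hlim
    exact eventually_all.2 fun n => eventually_all.2 fun f =>
      ((tendsto_pi_nhds.1 (tendsto_pi_nhds.1 hlim n) f).eventually_lt_const hη).mono
        fun _ => le_of_lt
  filter_upwards [hentry, eventually_gt_atTop 0] with T hentry hT w hw
  have hT0 : (0 : ℝ) < T := by exact_mod_cast hT
  have hserved := mul_le_mul_of_nonneg_left (R.dot_sum_lam_le hPc hw T ω) (inv_nonneg.2 hT0.le)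
  have herror := dot_le_mul_total hw.1 hentry
  simp only [map_sub, map_smul, smul_eq_mul] at herror
  rw [mul_sub, mul_add, inv_mul_cancel_left₀ hT0.ne'] at hserved
  rw [R.avgRate_eq, map_smul, smul_eq_mul]
  linarith

end NearMaxWeight

section BackPressure

variable {N F : Type*} [Fintype N] [DecidableEq N] [Fintype F] [DecidableEq F]
  {net : Network N F} {Pc : (N → Bool) → Set (Alloc N)} {Ω : Type*} [MeasurableSpace Ω]
  {μ : Measure Ω} {R : net.Run Pc μ}

theorem Run.IsMBP.isNearMaxWeight (h : R.IsMBP) (hPc : ∀ s, Pc s ⊆ net.allocations s) :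
    R.IsNearMaxWeight net.mbpLoss := by
  obtain ⟨fs, hfs⟩ := h
  intro t ω
  rw [(hfs t ω).2]
  exact (hfs t ω).1.maxWeight_le hPc (R.q_nonneg t ω)

theorem Run.IsMBP.stable_of_mem_capacityInterior [IsProbabilityMeasure μ] {K : ℝ} (h : R.IsMBP)
    (hPc : ∀ s, Pc s ⊆ net.allocations s) (hK : R.MomentBound K) {x : QVec N F}
    (hx : x ∈ net.capacityInterior Pc) (hlam : ∀ t ω, R.lam t ω = x) : R.Stable := by
  obtain ⟨δ, hδ, hmargin⟩ := exists_hasMargin_of_mem_capacityInterior hPc hx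
  refine (h.isNearMaxWeight hPc).stable hPc hK hδ (c := 0) fun t ω => ?_
  rw [hlam, add_zero]
  exact hmargin _ (R.q_mem_queueStates t ω)

end BackPressure

section CongestionControl

variable {N F : Type*} [Fintype N] [Fintype F] {net : Network N F} {D : F → Set ℝ}
  {U : F → ℝ → ℝ}

theorem IsPenalizedOptimum.le_of_midpoint_gap {V κ : ℝ} {q x y : QVec N F}
    (hy : net.IsPenalizedOptimum D U V q y) (hV : 0 < V) (hU : ∀ f, IsUtility (D f) (U f))
    (hx : x ∈ net.rateBox D)
    (hgap : (net.sourceUtility U y + net.sourceUtility U x) / 2 + κ ≤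
      net.sourceUtility U (midpoint ℝ y x)) :
    V * (net.sourceUtility U x + 2 * κ) - dot q x ≤ V * net.sourceUtility U y - dot q y := by
  have hopt : V * net.sourceUtility U (midpoint ℝ y x) - dot q (midpoint ℝ y x) ≤
      V * net.sourceUtility U y - dot q y := hy.2 ((convex_rateBox hU).midpoint_mem hy.1 hx)
  rw [midpoint_eq_add_smul y x, map_add, map_smul, map_smul, smul_eq_mul, smul_eq_mul,
    ← midpoint_eq_add_smul] at hopt
  linarith [mul_le_mul_of_nonneg_left hgap hV.le]

variable [DecidableEq N] {Pc : (N → Bool) → Set (Alloc N)}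

namespace Run.IsANCC

variable {Ω : Type*} [MeasurableSpace Ω] {μ : Measure Ω} {R : net.Run Pc μ} {V : ℝ}

theorem exists_hasSlack (h : R.IsANCC U V) (hV : 0 < V)
    (hPc : ∀ s, Pc s ⊆ net.allocations s) (hU : ∀ f, IsUtility (D f) (U f))
    (hint : (net.capacityInterior Pc).Nonempty) : ∃ c, ∃ δ > 0, R.HasSlack δ c := by
  obtain ⟨z, hz, δ, hδ, hmargin⟩ := exists_mem_numFeasible_hasMargin hPc hU hint
  have hpos := fun f n (hn : n ∈ net.src f) => lamMax_pos hPc hint hn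
  refine ⟨V * (net.sourceUtility U (fun _ _ => net.lamMax) - net.sourceUtility U z), δ, hδ,
    fun t ω => ?_⟩
  have hmax := mul_le_mul_of_nonneg_left
    (sourceUtility_le_of_mem_rateBox hU (h.lam_mem_rateBox hU hpos t ω)) hV.le
  linarith [h.mul_sourceUtility_sub_dot_le hV hU hpos t ω (numFeasible_subset_rateBox hPc hz),
    hmargin _ (R.q_mem_queueStates t ω)]

theorem avgRate_mem_rateBox (h : R.IsANCC U V) (hU : ∀ f, IsUtility (D f) (U f))
    (hpos : ∀ f, ∀ n ∈ net.src f, 0 < net.lamMax) {T : ℕ} (hT : 0 < T) (ω : Ω) :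
    R.avgRate T ω ∈ net.rateBox D := by
  have hT0 : (T : ℝ) ≠ 0 := by positivity
  rw [R.avgRate_eq, Finset.smul_sum]
  exact (convex_rateBox hU).sum_mem (fun _ _ => by positivity) (by simp [hT0])
    fun t _ => h.lam_mem_rateBox hU hpos t ω

theorem sum_sourceUtility_le (h : R.IsANCC U V) (hU : ∀ f, IsUtility (D f) (U f))
    (hpos : ∀ f, ∀ n ∈ net.src f, 0 < net.lamMax) {T : ℕ} (hT : 0 < T) (ω : Ω) :
    ∑ t ∈ Finset.range T, net.sourceUtility U (R.lam t ω) ≤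
      T * net.sourceUtility U (R.avgRate T ω) := by
  have hT0 : (0 : ℝ) < T := by exact_mod_cast hT
  have hjensen := (concaveOn_sourceUtility (net := net) hU).le_map_sum (t := Finset.range T)
    (w := fun _ => (T : ℝ)⁻¹) (p := fun t => R.lam t ω) (fun _ _ => by positivity)
    (by simp [hT0.ne']) fun t _ => (h.lam_mem_rateBox hU hpos t ω).1
  rw [R.avgRate_eq, Finset.smul_sum]
  simp only [smul_eq_mul, ← Finset.mul_sum] at hjensen
  exact (inv_mul_le_iff₀ hT0).1 hjensen

theorem drift_plus_penalty_le (h : R.IsANCC U V) (hV : 0 < V)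
    (hPc : ∀ s, Pc s ⊆ net.allocations s) (hU : ∀ f, IsUtility (D f) (U f))
    (hpos : ∀ f, ∀ n ∈ net.src f, 0 < net.lamMax) {T : ℕ} (hT : 0 < T) {ω : Ω} {B : ℝ}
    (hB : ∑ t ∈ Finset.range T, (net.maxWeight Pc (R.q t ω) - dot (R.q t ω) (R.lam t ω)) ≤ B * T)
    {y : QVec N F} (hy : y ∈ net.rateBox D) :
    V * net.sourceUtility U y - dot (R.avgQueue T ω) y + net.maxWeight Pc (R.avgQueue T ω) ≤
      V * net.sourceUtility U (R.avgRate T ω) + B := by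
  have hT0 : (0 : ℝ) < T := by exact_mod_cast hT
  have hpenalized := Finset.sum_le_sum fun t (_ : t ∈ Finset.range T) =>
    h.mul_sourceUtility_sub_dot_le hV hU hpos t ω hy
  have hutility := mul_le_mul_of_nonneg_left (h.sum_sourceUtility_le hU hpos hT ω) hV.le
  have hweight := R.mul_maxWeight_avgQueue_le hPc hT ω
  have hqueue : T * dot (R.avgQueue T ω) y = ∑ t ∈ Finset.range T, dot (R.q t ω) y := by
    rw [R.avgQueue_eq, map_smul, map_sum, LinearMap.smul_apply, LinearMap.sum_apply, smul_eq_mul,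
      mul_inv_cancel_left₀ hT0.ne']
  simp only [Finset.sum_sub_distrib, Finset.sum_const, Finset.card_range, nsmul_eq_mul,
    ← Finset.mul_sum] at hpenalized hB
  refine le_of_mul_le_mul_left ?_ hT0
  linarith

theorem sourceUtility_sub_div_le (h : R.IsANCC U V) (hV : 0 < V)
    (hPc : ∀ s, Pc s ⊆ net.allocations s) (hU : ∀ f, IsUtility (D f) (U f))
    (hpos : ∀ f, ∀ n ∈ net.src f, 0 < net.lamMax) {T : ℕ} (hT : 0 < T) {ω : Ω} {B : ℝ}
    (hB : ∑ t ∈ Finset.range T, (net.maxWeight Pc (R.q t ω) - dot (R.q t ω) (R.lam t ω)) ≤ B * T)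
    {x : QVec N F} (hx : x ∈ net.numFeasible Pc D) :
    net.sourceUtility U x - B / V ≤ net.sourceUtility U (R.avgRate T ω) := by
  have hweight := dot_le_maxWeight hPc hx.1 (R.avgQueue_mem_queueStates T ω)
  have hdrift := h.drift_plus_penalty_le hV hPc hU hpos hT hB (numFeasible_subset_rateBox hPc hx)
  rw [sub_le_comm, le_div_iff₀ hV]
  linarith

theorem sourceUtility_add_le_of_midpoint_gap (h : R.IsANCC U V) (hV : 0 < V)
    (hPc : ∀ s, Pc s ⊆ net.allocations s) (hU : ∀ f, IsUtility (D f) (U f))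
    (hpos : ∀ f, ∀ n ∈ net.src f, 0 < net.lamMax) {T : ℕ} (hT : 0 < T) {ω : Ω} {B κ : ℝ}
    (hB : ∑ t ∈ Finset.range T, (net.maxWeight Pc (R.q t ω) - dot (R.q t ω) (R.lam t ω)) ≤ B * T)
    {x y : QVec N F} (hx : x ∈ net.numFeasible Pc D)
    (hy : net.IsPenalizedOptimum D U V (R.avgQueue T ω) y)
    (hgap : (net.sourceUtility U y + net.sourceUtility U x) / 2 + κ ≤
      net.sourceUtility U (midpoint ℝ y x)) :
    net.sourceUtility U x + 2 * κ - B / V ≤ net.sourceUtility U (R.avgRate T ω) := by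
  have hopt := hy.le_of_midpoint_gap hV hU (numFeasible_subset_rateBox hPc hx) hgap
  have hweight := dot_le_maxWeight hPc hx.1 (R.avgQueue_mem_queueStates T ω)
  have hdrift := h.drift_plus_penalty_le hV hPc hU hpos hT hB hy.1
  rw [sub_le_comm, le_div_iff₀ hV]
  linarith

end Run.IsANCC

/-- A bound, under back pressure, on the time average of the gap between the maximum weight and the
weighted arrival rates, when the conditional fourth moments of the arrivals are at most `K`. It is
half of the bound on the drift of the squared norm of the queues; the summand `1` there absorbs the
fluctuations of the arrivals, which vanish in the time average. -/
def mbpGapConst (net : Network N F) (K : ℝ) : ℝ :=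
  (2 * net.mbpLoss + net.driftConst + 2 * Run.arrivalMoment N F K + 1) / 2

namespace Run.IsMBP

variable [DecidableEq F] {Ω : Type*} [MeasurableSpace Ω] {μ : Measure Ω} [IsProbabilityMeasure μ]
  {R : net.Run Pc μ} {K V : ℝ}

theorem ae_eventually_sum_maxWeight_sub_dot_le (h : R.IsMBP)
    (hPc : ∀ s, Pc s ⊆ net.allocations s) (hK : R.MomentBound K) {c δ : ℝ} (hδ : 0 < δ)
    (hslack : R.HasSlack δ c) : ∀ᵐ ω ∂μ, ∀ᶠ T : ℕ in atTop,
      ∑ t ∈ Finset.range T, (net.maxWeight Pc (R.q t ω) - dot (R.q t ω) (R.lam t ω)) ≤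
        net.mbpGapConst K * T := by
  filter_upwards [(h.isNearMaxWeight hPc).ae_eventually_sum_maxWeight_sub_dot_le hPc hK hδ hslack
    one_pos] with ω hdrift
  filter_upwards [hdrift] with T hdrift
  rw [mbpGapConst]
  linarith [sqNorm_nonneg (R.q T ω)]

theorem stable_of_isANCC (h : R.IsMBP) (hA : R.IsANCC U V) (hV : 0 < V)
    (hPc : ∀ s, Pc s ⊆ net.allocations s) (hU : ∀ f, IsUtility (D f) (U f))
    (hint : (net.capacityInterior Pc).Nonempty) (hK : R.MomentBound K) : R.Stable := by
  obtain ⟨c, δ, hδ, hslack⟩ := hA.exists_hasSlack hV hPc hU hint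
  exact (h.isNearMaxWeight hPc).stable hPc hK hδ hslack

theorem ae_eventually_le_sourceUtility_avgRate (h : R.IsMBP) (hA : R.IsANCC U V) (hV : 0 < V)
    (hPc : ∀ s, Pc s ⊆ net.allocations s) (hU : ∀ f, IsUtility (D f) (U f))
    (hint : (net.capacityInterior Pc).Nonempty) (hK : R.MomentBound K) {x : QVec N F}
    (hx : x ∈ net.numFeasible Pc D) : ∀ᵐ ω ∂μ, ∀ᶠ T : ℕ in atTop,
      R.avgRate T ω ∈ net.sourceVectors D ∧
      net.sourceUtility U x - net.mbpGapConst K / V ≤ net.sourceUtility U (R.avgRate T ω) := by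
  have hpos := fun f n (hn : n ∈ net.src f) => lamMax_pos hPc hint hn
  obtain ⟨c, δ, hδ, hslack⟩ := hA.exists_hasSlack hV hPc hU hint
  filter_upwards [h.ae_eventually_sum_maxWeight_sub_dot_le hPc hK hδ hslack] with ω hgap
  filter_upwards [hgap, eventually_gt_atTop 0] with T hgap hT
  exact ⟨(hA.avgRate_mem_rateBox hU hpos hT ω).1,
    hA.sourceUtility_sub_div_le hV hPc hU hpos hT hgap hx⟩

theorem ae_eventually_dist_lt (h : R.IsMBP) (hA : R.IsANCC U V) (hV : 0 < V)
    (hPc : ∀ s, Pc s ⊆ net.allocations s) (hU : ∀ f, IsUtility (D f) (U f))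
    (hint : (net.capacityInterior Pc).Nonempty) (hK : R.MomentBound K) {x : QVec N F}
    (hx : x ∈ net.numFeasible Pc D) {κ η ε : ℝ} (hκ : 0 < κ) (hη : 0 < η)
    (hgap : ∀ u ∈ net.sourceVectors D, ε ≤ dist u x →
      (net.sourceUtility U u + net.sourceUtility U x) / 2 + κ ≤
        net.sourceUtility U (midpoint ℝ u x))
    (hnear : ∀ y ∈ net.sourceVectors D, net.HasMargin Pc (-η) y →
      net.sourceUtility U y ≤ net.sourceUtility U x + κ / 2)
    (hCV : net.mbpGapConst K / V ≤ κ / 2) :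
    ∀ᵐ ω ∂μ, ∀ᶠ T : ℕ in atTop, dist (R.avgRate T ω) x < ε ∧
      ∀ y, net.IsPenalizedOptimum D U V (R.avgQueue T ω) y → dist y x < ε := by
  have hpos := fun f n (hn : n ∈ net.src f) => lamMax_pos hPc hint hn
  obtain ⟨c, δ, hδ, hslack⟩ := hA.exists_hasSlack hV hPc hU hint
  filter_upwards [h.ae_eventually_sum_maxWeight_sub_dot_le hPc hK hδ hslack,
    (h.isNearMaxWeight hPc).ae_eventually_hasMargin hPc hK hδ hslack] with ω hdrift hmargin
  filter_upwards [hdrift, hmargin η hη, eventually_gt_atTop 0] with T hdrift hmargin hT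
  have hmem := (hA.avgRate_mem_rateBox hU hpos hT ω).1
  refine ⟨lt_of_not_ge fun hfar => ?_, fun y hy => lt_of_not_ge fun hfar => ?_⟩
  · have hmid : net.HasMargin Pc (-η) (midpoint ℝ (R.avgRate T ω) x) := by
      rw [midpoint_eq_add_smul]
      have hcomb := hmargin.add_smul (a := 2⁻¹) (b := 2⁻¹)
        (hasMargin_zero_of_mem_capacityRegion hPc hx.1) (by norm_num) (by norm_num) (by norm_num)
      exact hcomb.mono fun n f => by linarith
    linarith [hgap _ hmem hfar, hA.sourceUtility_sub_div_le hV hPc hU hpos hT hdrift hx,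
      hnear _ ((convex_sourceVectors hU).midpoint_mem hmem hx.2) hmid]
  · linarith [hnear _ hmem hmargin,
      hA.sourceUtility_add_le_of_midpoint_gap hV hPc hU hpos hT hdrift hx hy (hgap y hy.1.1 hfar)]

end Run.IsMBP

theorem exists_forall_ae_eventually_dist_lt [DecidableEq F]
    (hPc : ∀ s, Pc s ⊆ net.allocations s) (hU : ∀ f, IsUtility (D f) (U f))
    (hint : (net.capacityInterior Pc).Nonempty) {x : QVec N F} (hx : x ∈ net.numFeasible Pc D)
    (hmax : IsMaxOn (net.sourceUtility U) (net.numFeasible Pc D) x) (K : ℝ) {ε : ℝ}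
    (hε : 0 < ε) : ∃ V₀ > 0, ∀ V, V₀ ≤ V →
      ∀ (Ω : Type*) [MeasurableSpace Ω] (μ : Measure Ω) [IsProbabilityMeasure μ]
        (R : net.Run Pc μ), R.MomentBound K → R.IsMBP → R.IsANCC U V →
        ∀ᵐ ω ∂μ, ∀ᶠ T : ℕ in atTop, dist (R.avgRate T ω) x < ε ∧
          ∀ y, net.IsPenalizedOptimum D U V (R.avgQueue T ω) y → dist y x < ε := by
  obtain ⟨κ, hκ, hgap⟩ := exists_sourceUtility_midpoint_gap hU hx.2 hε
  obtain ⟨η, hη, hnear⟩ :=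
    exists_forall_hasMargin_sourceUtility_le hPc hU hint hmax (half_pos hκ)
  refine ⟨max 1 (net.mbpGapConst K / (κ / 2)), by positivity,
    fun V hV Ω _ μ _ R hK h hA => ?_⟩
  have hV0 : 0 < V := one_pos.trans_le ((le_max_left _ _).trans hV)
  have hCV : net.mbpGapConst K / V ≤ κ / 2 :=
    (div_le_comm₀ hV0 (half_pos hκ)).2 ((le_max_right _ _).trans hV)
  exact h.ae_eventually_dist_lt hA hV0 hPc hU hint hK hx hκ hη hgap hnear hCV

end CongestionControl

/-! ### Equal power allocation -/

theorem ciSup_pressure {N F : Type*} [Finite F] {q : QVec N F} {fs : N → N → F}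
    (hfs : IsTopFlow q fs) (n m : N) :
    ⨆ f, (q n f - q m f) = q n (fs n m) - q m (fs n m) :=
  have : Nonempty F := ⟨fs n m⟩
  le_antisymm (ciSup_le (hfs n m))
    (le_ciSup (f := fun f => q n f - q m f) (Set.finite_range _).bddAbove (fs n m))

section EqualPower

variable {N F : Type*} [Fintype N] [DecidableEq N] {net : Network N F}

theorem mem_dbsgLinks {s : N → Bool} {n m : N} :
    (n, m) ∈ net.dbsgLinks s ↔ m ∈ net.nbrs n ∧ s n = true ∧ s m = false := by
  simp only [dbsgLinks, Finset.mem_filter_univ]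

theorem equalPower_nonneg (s : N → Bool) (n m : N) : 0 ≤ net.equalPower s n m := by
  unfold equalPower; split_ifs <;> positivity

theorem equalPower_le (s : N → Bool) (n m : N) :
    net.equalPower s n m ≤ ((net.nbrs n).card : ℝ)⁻¹ := by
  unfold equalPower
  split_ifs
  · rw [one_div]
  · positivity

theorem equalPower_mem_allocations (net : Network N F) (s : N → Bool) :
    net.equalPower s ∈ net.allocations s := by
  refine ⟨fun n m => ⟨equalPower_nonneg s n m, ?_⟩, fun n => ?_, fun n m h => ?_⟩
  · exact (equalPower_le s n m).trans (Nat.cast_inv_le_one _)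
  · calc ∑ m ∈ net.nbrs n, net.equalPower s n m
        ≤ (net.nbrs n).card • ((net.nbrs n).card : ℝ)⁻¹ :=
          Finset.sum_le_card_nsmul _ _ _ fun m _ => equalPower_le s n m
      _ ≤ 1 := by rw [nsmul_eq_mul]; exact mul_inv_le_one
  · by_contra hlink
    exact h (if_neg fun hmem => hlink (mem_dbsgLinks.1 hmem))

theorem linkRate_equalPower (h0 : ∀ n m i j, net.crossGain n m i j = 0) (s : N → Bool)
    (n m : N) : net.linkRate (net.equalPower s) n m =
      if (n, m) ∈ net.dbsgLinks s then net.fixedRate n m else 0 := by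
  split_ifs with h
  · have hI : net.interference (net.equalPower s) n m = 0 :=
      Finset.sum_eq_zero fun i _ => Finset.sum_eq_zero fun j _ => by simp [h0]
    rw [linkRate, hI, zero_add, equalPower, if_pos h, fixedRate, soloRate]
  · exact net.linkRate_of_power_eq_zero (if_neg h)

variable {q : QVec N F} {fs : N → N → F}

variable [DecidableEq F]

theorem share_equalPower (h0 : ∀ n m i j, net.crossGain n m i j = 0) {s : N → Bool} {n m : N}
    (h : (n, m) ∈ net.dbsgLinks s) : net.share fs (net.equalPower s) n m =
      net.fixedRate n m / ∑ m' ∈ Finset.univ.filter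
        (fun m' => (n, m') ∈ net.dbsgLinks s ∧ fs n m' = fs n m), net.fixedRate n m' := by
  simp only [share, linkRate_equalPower h0, if_pos h]
  rw [← Finset.sum_filter, Finset.filter_filter]
  simp only [and_comm]

variable [Finite F]

theorem ciSup_mbpRate_mul {s : N → Bool} {p : Alloc N} (hp : p ∈ net.allocations s)
    (hq : 0 ≤ q) (n m : N) : ⨆ f, net.mbpRate q fs p n m f * (q n f - q m f) =
      net.mbpRate q fs p n m (fs n m) * (q n (fs n m) - q m (fs n m)) := by
  have : Nonempty F := ⟨fs n m⟩
  refine le_antisymm (ciSup_le fun f => ?_) (le_ciSup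
    (f := fun f => net.mbpRate q fs p n m f * (q n f - q m f)) (Set.finite_range _).bddAbove _)
  obtain rfl | hf := eq_or_ne f (fs n m)
  · exact le_rfl
  · rw [mbpRate_of_ne hf, zero_mul]
    exact mbpRate_mul_nonneg hp hq n m _

theorem mbpRate_equalPower_mul (h0 : ∀ n m i j, net.crossGain n m i j = 0)
    (hfs : IsTopFlow q fs) (s : N → Bool) (n m : N) :
    net.mbpRate q fs (net.equalPower s) n m (fs n m) * (q n (fs n m) - q m (fs n m)) =
      if (n, m) ∈ net.dbsgLinks s then net.dbsgWeight q fs s n m else 0 := by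
  split_ifs with hlink
  · rw [dbsgWeight, ciSup_pressure hfs]
    obtain hpos | hnonpos := lt_or_ge 0 (q n (fs n m) - q m (fs n m))
    · rw [max_eq_right hpos.le, mbpRate, if_pos ⟨rfl, hpos⟩, share_equalPower h0 hlink,
        linkRate_equalPower h0, if_pos hlink]
    · rw [max_eq_left hnonpos, mul_zero, mbpRate_of_pressure_nonpos hnonpos, zero_mul]
  · have hrate : net.linkRate (net.equalPower s) n m = 0 := by
      rw [linkRate_equalPower h0, if_neg hlink]
    rw [mbpRate, share, hrate, zero_div, mul_zero, min_self, ite_self, zero_mul]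

theorem mbpObjective_equalPower (h0 : ∀ n m i j, net.crossGain n m i j = 0) (hq : 0 ≤ q)
    (hfs : IsTopFlow q fs) (s : N → Bool) : net.mbpObjective q fs (net.equalPower s) =
      ∑ l ∈ net.dbsgLinks s, net.dbsgWeight q fs s l.1 l.2 := by
  simp only [mbpObjective, ciSup_mbpRate_mul (net.equalPower_mem_allocations s) hq,
    mbpRate_equalPower_mul h0 hfs]
  rw [← Fintype.sum_prod_type', Finset.sum_ite_mem, Finset.univ_inter]

theorem isMBPChoice_equalPower_iff (h0 : ∀ n m i j, net.crossGain n m i j = 0) (hq : 0 ≤ q)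
    (hfs : IsTopFlow q fs) (s : N → Bool) (p : Alloc N) :
    net.IsMBPChoice (fun s => {net.equalPower s}) q fs s p ↔
      p = net.equalPower s ∧ net.IsMaxWeightDBSG q fs s := by
  simp only [IsMBPChoice, Set.mem_singleton_iff, forall_eq, hfs, true_and]
  refine and_congr_right fun hp => ?_
  simp only [hp, mbpObjective_equalPower h0 hq hfs, IsMaxWeightDBSG]

end EqualPower

end Network

end MUMIMO

end

theorem mainTheorem3 {N F : Type*} [Fintype N] [DecidableEq N] [Fintype F] [DecidableEq F]
    (net : MUMIMO.Network N F) (Pc : (N → Bool) → Set (MUMIMO.Alloc N))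
    (hPc : ∀ s, Pc s ⊆ net.allocations s) :
    -- the constrained capacity region is part of the unconstrained one
    net.capacityRegion Pc ⊆ net.capacityRegion net.allocations ∧
    -- constrained back pressure is throughput optimal for the constrained region
    (∀ x ∈ net.capacityInterior Pc,
      ∀ (Ω : Type*) [MeasurableSpace Ω] (μ : Measure Ω) [IsProbabilityMeasure μ]
        (R : net.Run Pc μ) (K : ℝ), R.MomentBound K → R.IsMBP → (∀ t ω, R.lam t ω = x) →
        R.Stable) ∧
    -- with congestion control it is stable and optimal for the constrained NUM problem
    (∀ (D : F → Set ℝ) (U : F → ℝ → ℝ), (∀ f, MUMIMO.Network.IsUtility (D f) (U f)) →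
      (net.capacityInterior Pc).Nonempty →
      ∀ obj : MUMIMO.QVec N F → ℝ,
        (obj = net.sourceUtility U ∨
          ((∀ f, (net.src f).card = 1) ∧ obj = MUMIMO.Network.flowUtility U)) →
        (∀ K : ℝ, ∃ C : ℝ, ∀ V : ℝ, 0 < V →
          ∀ (Ω : Type*) [MeasurableSpace Ω] (μ : Measure Ω) [IsProbabilityMeasure μ]
            (R : net.Run Pc μ), R.MomentBound K → R.IsMBP → R.IsANCC U V →
            R.Stable ∧
            ∀ x ∈ net.numFeasible Pc D, ∀ᵐ ω ∂μ, ∀ᶠ T : ℕ in atTop,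
              obj x - C / V ≤ obj (R.avgRate T ω)) ∧
        (∀ x ∈ net.numFeasible Pc D, IsMaxOn obj (net.numFeasible Pc D) x →
          ∀ (K ε : ℝ), 0 < ε → ∃ V₀ : ℝ, 0 < V₀ ∧ ∀ V : ℝ, V₀ ≤ V →
          ∀ (Ω : Type*) [MeasurableSpace Ω] (μ : Measure Ω) [IsProbabilityMeasure μ]
            (R : net.Run Pc μ), R.MomentBound K → R.IsMBP → R.IsANCC U V →
            ∀ᵐ ω ∂μ, ∀ᶠ T : ℕ in atTop,
              dist (R.avgRate T ω) x < ε ∧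
              ∀ y, net.IsPenalizedOptimum D U V (R.avgQueue T ω) y → dist y x < ε)) ∧
    -- fixed equal power is an admissible constraint, and without interference it turns the
    -- scheduler into a maximum weighted directed bipartite subgraph problem
    (∀ s, net.equalPower s ∈ net.allocations s) ∧
    ((∀ n m i j, net.crossGain n m i j = 0) →
      ∀ (q : MUMIMO.QVec N F) (fs : N → N → F) (s : N → Bool) (p : MUMIMO.Alloc N), 0 ≤ q →
        MUMIMO.Network.IsTopFlow q fs →
        (net.IsMBPChoice (fun s => {net.equalPower s}) q fs s p ↔
          p = net.equalPower s ∧ net.IsMaxWeightDBSG q fs s)) := by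
  refine ⟨MUMIMO.Network.capacityRegion_mono hPc,
    fun x hx Ω _ μ _ R K hK hR hlam => hR.stable_of_mem_capacityInterior hPc hK hx hlam,
    fun D U hU hint obj hobj => ?_, net.equalPower_mem_allocations,
    fun h0 q fs s p hq hfs => MUMIMO.Network.isMBPChoice_equalPower_iff h0 hq hfs s p⟩
  have hobj : Set.EqOn obj (net.sourceUtility U) (net.sourceVectors D) := by
    obtain rfl | ⟨hsrc, rfl⟩ := hobj
    · exact Set.eqOn_refl _ _
    · exact fun x hx => MUMIMO.Network.flowUtility_eq_sourceUtility hsrc hx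
  refine ⟨fun K => ⟨net.mbpGapConst K, fun V hV Ω _ μ _ R hK hR hA =>
    ⟨hR.stable_of_isANCC hA hV hPc hU hint hK, fun x hx => ?_⟩⟩,
    fun x hx hmax K ε hε => ?_⟩
  · filter_upwards [hR.ae_eventually_le_sourceUtility_avgRate hA hV hPc hU hint hK hx] with ω hω
    filter_upwards [hω] with T ⟨hmem, hle⟩
    rwa [hobj hx.2, hobj hmem]
  · have hmax' : IsMaxOn (net.sourceUtility U) (net.numFeasible Pc D) x := fun y hy =>
      (hobj hy.2).symm.trans_le <| (hmax hy).trans_eq (hobj hx.2)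
    exact MUMIMO.Network.exists_forall_ae_eventually_dist_lt hPc hU hint hx hmax' K hε
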